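/- **Setting.** Let $T\ge 1$, let $\omega\in\mathbb C$ be a primitive $T$-th root of unity, and let $\Pi=\langle \mathsf s,\mathsf t\mid \mathsf s^T=\mathsf t^2=(\mathsf s\mathsf t)^2=1\rangle$ act on $\mathbb P^1$ by $\mathsf s:z\mapsto\omega z$, $\mathsf t:z\mapsto\bar z$. Let $\mathfrak g$ be a finite-dimensional complex Lie algebra with an automorphism $\sigma$, $\sigma^T=1$, an anti-linear involutive automorphism $\tau$ stabilising the eigenspaces of $\sigma$, and a non-degenerate invariant symmetric bilinear form $\langle\cdot,\cdot\rangle$ with $\langle\sigma x,\sigma y\rangle=\langle x,y\rangle$ and $\langle\tau x,\tau y\rangle=\overline{\langle x,y\rangle}$. Let $\tilde{\mathfrak g}=\mathfrak g\otimes\mathbb C[t,t^{-1}]\oplus\mathbb C\mathsf K\oplus\mathbb C\mathsf D$, write $x_n=x\otimes t^n$, extend $\sigma$ by $x_n\mapsto(\sigma x)_n$, $\mathsf K\mapsto\mathsf K$, $\mathsf D\mapsto\mathsf D$ and $\tau$ anti-linearly by $x_n\mapsto(\tau x)_{-n}$, $\mathsf K\mapsto-\mathsf K$, $\mathsf D\mapsto-\mathsf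 D$, and let $(x_m+\alpha\mathsf K+\xi\mathsf D\,|\,y_n+\beta\mathsf K+\upsilon\mathsf D)=\langle x,y\rangle\delta_{m+n,0}+\alpha\upsilon+\xi\beta$. Put $\mathsf F_n\tilde{\mathfrak g}=\mathfrak g\otimes t^n\mathbb C[t]$, $\overline{\mathsf F}_n\tilde{\mathfrak g}=\mathfrak g\otimes t^{-n}\mathbb C[t^{-1}]$. Let $\mathcal D=\sum_{x}n_x x+n_\infty\infty$, with finitely many $x\in\mathbb C$, all $n_x\ge1$, $n_\infty\ge 1$, and with the points in pairwise disjoint $\Pi$-orbits; $n_0:=0$ if $0$ is not among them. The points $x\neq\infty$ with $n_x\ge1$ are divided into $\boldsymbol z_c$ (trivial stabiliser), $\boldsymbol z_r^k$, $k\in\mathbb Z_T$ ($x\ne0$, $\omega^k\bar x=x$), and possibly $0$. Let $$\mathcal T^{\mathcal D}\tilde{\mathfrak g}=\bigoplus_{x\ne\infty}\tilde{\mathfrak g}[\varepsilon_x]/(\varepsilon_x^{n_x})\oplus\varepsilon_\infty\tilde{\mathfrak g}[\varepsilon_\infty]/(\varepsilon_\infty^{n_\infty}),$$ where $\mathsf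 t$ acts by $\tau$ and $\mathsf s$ by $\sigma$ together with $\varepsilon_x\mapsto\omega^{-1}\varepsilon_{\omega x}$, $\varepsilon_\infty\mapsto\omega\varepsilon_\infty$, and let $\tilde{\mathfrak g}^{\mathcal D}$ be the real subspace of elements invariant, at each point $x$, under the stabiliser $\Pi_x$. Let $\Omega_{\Pi\mathcal D}$ be the complex space of meromorphic differentials on $\mathbb P^1$ with poles of order at most $n_x$ at the points of $\Pi x$, at most $n_\infty$ at $\infty$, and no other poles. $\Pi$ acts on it by $\mathsf s.(f\,dz)=f(\omega^{-1}z)\,\omega^{-1}dz$, $\mathsf t.(f\,dz)=\overline{f(\bar z)}\,dz$. For a complex vector space $V$ with (anti-)linear operators $r_\alpha$, $\alpha\in\Pi$, put $\Omega_{\Pi\mathcal D}(V)=V\otimes\Omega_{\Pi\mathcal D}$ and $\hat\alpha(v\otimes\varpi)=r_\alpha v\otimes\alpha.\varpi$. Let $\Omega^\Pi_{\mathcal D}(\tilde{\mathfrak g})=\Omega_{\Pi\mathcal D}(\tilde{\mathfrak g})^\Pi$, paired with $\tilde{\mathfrak g}^{\mathcal D}$ by $$\langle\!\langle\varphi,X\rangle\!\rangle=\operatorname{Re}\sum_x\frac{2T}{|\Pi_x|}\operatorname{res}_x(\varphi|X_x),$$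 where $\varepsilon_x$ is replaced by $z-x$ and $\varepsilon_\infty$ by $z^{-1}$ in $X_x$. **Bases.** Let $\mathfrak g_{k,p}=\{x:\sigma^k\tau x=\omega^{kp}x\}$ and $\mathfrak g_{(j)}=\{x:\sigma x=\omega^jx,\ \tau x=x\}$. Fix bases $I^a_{k,p}$ of $\mathfrak g_{k,p}$ and $I^{(j,\alpha)}$ of $\mathfrak g_{(j)}$ over $\mathbb R$, with dual bases $I_{a;k,-p}$ of $\mathfrak g_{k,-p}$ and $I_{(-j,\alpha)}$ of $\mathfrak g_{(-j)}$; let $I^a=I^a_{0,0}$, $I_a=I_{a;0,0}$, and fix a square root $\omega^{1/2}$ of $\omega$. Let $I^{\tilde a}$ run over the basis $I^a_n,\mathsf K,\mathsf D$ of $\tilde{\mathfrak g}$, with dual basis $I_{\tilde a}$: $I_{a,-n},\mathsf D,\mathsf K$. Let $I^{\tilde a}_{k,p}$ run over $I_0$, $\frac1{\sqrt2}(I_n+I_{-n})$, $\frac i{\sqrt2}(I_n-I_{-n})$ with $n>0$ and $I=I^a_{k,p}$, and $i\omega^{-kp/2}\mathsf K$, $i\omega^{-kp/2}\mathsf D$;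 let $I_{\tilde a;k,-p}$ run over the same expressions with $I=I_{a;k,-p}$, and $-i\omega^{kp/2}\mathsf D$, $-i\omega^{kp/2}\mathsf K$. Define $I^{(j,\tilde\alpha)}$, $I_{(-j,\tilde\alpha)}$ in the same way from $I^{(j,\alpha)}$, $I_{(-j,\alpha)}$, with $i\mathsf K,i\mathsf D$, respectively $-i\mathsf D,-i\mathsf K$, included only if $j\equiv0$ mod $T$. The *level* of an index is $n$, respectively $|n|$, for the modes $\pm n$, and $0$ for $\mathsf K$, $\mathsf D$. Infinite sums over such indices are limits as $N\to\infty$ of the sums over levels $<N$. **Completions and fields.** For a complex space with a descending filtration, the completion is the inverse limit of the quotients. Let $c$ be the conjugation of a complexification $W_{\mathbb C}=W\otimes_{\mathbb R}\mathbb C$. For $\mathsf X\in\tilde{\mathfrak g}$ put $\mathsf X^{(x)}_{p,\mathbb C}=\frac12\big((\mathsf X\varepsilon_x^p)\otimes1-(i\mathsf X\varepsilon_x^p)\otimes i\big)\in(\mathcal T^{\mathcal D}\tilde{\mathfrak g})_{\mathbb C}$. Let $\mathsf F_n((\mathcal T^{\mathcal D}\tilde{\mathfrak g})_{\mathbb C})$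 be spanned by all $\mathsf X^{(x)}_{p,\mathbb C}$, $\mathsf X\in\mathsf F_n\tilde{\mathfrak g}$, and $c(\mathsf X^{(x)}_{p,\mathbb C})$, $\mathsf X\in\overline{\mathsf F}_n\tilde{\mathfrak g}$. Let $\mathsf F_n(\tilde{\mathfrak g}^{\mathcal D}_{\mathbb C})$ be spanned by these elements for $x\in\boldsymbol z_c$; by $\mathsf X^{(x)}_{p,\mathbb C}+c\big((\omega^{-kp}\sigma^k\tau\mathsf X)^{(x)}_{p,\mathbb C}\big)$, $\mathsf X\in\mathsf F_n\tilde{\mathfrak g}$, for $x\in\boldsymbol z_r^k$; and by $\mathsf X^{(x)}_{p,\mathbb C}+c\big((\tau\mathsf X)^{(x)}_{p,\mathbb C}\big)$, $\mathsf X\in\mathsf F_n\tilde{\mathfrak g}$, for $x\in\{0,\infty\}$, where $\sigma\mathsf X=\omega^p\mathsf X$ if $x=0$ and $\sigma\mathsf X=\omega^{-p}\mathsf X$ if $x=\infty$. Let $\mathfrak F$ and $\mathfrak F_{\mathbb C}$ be the completions of $\tilde{\mathfrak g}\otimes U$, for $U=\tilde{\mathfrak g}^{\mathcal D}_{\mathbb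 C}$ and $U=(\mathcal T^{\mathcal D}\tilde{\mathfrak g})_{\mathbb C}$, with respect to $\mathsf F_n\tilde{\mathfrak g}\otimes c(\mathsf F_nU)+\overline{\mathsf F}_n\tilde{\mathfrak g}\otimes\mathsf F_nU$; $\Pi$ acts on them by $r_{\mathsf s}=\sigma\otimes\mathrm{id}$, $r_{\mathsf t}=\tau\otimes c$. There is a map $\mathfrak F\to\mathfrak F_{\mathbb C}$ induced by $\tilde{\mathfrak g}^{\mathcal D}\subset\mathcal T^{\mathcal D}\tilde{\mathfrak g}$. Let $\Omega^\Pi_{\mathcal D}(\tilde{\mathfrak g})\hat\otimes_{\mathbb R}\tilde{\mathfrak g}^{\mathcal D}$ be the completion with respect to the preimages of $\Omega_{\Pi\mathcal D}(\mathsf F_n(\tilde{\mathfrak g}\otimes\tilde{\mathfrak g}^{\mathcal D}_{\mathbb C}))$ under $\zeta:(\mathsf X\otimes\varpi)\otimes_{\mathbb R}Y\mapsto(\mathsf X\otimes(Y\otimes1))\otimes\varpi$, and extend $\zeta$ to a map from it to $\Omega_{\Pi\mathcal D}(\mathfrak F)$ by continuity. **Proposition.** (a) $\tilde{\mathfrak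 g}^{\mathcal D}$ has the real basis $\{I^A\}$: $I^{\tilde a}\varepsilon_x^p$, $iI^{\tilde a}\varepsilon_x^p$ ($x\in\boldsymbol z_c$), $I^{\tilde a}_{k,p}\varepsilon_x^p$ ($x\in\boldsymbol z_r^k$), $0\le p<n_x$; $I^{(p,\tilde\alpha)}\varepsilon_0^p$, $0\le p<n_0$; $I^{(-q-1,\tilde\alpha)}\varepsilon_\infty^{q+1}$, $0\le q\le n_\infty-2$. The space $\Omega^\Pi_{\mathcal D}(\tilde{\mathfrak g})$ has a real basis $\{I_A\}$ dual to it: $\langle\!\langle I_A,I^B\rangle\!\rangle=\delta_A^B$. (b) The following sums converge in $\mathfrak F$: for $x\in\boldsymbol z_c$, $$\mathcal A^x_p=\sum_{\tilde a}I_{\tilde a}\otimes\tfrac12\big((I^{\tilde a}\varepsilon_x^p)\otimes1-(iI^{\tilde a}\varepsilon_x^p)\otimes i\big),\qquad\mathcal A^{\bar x}_p=\sum_{\tilde a}\tau I_{\tilde a}\otimes\tfrac12\big((I^{\tilde a}\varepsilon_x^p)\otimes1+(iI^{\tilde a}\varepsilon_x^p)\otimes i\big);$$ for $x\in\boldsymbol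 z_r^k$, $\mathcal A^x_p=\sum_{\tilde a}I_{\tilde a;k,-p}\otimes(I^{\tilde a}_{k,p}\varepsilon_x^p\otimes1)$; and $\mathcal A^0_p=\sum_{\tilde\alpha}I_{(-p,\tilde\alpha)}\otimes(I^{(p,\tilde\alpha)}\varepsilon_0^p\otimes1)$, $\mathcal A^\infty_{q+1}=\sum_{\tilde\alpha}I_{(q+1,\tilde\alpha)}\otimes(I^{(-q-1,\tilde\alpha)}\varepsilon_\infty^{q+1}\otimes1)$. The sums $\mathcal A^x_{p,\mathbb C}=\sum_{\tilde a}I_{\tilde a}\otimes (I^{\tilde a})^{(x)}_{p,\mathbb C}$, for all points $x$ (including $0$ and $\infty$), converge in $\mathfrak F_{\mathbb C}$. (c) The canonical element $\Phi=\sum_AI_A\otimes_{\mathbb R}I^A$ converges in $\Omega^\Pi_{\mathcal D}(\tilde{\mathfrak g})\hat\otimes_{\mathbb R}\tilde{\mathfrak g}^{\mathcal D}$, its image $\zeta(\Phi)\in\Omega_{\Pi\mathcal D}(\mathfrak F)$ is $\Pi$-invariant, and $$\zeta(\Phi)=\frac1T\sum_{k=0}^{T-1}\hat{\mathsf s}^k\Big[\sum_{x\in\boldsymbol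 z_c\cup\bar{\boldsymbol z}_c\cup\bigcup_l\boldsymbol z_r^l}\ \sum_{p=0}^{n_x-1}\frac{\mathcal A^x_p}{(z-x)^{p+1}}dz\Big]+\sum_{p=0}^{n_0-1}\mathcal A^0_pz^{-p-1}dz-\sum_{q=0}^{n_\infty-2}\mathcal A^\infty_{q+1}z^qdz,$$ with $n_{\bar x}:=n_x$ for $x\in\boldsymbol z_c$. (d) The image of $\zeta(\Phi)$ in $\mathfrak F_{\mathbb C}\otimes\{\text{meromorphic differentials}\}$ is $$\frac1T\sum_{\alpha\in\Pi}\hat\alpha\Big[\sum_{x\ne\infty}\sum_{p=0}^{n_x-1}\frac{\mathcal A^x_{p,\mathbb C}}{(z-x)^{p+1}}dz-\sum_{q=0}^{n_\infty-2}\mathcal A^\infty_{q+1,\mathbb C}z^qdz\Big],$$ where $x$ runs over all finite points of $\mathcal D$, including $0$ if present. -/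

import Mathlib

open scoped TensorProduct

noncomputable section

namespace Gaudin

/-! ### Semilinear maps, the dihedral group -/

theorem real_smul_eq {V : Type*} [AddCommGroup V] [Module ℂ V] [Module ℝ V]
    [IsScalarTower ℝ ℂ V] (r : ℝ) (v : V) : r • v = (r : ℂ) • v := by
  rw [← one_smul ℂ v, ← smul_assoc, smul_smul, Complex.real_smul]

/-- A conjugate-linear map, seen as a map of real vector spaces. -/
def toReal {V W : Type*} [AddCommGroup V] [AddCommGroup W] [Module ℂ V] [Module ℂ W]
    [Module ℝ V] [Module ℝ W] [IsScalarTower ℝ ℂ V] [IsScalarTower ℝ ℂ W]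
    (f : V →ₛₗ[starRingEnd ℂ] W) : V →ₗ[ℝ] W where
  toFun := f
  map_add' := f.map_add
  map_smul' r v := by
    simp only [RingHom.id_apply]
    rw [real_smul_eq r v, real_smul_eq r (f v), f.map_smulₛₗ, Complex.conj_ofReal]

/-- The maps by which the elements of the dihedral group `⟨s, t | s ^ T = t ^ 2 = (s t) ^ 2 = 1⟩`
act, when `s` acts by `S` and `t` by `R`.  In Mathlib's notation `s = r 1`, `t = sr 0` and
`sr i = t s ^ i`. -/
def dihedralAct {V : Type*} [AddCommGroup V] [Module ℝ V] {T : ℕ} (S R : Module.End ℝ V) :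
    DihedralGroup T → Module.End ℝ V
  | .r i => S ^ i.val
  | .sr i => R * S ^ i.val

/-- The action of the dihedral group on the complex plane, `s : z ↦ ω z`, `t : z ↦ conj z`. -/
def mob {T : ℕ} (ω : ℂ) : DihedralGroup T → ℂ → ℂ
  | .r i => fun z => ω ^ i.val * z
  | .sr i => fun z => starRingEnd ℂ (ω ^ i.val * z)

/-! ### The finite-dimensional Lie algebra -/

/-- A complex Lie algebra with an automorphism `σ` with `σ ^ T = 1`, a conjugate-linear
involutive automorphism `τ` stabilising the eigenspaces of `σ`, and a non-degenerate invariant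
symmetric bilinear form which is `σ`-invariant and real with respect to `τ`. -/
structure LieData (g : Type*) [LieRing g] [LieAlgebra ℂ g] (T : ℕ) where
  ω : ℂ
  ω_prim : IsPrimitiveRoot ω T
  σ : g ≃ₗ⁅ℂ⁆ g
  σ_pow : ∀ x, σ^[T] x = x
  τ : g →ₛₗ[starRingEnd ℂ] g
  τ_lie : ∀ x y, τ ⁅x, y⁆ = ⁅τ x, τ y⁆
  τ_invol : ∀ x, τ (τ x) = x
  τ_stable : ∀ (j : ℕ) (x : g), σ x = ω ^ j • x → σ (τ x) = ω ^ j • τ x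
  form : LinearMap.BilinForm ℂ g
  form_symm : ∀ x y, form x y = form y x
  form_nondeg : form.Nondegenerate
  form_inv : ∀ x y z, form ⁅x, y⁆ z = form x ⁅y, z⁆
  form_σ : ∀ x y, form (σ x) (σ y) = form x y
  form_τ : ∀ x y, form (τ x) (τ y) = starRingEnd ℂ (form x y)

section LieSection

variable {g : Type*} [LieRing g] [LieAlgebra ℂ g] {T : ℕ}

/-- `σ` as a linear map. -/
def LieData.σL (L : LieData g T) : g →ₗ[ℂ] g := (L.σ : g →ₗ⁅ℂ⁆ g).toLinearMap

/-- The real form `g_{k,p} = {x | σ ^ k τ x = ω ^ (k p) x}`. -/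
def LieData.gkp (L : LieData g T) (k p : ZMod T) : Submodule ℝ g :=
  LinearMap.eqLocus
    ((L.σL.restrictScalars ℝ) ^ k.val * toReal L.τ : Module.End ℝ g)
    (((L.ω ^ (k.val * p.val)) • (LinearMap.id : g →ₗ[ℂ] g)).restrictScalars ℝ)

/-- The real form `g_(j) = {x | σ x = ω ^ j x, τ x = x}` of the `ω ^ j`-eigenspace of `σ`. -/
def LieData.gj (L : LieData g T) (j : ZMod T) : Submodule ℝ g :=
  LinearMap.eqLocus (L.σL.restrictScalars ℝ)
    (((L.ω ^ j.val) • (LinearMap.id : g →ₗ[ℂ] g)).restrictScalars ℝ) ⊓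
  LinearMap.eqLocus (toReal L.τ) LinearMap.id

/-- A choice of a square root `η` of `ω`, and of bases of the real forms `g_{k,p}` and `g_(j)`
together with their dual bases, in `g_{k,-p}` and `g_(-j)`, with respect to the form. -/
structure BasisData (L : LieData g T) where
  η : ℂ
  η_sq : η ^ 2 = L.ω
  d : ℕ
  b : ∀ k p : ZMod T, Module.Basis (Fin d) ℝ (L.gkp k p)
  bd : ∀ k p : ZMod T, Module.Basis (Fin d) ℝ (L.gkp k (-p))
  b_dual : ∀ (k p : ZMod T) (a a' : Fin d),
    L.form (bd k p a : g) (b k p a' : g) = if a = a' then 1 else 0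
  m : ZMod T → ℕ
  c : ∀ j : ZMod T, Module.Basis (Fin (m j)) ℝ (L.gj j)
  cd : ∀ j : ZMod T, Module.Basis (Fin (m j)) ℝ (L.gj (-j))
  c_dual : ∀ (j : ZMod T) (a a' : Fin (m j)),
    L.form (cd j a : g) (c j a' : g) = if a = a' then 1 else 0

/-! ### The affine Kac-Moody algebra -/

variable (g) in
/-- The vector space `g ⊗ ℂ[t, t⁻¹] ⊕ ℂ K ⊕ ℂ D`.  A triple `(x, α, β)` stands for
`∑ n, x n ⊗ t ^ n + α K + β D`. -/
def AffineKM : Type _ := (ℤ →₀ g) × ℂ × ℂ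

instance : AddCommGroup (AffineKM g) := inferInstanceAs (AddCommGroup ((ℤ →₀ g) × ℂ × ℂ))

instance : Module ℂ (AffineKM g) := inferInstanceAs (Module ℂ ((ℤ →₀ g) × ℂ × ℂ))

namespace AffineKM

/-- The component in `g ⊗ ℂ[t, t⁻¹]`. -/
def loopPart : AffineKM g →ₗ[ℂ] (ℤ →₀ g) := LinearMap.fst ℂ (ℤ →₀ g) (ℂ × ℂ)

/-- The coefficient of `K`. -/
def kPart : AffineKM g →ₗ[ℂ] ℂ :=
  LinearMap.fst ℂ ℂ ℂ ∘ₗ LinearMap.snd ℂ (ℤ →₀ g) (ℂ × ℂ)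

/-- The coefficient of `D`. -/
def dPart : AffineKM g →ₗ[ℂ] ℂ :=
  LinearMap.snd ℂ ℂ ℂ ∘ₗ LinearMap.snd ℂ (ℤ →₀ g) (ℂ × ℂ)

/-- The element `x_n = x ⊗ t ^ n`. -/
def mode (x : g) (n : ℤ) : AffineKM g := (Finsupp.single n x, 0, 0)

variable (g) in
/-- The central element `K`. -/
def K : AffineKM g := (0, 1, 0)

variable (g) in
/-- The derivation element `D`. -/
def D : AffineKM g := (0, 0, 1)

end AffineKM

open AffineKM

/-- The bilinear form on the affine Kac-Moody algebra:
`(x_m + α K + ξ D | y_n + β K + υ D) = ⟨x, y⟩ δ_{m + n, 0} + α υ + ξ β`. -/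
def LieData.kmForm (L : LieData g T) : LinearMap.BilinForm ℂ (AffineKM g) :=
  LinearMap.compl₁₂
      (Finsupp.lsum ℂ fun n : ℤ => L.form.compl₂ (Finsupp.lapply (-n) : (ℤ →₀ g) →ₗ[ℂ] g))
      loopPart loopPart +
    LinearMap.compl₁₂ (LinearMap.mul ℂ ℂ) kPart dPart +
    LinearMap.compl₁₂ (LinearMap.mul ℂ ℂ) dPart kPart

/-- The lift of `σ`: `x_n ↦ (σ x)_n`, `K ↦ K`, `D ↦ D`. -/
def LieData.σt (L : LieData g T) : AffineKM g →ₗ[ℂ] AffineKM g :=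
  LinearMap.prodMap (Finsupp.mapRange.linearMap L.σL) (LinearMap.id : ℂ × ℂ →ₗ[ℂ] ℂ × ℂ)

/-- The conjugate-linear lift of `τ`: `x_n ↦ (τ x)_{-n}`, `K ↦ -K`, `D ↦ -D`. -/
def LieData.τt (L : LieData g T) : AffineKM g →ₛₗ[starRingEnd ℂ] AffineKM g where
  toFun X := ((Finsupp.mapRange.linearMap L.τ X.1).comapDomain (fun n : ℤ => -n)
      neg_injective.injOn, -starRingEnd ℂ X.2.1, -starRingEnd ℂ X.2.2)
  map_add' X Y := by
    refine Prod.ext ?_ (Prod.ext ?_ ?_)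
    · ext n
      simp only [Finsupp.comapDomain_apply]
      change L.τ ((X.1 + Y.1) (-n)) = L.τ (X.1 (-n)) + L.τ (Y.1 (-n))
      simp
    · change -starRingEnd ℂ (X.2.1 + Y.2.1) = -starRingEnd ℂ X.2.1 + -starRingEnd ℂ Y.2.1
      rw [map_add, neg_add]
    · change -starRingEnd ℂ (X.2.2 + Y.2.2) = -starRingEnd ℂ X.2.2 + -starRingEnd ℂ Y.2.2
      rw [map_add, neg_add]
  map_smul' a X := by
    refine Prod.ext ?_ (Prod.ext ?_ ?_)
    · ext n
      simp only [Finsupp.comapDomain_apply]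
      change L.τ (a • X.1 (-n)) = starRingEnd ℂ a • L.τ (X.1 (-n))
      exact L.τ.map_smulₛₗ a _
    · change -starRingEnd ℂ (a * X.2.1) = starRingEnd ℂ a * -starRingEnd ℂ X.2.1
      rw [map_mul, mul_neg]
    · change -starRingEnd ℂ (a * X.2.2) = starRingEnd ℂ a * -starRingEnd ℂ X.2.2
      rw [map_mul, mul_neg]

variable (g) in
/-- `F_n = g ⊗ t ^ n ℂ[t]`. -/
def Fpos (n : ℕ) : Submodule ℂ (AffineKM g) where
  carrier := {X | (∀ m : ℤ, m < n → loopPart X m = 0) ∧ kPart X = 0 ∧ dPart X = 0}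
  zero_mem' := by simp
  add_mem' := by
    rintro X Y ⟨h1, h2, h3⟩ ⟨h1', h2', h3'⟩
    refine ⟨fun m hm => ?_, by simp [h2, h2'], by simp [h3, h3']⟩
    simp [h1 m hm, h1' m hm]
  smul_mem' := by
    rintro a X ⟨h1, h2, h3⟩
    refine ⟨fun m hm => ?_, by simp [h2], by simp [h3]⟩
    simp [h1 m hm]

variable (g) in
/-- `F̄_n = g ⊗ t ^ (-n) ℂ[t⁻¹]`. -/
def Fneg (n : ℕ) : Submodule ℂ (AffineKM g) where
  carrier := {X | (∀ m : ℤ, -n < m → loopPart X m = 0) ∧ kPart X = 0 ∧ dPart X = 0}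
  zero_mem' := by simp
  add_mem' := by
    rintro X Y ⟨h1, h2, h3⟩ ⟨h1', h2', h3'⟩
    refine ⟨fun m hm => ?_, by simp [h2, h2'], by simp [h3, h3']⟩
    simp [h1 m hm, h1' m hm]
  smul_mem' := by
    rintro a X ⟨h1, h2, h3⟩
    refine ⟨fun m hm => ?_, by simp [h2], by simp [h3]⟩
    simp [h1 m hm]

theorem σt_mem_Fpos (L : LieData g T) {n : ℕ} {X : AffineKM g} (h : X ∈ Fpos g n) :
    L.σt X ∈ Fpos g n := by
  obtain ⟨h1, h2, h3⟩ := h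
  refine ⟨fun m hm => ?_, h2, h3⟩
  change L.σL (loopPart X m) = 0
  rw [h1 m hm, map_zero]

theorem σt_mem_Fneg (L : LieData g T) {n : ℕ} {X : AffineKM g} (h : X ∈ Fneg g n) :
    L.σt X ∈ Fneg g n := by
  obtain ⟨h1, h2, h3⟩ := h
  refine ⟨fun m hm => ?_, h2, h3⟩
  change L.σL (loopPart X m) = 0
  rw [h1 m hm, map_zero]

theorem τt_mem_Fneg (L : LieData g T) {n : ℕ} {X : AffineKM g} (h : X ∈ Fpos g n) :
    L.τt X ∈ Fneg g n := by
  obtain ⟨h1, h2, h3⟩ := h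
  refine ⟨fun m hm => ?_, ?_, ?_⟩
  · change L.τ (loopPart X (-m)) = 0
    rw [h1 (-m) (by omega), map_zero]
  · change -starRingEnd ℂ (kPart X) = 0
    simp [h2]
  · change -starRingEnd ℂ (dPart X) = 0
    simp [h3]

theorem τt_mem_Fpos (L : LieData g T) {n : ℕ} {X : AffineKM g} (h : X ∈ Fneg g n) :
    L.τt X ∈ Fpos g n := by
  obtain ⟨h1, h2, h3⟩ := h
  refine ⟨fun m hm => ?_, ?_, ?_⟩
  · change L.τ (loopPart X (-m)) = 0
    rw [h1 (-m) (by omega), map_zero]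
  · change -starRingEnd ℂ (kPart X) = 0
    simp [h2]
  · change -starRingEnd ℂ (dPart X) = 0
    simp [h3]

end LieSection

/-! ### The divisor and the Takiff algebra -/

/-- A divisor `∑ x, n x • x + nInf • ∞` on the Riemann sphere whose support consists of `∞` and of
finitely many points of `ℂ` with pairwise disjoint orbits. -/
structure Divisor (T : ℕ) (ω : ℂ) where
  n : ℂ →₀ ℕ
  nInf : ℕ
  nInf_pos : 1 ≤ nInf
  disjoint : ∀ x ∈ n.support, ∀ y ∈ n.support, x ≠ y → ∀ α : DihedralGroup T, mob ω α x ≠ y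

section DivisorSection

variable {T : ℕ} {ω : ℂ}

/-- The points of trivial stabiliser. -/
def Divisor.cplxPts (Z : Divisor T ω) : Finset ℂ := by
  classical
  exact Z.n.support.filter fun x => x ≠ 0 ∧ ∀ k : ZMod T, ω ^ k.val * starRingEnd ℂ x ≠ x

/-- The non-zero points whose stabiliser is generated by `s ^ k t`. -/
def Divisor.realPts (Z : Divisor T ω) (k : ZMod T) : Finset ℂ := by
  classical
  exact Z.n.support.filter fun x => x ≠ 0 ∧ ω ^ k.val * starRingEnd ℂ x = x

/-- Indices of the summands `g̃ ε_x ^ p`, `p < n x`, and `g̃ ε_∞ ^ (q + 1)`, `q < nInf - 1`. -/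
abbrev Slot (Z : Divisor T ω) : Type :=
  (Σ x : {x : ℂ // x ∈ Z.n.support}, Fin (Z.n x)) ⊕ Fin (Z.nInf - 1)

theorem Divisor.mem_of_cplx (Z : Divisor T ω) {x : ℂ} (h : x ∈ Z.cplxPts) : x ∈ Z.n.support := by
  classical
  exact (Finset.mem_filter.1 h).1

theorem Divisor.mem_of_real (Z : Divisor T ω) {k : ZMod T} {x : ℂ} (h : x ∈ Z.realPts k) :
    x ∈ Z.n.support := by
  classical
  exact (Finset.mem_filter.1 h).1

theorem Divisor.zero_mem (Z : Divisor T ω) (p : Fin (Z.n 0)) : (0 : ℂ) ∈ Z.n.support := by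
  rw [Finsupp.mem_support_iff]
  have := p.2
  omega

/-- `α` fixes the point of a slot. -/
def Fixes {Z : Divisor T ω} : Slot Z → DihedralGroup T → Prop
  | .inl s, α => mob ω α (s.1 : ℂ) = s.1
  | .inr _, _ => True

/-- The scalar by which `s` acts on the local coordinate factor of a slot: `ε_x ↦ ω⁻¹ ε_{ω x}` and
`ε_∞ ↦ ω ε_∞`. -/
def slotWeight {Z : Divisor T ω} : Slot Z → ℂ
  | .inl s => (ω ^ (s.2 : ℕ))⁻¹
  | .inr q => ω ^ ((q : ℕ) + 1)

variable {g : Type*} [LieRing g] [LieAlgebra ℂ g]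

/-- The space `⨁_x g̃[ε_x]/(ε_x ^ (n x)) ⊕ ε_∞ g̃[ε_∞]/(ε_∞ ^ nInf)`. -/
abbrev TakD (g : Type*) [LieRing g] [LieAlgebra ℂ g] (Z : Divisor T ω) : Type _ :=
  Slot Z → AffineKM g

/-- The element `X ⊗ ε_x ^ p`, respectively `X ⊗ ε_∞ ^ (q + 1)`. -/
def tak {Z : Divisor T ω} (s : Slot Z) : AffineKM g →ₗ[ℂ] TakD g Z := by
  classical
  exact LinearMap.single ℂ (fun _ : Slot Z => AffineKM g) s

end DivisorSection

section Takiff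

variable {g : Type*} [LieRing g] [LieAlgebra ℂ g] {T : ℕ} (L : LieData g T) (Z : Divisor T L.ω)

/-- Slot by slot action of `s`. -/
def takS : TakD g Z →ₗ[ℂ] TakD g Z :=
  LinearMap.pi fun s => slotWeight s • (L.σt ∘ₗ LinearMap.proj s)

/-- Slot by slot action of `t`. -/
def takT : TakD g Z →ₛₗ[starRingEnd ℂ] TakD g Z where
  toFun X s := L.τt (X s)
  map_add' X Y := by ext1 s; simp
  map_smul' a X := by ext1 s; exact L.τt.map_smulₛₗ a (X s)

/-- The real vector space underlying the Lie algebra `g̃^D`: at every point, the elements of the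
Takiff algebra that are invariant under the stabiliser of the point. -/
def gD : Submodule ℝ (TakD g Z) where
  carrier := {X | ∀ (s : Slot Z) (α : DihedralGroup T), Fixes s α →
    dihedralAct ((takS L Z).restrictScalars ℝ) (toReal (takT L Z)) α X s = X s}
  zero_mem' := by intro s α _; rw [map_zero]
  add_mem' := by intro X Y hX hY s α h; rw [map_add, Pi.add_apply, hX s α h, hY s α h]; rfl
  smul_mem' := by intro r X hX s α h; rw [map_smul, Pi.smul_apply, hX s α h]; rfl

end Takiff

/-! ### Meromorphic differentials -/

/-- The substitution `f ↦ f ∘ u` in rational functions. -/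
def ratComp (u : RatFunc ℂ) (hu : Transcendental ℂ u) : RatFunc ℂ →ₐ[ℂ] RatFunc ℂ :=
  IsFractionRing.liftAlgHom (g := (Polynomial.aeval u : Polynomial ℂ →ₐ[ℂ] RatFunc ℂ))
    (transcendental_iff_injective.1 hu)

theorem transcendental_inv_X : Transcendental ℂ (RatFunc.X⁻¹ : RatFunc ℂ) :=
  fun h => RatFunc.transcendental_X (IsAlgebraic.inv_iff.1 h)

/-- A polynomial, as a Laurent series. -/
def polyToLaurent : Polynomial ℂ →+* LaurentSeries ℂ :=
  (HahnSeries.ofPowerSeries ℤ ℂ).comp Polynomial.coeToPowerSeries.ringHom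

theorem polyToLaurent_injective : Function.Injective polyToLaurent :=
  (HahnSeries.ofPowerSeries_injective (Γ := ℤ) (R := ℂ)).comp (Polynomial.coe_injective ℂ)

/-- Laurent expansion at the origin. -/
def germZero : RatFunc ℂ →+* LaurentSeries ℂ := IsFractionRing.lift polyToLaurent_injective

theorem germZero_smul (a : ℂ) (f : RatFunc ℂ) (n : ℤ) :
    (germZero (a • f)).coeff n = a * (germZero f).coeff n := by
  have h1 : germZero (algebraMap (Polynomial ℂ) (RatFunc ℂ) (Polynomial.C a)) =
      HahnSeries.C a := by
    unfold germZero
    rw [IsFractionRing.lift_algebraMap]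
    simp [polyToLaurent]
  have h2 : a • f = algebraMap (Polynomial ℂ) (RatFunc ℂ) (Polynomial.C a) * f := by
    rw [RatFunc.algebraMap_C, RatFunc.smul_eq_C_mul]
  rw [h2, map_mul, h1, HahnSeries.C_mul_eq_smul]
  simp

/-- The `n`-th coefficient of the Laurent expansion of `f` at `x`, in the variable `z - x`. -/
def coeffAt (x : ℂ) (n : ℤ) : RatFunc ℂ →ₗ[ℂ] ℂ where
  toFun f := (germZero (RatFunc.laurent x f)).coeff n
  map_add' f h := by simp
  map_smul' a f :=
    (congrArg (fun h => (germZero h).coeff n) ((RatFunc.laurent x).toLinearMap.map_smul a f)).trans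
      (germZero_smul a _ n)

/-- The `n`-th coefficient of the Laurent expansion of `f` at `∞`, in the variable `z⁻¹`. -/
def coeffInf (n : ℤ) : RatFunc ℂ →ₗ[ℂ] ℂ where
  toFun f := (germZero (ratComp RatFunc.X⁻¹ transcendental_inv_X f)).coeff n
  map_add' f h := by simp
  map_smul' a f :=
    (congrArg (fun h => (germZero h).coeff n)
      ((ratComp RatFunc.X⁻¹ transcendental_inv_X).toLinearMap.map_smul a f)).trans
      (germZero_smul a _ n)

theorem transcendental_scale_X {a : ℂ} (ha : a ≠ 0) :
    Transcendental ℂ (RatFunc.C a * RatFunc.X : RatFunc ℂ) := by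
  intro h
  refine RatFunc.transcendental_X (K := ℂ) ?_
  have h1 : (RatFunc.X : RatFunc ℂ) = RatFunc.C a⁻¹ * (RatFunc.C a * RatFunc.X) := by
    rw [← mul_assoc, ← map_mul, inv_mul_cancel₀ ha, map_one, one_mul]
  rw [h1]
  exact (isAlgebraic_algebraMap (R := ℂ) (A := RatFunc ℂ) a⁻¹).mul h

/-- The pullback action of `s` on differentials: `s . (f dz) = f(ω⁻¹ z) ω⁻¹ dz`.  Here and below a
differential `f dz` on the Riemann sphere is represented by the rational function `f`. -/
def diffS {ω : ℂ} (hω : ω ≠ 0) : RatFunc ℂ →ₗ[ℂ] RatFunc ℂ :=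
  ω⁻¹ • (ratComp _ (transcendental_scale_X (inv_ne_zero hω))).toLinearMap

theorem polyConj_injective : Function.Injective ((algebraMap (Polynomial ℂ) (RatFunc ℂ)).comp
    (Polynomial.mapRingHom (starRingEnd ℂ))) :=
  (RatFunc.algebraMap_injective ℂ).comp
    (Polynomial.map_injective (starRingEnd ℂ) (starRingEnd ℂ).injective)

/-- The rational function obtained from `f` by conjugating all coefficients. -/
def ratConj : RatFunc ℂ →+* RatFunc ℂ := IsFractionRing.lift polyConj_injective

/-- The action of `t` on differentials, by conjugating the coefficients of `f`. -/
def diffT : RatFunc ℂ →ₛₗ[starRingEnd ℂ] RatFunc ℂ where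
  toFun := ratConj
  map_add' f h := map_add _ f h
  map_smul' a f := by
    have h1 : ∀ (c : ℂ) (h : RatFunc ℂ),
        c • h = algebraMap (Polynomial ℂ) (RatFunc ℂ) (Polynomial.C c) * h := by
      intro c h
      rw [RatFunc.algebraMap_C, ← RatFunc.smul_eq_C_mul]
    have h2 : ratConj (algebraMap (Polynomial ℂ) (RatFunc ℂ) (Polynomial.C a)) =
        algebraMap (Polynomial ℂ) (RatFunc ℂ) (Polynomial.C (starRingEnd ℂ a)) := by
      unfold ratConj
      rw [IsFractionRing.lift_algebraMap]
      simp
    refine (congrArg ratConj (h1 a f)).trans ?_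
    rw [map_mul, h2]
    exact (h1 _ _).symm

section Omega

variable {T : ℕ} {ω : ℂ} (Z : Divisor T ω)

/-- The largest order of pole allowed at `x`: it is `n y` for `x` in the orbit of a point `y` of
the support, and `0` if there is no such `y`. -/
def Divisor.orbitOrder (x : ℂ) : ℕ := by
  classical
  exact ∑ y ∈ Z.n.support, if ∃ α : DihedralGroup T, mob ω α y = x then Z.n y else 0

/-- The meromorphic differentials `f dz` with a pole of order at most `n y` at every point of the
orbit of every point `y` of the support, of order at most `nInf` at `∞`, and no other poles. -/
def OmegaD : Submodule ℂ (RatFunc ℂ) :=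
  (⨅ (x : ℂ) (m : ℤ) (_ : m < -(Z.orbitOrder x : ℤ)), LinearMap.ker (coeffAt x m)) ⊓
    ⨅ (m : ℤ) (_ : m < 2 - (Z.nInf : ℤ)), LinearMap.ker (coeffInf m)

/-- The subspace `E ⊗ Ω` of the space of all `V`-valued meromorphic differentials, where `Ω` is the
space of differentials above and `E` is a subspace of `V`. -/
def omegaOf {V : Type*} [AddCommGroup V] [Module ℂ V] (E : Submodule ℂ V) :
    Submodule ℂ (V ⊗[ℂ] RatFunc ℂ) :=
  Submodule.map₂ (TensorProduct.mk ℂ V (RatFunc ℂ)) E (OmegaD Z)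

end Omega

/-- The action of the dihedral group on `V`-valued meromorphic differentials, by
`X ⊗ ϖ ↦ α X ⊗ α . ϖ`, where `s` and `t` act on `V` by `S` and `R`. -/
def diffAct {V : Type*} [AddCommGroup V] [Module ℂ V] {T : ℕ} {ω : ℂ} (hω : ω ≠ 0)
    (S : V →ₗ[ℂ] V) (R : V →ₛₗ[starRingEnd ℂ] V) :
    DihedralGroup T → Module.End ℝ (V ⊗[ℂ] RatFunc ℂ) :=
  dihedralAct ((TensorProduct.map S (diffS hω)).restrictScalars ℝ)
    (toReal (TensorProduct.map R diffT))

section Pairing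

variable {g : Type*} [LieRing g] [LieAlgebra ℂ g] {T : ℕ} [NeZero T] (L : LieData g T)
  (Z : Divisor T L.ω)

theorem LieData.ω_ne (L : LieData g T) : L.ω ≠ 0 := L.ω_prim.ne_zero (NeZero.ne T)

/-- The invariant `g̃`-valued meromorphic differentials with poles bounded by the divisor. -/
def OmegaPiD : Submodule ℝ (AffineKM g ⊗[ℂ] RatFunc ℂ) :=
  (omegaOf Z (⊤ : Submodule ℂ (AffineKM g))).restrictScalars ℝ ⊓
    ⨅ α : DihedralGroup T, LinearMap.eqLocus (diffAct L.ω_ne L.σt L.τt α) LinearMap.id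

/-- The linear map sending `ϖ` to the residue of `ξ_x ^ p ϖ` at `x`, respectively of
`ξ_∞ ^ (q + 1) ϖ` at `∞`, where `ξ_x = z - x` and `ξ_∞ = z⁻¹`. -/
def slotRes {T : ℕ} {ω : ℂ} {Z : Divisor T ω} : Slot Z → RatFunc ℂ →ₗ[ℂ] ℂ
  | .inl s => coeffAt (s.1 : ℂ) (-((s.2 : ℕ) : ℤ) - 1)
  | .inr q => -coeffInf (-((q : ℕ) : ℤ))

/-- `(X ⊗ ϖ, Y) ↦ (X | Y) res ϖ`. -/
def slotPairing {Z : Divisor T L.ω} (s : Slot Z) (Y : AffineKM g) :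
    AffineKM g ⊗[ℂ] RatFunc ℂ →ₗ[ℂ] ℂ :=
  LinearMap.mul' ℂ ℂ ∘ₗ TensorProduct.map (L.kmForm.flip Y) (slotRes s)

/-- The pairing `Re ∑_x (2 T / |Π_x|) res_x (φ | X_x)`. -/
def pairing (φ : OmegaPiD L Z) (X : gD L Z) : ℝ :=
  ∑ s : Slot Z, (2 * T / Nat.card {α : DihedralGroup T // Fixes s α} : ℝ) *
    (slotPairing L s (X.1 s) φ.1).re

end Pairing

/-! ### Completions -/

section Completion

variable {R R' : Type*} [Ring R] [Ring R'] {ρ : R →+* R'} {V V' : Type*} [AddCommGroup V]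
  [AddCommGroup V'] [Module R V] [Module R' V']

/-- The families in `∏ n, V / F n` which are compatible with the filtration. -/
def complSub (F : ℕ → Submodule R V) : Submodule R (∀ n, V ⧸ F n) where
  carrier := {a | ∀ n m, n ≤ m → ∃ v, (F m).mkQ v = a m ∧ (F n).mkQ v = a n}
  zero_mem' n m _ := ⟨0, by simp⟩
  add_mem' := by
    intro a b ha hb n m h
    obtain ⟨v, h1, h2⟩ := ha n m h
    obtain ⟨w, h3, h4⟩ := hb n m h
    exact ⟨v + w, by rw [map_add, h1, h3]; rfl, by rw [map_add, h2, h4]; rfl⟩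
  smul_mem' := by
    intro r a ha n m h
    obtain ⟨v, h1, h2⟩ := ha n m h
    exact ⟨r • v, by rw [map_smul, h1]; rfl, by rw [map_smul, h2]; rfl⟩

/-- The completion `lim V / F n` of a vector space with respect to a descending filtration. -/
def Completion (F : ℕ → Submodule R V) : Type _ := ↥(complSub F)

instance (F : ℕ → Submodule R V) : AddCommGroup (Completion F) :=
  inferInstanceAs (AddCommGroup ↥(complSub F))

instance (F : ℕ → Submodule R V) : Module R (Completion F) :=
  inferInstanceAs (Module R ↥(complSub F))

/-- The image of an element of the completion in `V / F n`. -/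
def Completion.proj {F : ℕ → Submodule R V} (n : ℕ) (a : Completion F) : V ⧸ F n :=
  (show ↥(complSub F) from a).1 n

/-- The sequence `v` of vectors converges to `a` in the completion. -/
def IsLim {F : ℕ → Submodule R V} (v : ℕ → V) (a : Completion F) : Prop :=
  ∀ n, ∃ N₀, ∀ N, N₀ ≤ N → (F n).mkQ (v N) = a.proj n

/-- The extension to completions of a semilinear map compatible with the filtrations. -/
def complMap {F : ℕ → Submodule R V} {F' : ℕ → Submodule R' V'} (f : V →ₛₗ[ρ] V')
    (hf : ∀ n, F n ≤ (F' n).comap f) : Completion F →ₛₗ[ρ] Completion F' where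
  toFun a := ⟨fun n => Submodule.mapQ (F n) (F' n) f (hf n) (a.1 n), fun n m h => by
    obtain ⟨v, h1, h2⟩ := a.2 n m h
    refine ⟨f v, ?_, ?_⟩
    · exact congrArg (Submodule.mapQ (F m) (F' m) f (hf m)) h1
    · exact congrArg (Submodule.mapQ (F n) (F' n) f (hf n)) h2⟩
  map_add' a b := Subtype.ext (funext fun n => map_add (Submodule.mapQ (F n) (F' n) f (hf n)) _ _)
  map_smul' r a := Subtype.ext (funext fun n =>
    LinearMap.map_smulₛₗ (Submodule.mapQ (F n) (F' n) f (hf n)) r (a.1 n))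

end Completion

section Prod

variable {V : Type*} [AddCommGroup V] [Module ℂ V]

/-- The filtration `F n ⊗ M` of `V ⊗ M`, where `M` is the space of meromorphic differentials. -/
def prodFil (F : ℕ → Submodule ℂ V) (n : ℕ) : Submodule ℂ (V ⊗[ℂ] RatFunc ℂ) :=
  Submodule.map₂ (TensorProduct.mk ℂ V (RatFunc ℂ)) (F n) ⊤

/-- The map `v ↦ v ⊗ ϖ`, extended to completions. -/
def complTmul (F : ℕ → Submodule ℂ V) (ϖ : RatFunc ℂ) :
    Completion F →ₗ[ℂ] Completion (prodFil F) :=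
  complMap ((TensorProduct.mk ℂ V (RatFunc ℂ)).flip ϖ)
    (fun n _ hv => Submodule.apply_mem_map₂ _ (p := F n) (q := ⊤) hv trivial)

theorem complTmul_apply (F : ℕ → Submodule ℂ V) (ϖ : RatFunc ℂ) (a : Completion F) (n : ℕ) (v : V)
    (h : (F n).mkQ v = a.1 n) :
    (complTmul F ϖ a).1 n = (prodFil F n).mkQ (v ⊗ₜ[ℂ] ϖ) := by
  refine (congrArg (Submodule.mapQ _ _ _ _) h.symm).trans ?_
  rfl

/-- The canonical map from the tensor product of the completion of `V` with the space `M` of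
meromorphic differentials to the completion of `V ⊗ M`. -/
def complProd (F : ℕ → Submodule ℂ V) :
    Completion F ⊗[ℂ] RatFunc ℂ →ₗ[ℂ] Completion (prodFil F) :=
  TensorProduct.lift (LinearMap.mk₂ ℂ (fun a ϖ => complTmul F ϖ a)
    (fun a b ϖ => map_add _ a b)
    (fun c a ϖ => map_smul _ c a)
    (fun a ϖ ϖ' => Subtype.ext (funext fun n => by
      obtain ⟨v, h⟩ := (F n).mkQ_surjective (a.1 n)
      refine (complTmul_apply F _ a n v h).trans
        (Eq.trans ?_ (congrArg₂ (· + ·) (complTmul_apply F ϖ a n v h)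
          (complTmul_apply F ϖ' a n v h)).symm)
      exact congrArg (prodFil F n).mkQ (TensorProduct.tmul_add v ϖ ϖ')))
    (fun c a ϖ => Subtype.ext (funext fun n => by
      obtain ⟨v, h⟩ := (F n).mkQ_surjective (a.1 n)
      refine (complTmul_apply F _ a n v h).trans
        (Eq.trans ?_ (congrArg (c • ·) (complTmul_apply F ϖ a n v h)).symm)
      exact congrArg (prodFil F n).mkQ (TensorProduct.tmul_smul c v ϖ))))

end Prod

/-! ### Spaces of formal fields -/

section Fields

variable {g : Type*} [LieRing g] [LieAlgebra ℂ g] {T : ℕ} (L : LieData g T)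
variable {W : Type*} [AddCommGroup W] [Module ℝ W]

/-- Complex conjugation `c` on the complexification `ℂ ⊗ W` of a real vector space. -/
def conjC : ℂ ⊗[ℝ] W →ₛₗ[starRingEnd ℂ] ℂ ⊗[ℝ] W where
  toFun := TensorProduct.map Complex.conjAe.toLinearMap LinearMap.id
  map_add' u v := map_add _ u v
  map_smul' a u := by
    induction u using TensorProduct.induction_on with
    | zero => simp
    | tmul z w => simp [TensorProduct.smul_tmul']
    | add u v hu hv => rw [smul_add, map_add, hu, hv, map_add, smul_add]

theorem conjC_tmul (z : ℂ) (w : W) : conjC (z ⊗ₜ[ℝ] w) = (starRingEnd ℂ z) ⊗ₜ[ℝ] w := rfl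

theorem conjC_conjC (u : ℂ ⊗[ℝ] W) : conjC (conjC u) = u := by
  induction u using TensorProduct.induction_on with
  | zero => simp
  | tmul z w => simp [conjC_tmul]
  | add u v hu hv => rw [map_add, map_add, hu, hv]

variable (g) in
/-- The filtration `F_n ⊗ c(Fil n) + F̄_n ⊗ Fil n` of `g̃ ⊗ (ℂ ⊗ W)`. -/
def fieldFil (Fil : ℕ → Submodule ℂ (ℂ ⊗[ℝ] W)) (n : ℕ) :
    Submodule ℂ (AffineKM g ⊗[ℂ] (ℂ ⊗[ℝ] W)) :=
  Submodule.map₂ (TensorProduct.mk ℂ _ _) (Fpos g n) ((Fil n).map conjC) ⊔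
    Submodule.map₂ (TensorProduct.mk ℂ _ _) (Fneg g n) (Fil n)

/-- The action of `s` on `g̃ ⊗ (ℂ ⊗ W)`. -/
def fieldS : AffineKM g ⊗[ℂ] (ℂ ⊗[ℝ] W) →ₗ[ℂ] AffineKM g ⊗[ℂ] (ℂ ⊗[ℝ] W) :=
  TensorProduct.map L.σt LinearMap.id

/-- The action of `t` on `g̃ ⊗ (ℂ ⊗ W)`. -/
def fieldT : AffineKM g ⊗[ℂ] (ℂ ⊗[ℝ] W) →ₛₗ[starRingEnd ℂ] AffineKM g ⊗[ℂ] (ℂ ⊗[ℝ] W) :=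
  TensorProduct.map L.τt conjC

theorem fieldFil_le_fieldS (Fil : ℕ → Submodule ℂ (ℂ ⊗[ℝ] W)) (n : ℕ) :
    fieldFil g Fil n ≤ (fieldFil g Fil n).comap (fieldS L) := by
  refine sup_le (Submodule.map₂_le.2 fun X hX u hu => ?_) (Submodule.map₂_le.2 fun X hX u hu => ?_)
  · exact Submodule.mem_sup_left (Submodule.apply_mem_map₂ _ (σt_mem_Fpos L hX) hu)
  · exact Submodule.mem_sup_right (Submodule.apply_mem_map₂ _ (σt_mem_Fneg L hX) hu)

theorem fieldFil_le_fieldT (Fil : ℕ → Submodule ℂ (ℂ ⊗[ℝ] W)) (n : ℕ) :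
    fieldFil g Fil n ≤ (fieldFil g Fil n).comap (fieldT L) := by
  refine sup_le (Submodule.map₂_le.2 fun X hX u hu => ?_) (Submodule.map₂_le.2 fun X hX u hu => ?_)
  · obtain ⟨w, hw, rfl⟩ := hu
    refine Submodule.mem_sup_right ?_
    have h := Submodule.apply_mem_map₂ (TensorProduct.mk ℂ (AffineKM g) (ℂ ⊗[ℝ] W))
      (τt_mem_Fneg L hX) hw
    have e : fieldT L (X ⊗ₜ[ℂ] conjC w) = L.τt X ⊗ₜ[ℂ] conjC (conjC w) := rfl
    rw [conjC_conjC] at e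
    exact e ▸ h
  · exact Submodule.mem_sup_left
      (Submodule.apply_mem_map₂ _ (τt_mem_Fpos L hX) (Submodule.mem_map_of_mem hu))

/-- The action of the dihedral group on meromorphic differentials with values in the completion
of `g̃ ⊗ (ℂ ⊗ W)`. -/
def fieldAct [NeZero T] (Fil : ℕ → Submodule ℂ (ℂ ⊗[ℝ] W)) :
    DihedralGroup T → Module.End ℝ (Completion (fieldFil g Fil) ⊗[ℂ] RatFunc ℂ) :=
  diffAct L.ω_ne (complMap (fieldS L) (fieldFil_le_fieldS L Fil))
    (complMap (fieldT L) (fieldFil_le_fieldT L Fil))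

end Fields

section GaudinFields

variable {g : Type*} [LieRing g] [LieAlgebra ℂ g] {T : ℕ} (L : LieData g T) (Z : Divisor T L.ω)

variable (g) in
/-- For `X ⊗ ε ^ p` in a summand of the Takiff algebra, the vector
`1 / 2 (1 ⊗ (X ⊗ ε ^ p) - i ⊗ (i X ⊗ ε ^ p))` of the complexification. -/
def cplxVec {ω : ℂ} {Z : Divisor T ω} (s : Slot Z) (X : AffineKM g) : ℂ ⊗[ℝ] TakD g Z :=
  (1 / 2 : ℂ) • ((1 : ℂ) ⊗ₜ[ℝ] tak s X - Complex.I ⊗ₜ[ℝ] tak s (Complex.I • X))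

variable (g) in
/-- The vector `1 ⊗ (π₊ X ⊗ ε ^ p) - i ⊗ (i π₋ X ⊗ ε ^ p)`, where `π₊ X = (X + Y) / 2` and
`π₋ X = (X - Y) / 2` and `Y` is the image of `X` under the conjugation whose real points are
considered. -/
def invVec {ω : ℂ} {Z : Divisor T ω} (s : Slot Z) (X Y : AffineKM g) : ℂ ⊗[ℝ] TakD g Z :=
  (1 : ℂ) ⊗ₜ[ℝ] tak s ((1 / 2 : ℂ) • (X + Y)) -
    Complex.I ⊗ₜ[ℝ] tak s (Complex.I • (1 / 2 : ℂ) • (X - Y))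

theorem invVec_eq {ω : ℂ} {Z : Divisor T ω} (s : Slot Z) (X Y : AffineKM g) :
    invVec g s X Y = cplxVec g s X + conjC (cplxVec g s Y) := by
  have h2 : ∀ (z : ℂ) (X : AffineKM g),
      z ⊗ₜ[ℝ] tak s ((1 / 2 : ℂ) • X) = (1 / 2 : ℂ) • (z ⊗ₜ[ℝ] (tak s X : TakD g Z)) := by
    intro z X
    have e : (tak s ((1 / 2 : ℂ) • X) : TakD g Z) = (1 / 2 : ℝ) • tak s X := by
      rw [map_smul, ← Complex.coe_smul]
      norm_num
    rw [e, TensorProduct.tmul_smul, TensorProduct.smul_tmul', TensorProduct.smul_tmul']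
    congr 1
    simp
  unfold invVec cplxVec
  rw [smul_comm Complex.I (1 / 2 : ℂ), h2, h2, conjC.map_smulₛₗ, map_sub, conjC_tmul, conjC_tmul,
    ← smul_sub]
  have e : starRingEnd ℂ (1 / 2 : ℂ) = 1 / 2 := by
    have := Complex.conj_ofReal (1 / 2)
    push_cast at this
    exact this
  rw [e, ← smul_add]
  congr 1
  rw [map_add, smul_sub, map_sub, TensorProduct.tmul_add, TensorProduct.tmul_sub]
  simp only [map_one, Complex.conj_I, TensorProduct.neg_tmul]
  abel

variable (g) in
/-- The filtration of the complexification of `⨁_x g̃[ε_x]/(ε_x ^ (n x)) ⊕ ⋯`. -/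
def takFil {ω : ℂ} (Z : Divisor T ω) (n : ℕ) : Submodule ℂ (ℂ ⊗[ℝ] TakD g Z) :=
  Submodule.span ℂ
    ({v | ∃ (s : Slot Z) (X : AffineKM g), X ∈ Fpos g n ∧ v = cplxVec g s X} ∪
      {v | ∃ (s : Slot Z) (X : AffineKM g), X ∈ Fneg g n ∧ v = conjC (cplxVec g s X)})

/-- Generators of the filtration of the complexification of `g̃^D`, seen in the complexification of
the ambient space: one family for every complex point `x` and its conjugate, one for every real
point, one for the origin, one for infinity. -/
def gDGen (n : ℕ) : Set (ℂ ⊗[ℝ] TakD g Z) :=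
  {v | ∃ (x : {x : ℂ // x ∈ Z.n.support}) (p : Fin (Z.n x)) (X : AffineKM g),
      (x : ℂ) ∈ Z.cplxPts ∧ X ∈ Fpos g n ∧ v = cplxVec g (.inl ⟨x, p⟩) X} ∪
  {v | ∃ (x : {x : ℂ // x ∈ Z.n.support}) (p : Fin (Z.n x)) (X : AffineKM g),
      (x : ℂ) ∈ Z.cplxPts ∧ X ∈ Fneg g n ∧ v = conjC (cplxVec g (.inl ⟨x, p⟩) X)} ∪
  {v | ∃ (k : ZMod T) (x : {x : ℂ // x ∈ Z.n.support}) (p : Fin (Z.n x)) (X : AffineKM g),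
      (x : ℂ) ∈ Z.realPts k ∧ X ∈ Fpos g n ∧
      v = invVec g (.inl ⟨x, p⟩) X
        ((L.ω ^ (k.val * (p : ℕ)))⁻¹ • (L.σt ^ k.val : Module.End ℂ _) (L.τt X))} ∪
  {v | ∃ (x : {x : ℂ // x ∈ Z.n.support}) (p : Fin (Z.n x)) (X : AffineKM g),
      (x : ℂ) = 0 ∧ X ∈ Fpos g n ∧ L.σt X = L.ω ^ (p : ℕ) • X ∧
      v = invVec g (.inl ⟨x, p⟩) X (L.τt X)} ∪
  {v | ∃ (q : Fin (Z.nInf - 1)) (X : AffineKM g),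
      X ∈ Fpos g n ∧ L.σt X = (L.ω ^ ((q : ℕ) + 1))⁻¹ • X ∧ v = invVec g (.inr q) X (L.τt X)}

/-- The filtration of the complexification of `g̃^D`. -/
def gDFil (n : ℕ) : Submodule ℂ (ℂ ⊗[ℝ] gD L Z) :=
  (Submodule.span ℂ (gDGen L Z n)).comap ((gD L Z).subtype.baseChange ℂ)

theorem σt_pow_mem_Fneg {n : ℕ} (k : ℕ) {X : AffineKM g} (h : X ∈ Fneg g n) :
    (L.σt ^ k : Module.End ℂ _) X ∈ Fneg g n := by
  induction k with
  | zero => simpa using h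
  | succ k ih => rw [pow_succ']; exact σt_mem_Fneg L ih

theorem gDFil_le (n : ℕ) :
    gDFil L Z n ≤ (takFil g Z n).comap ((gD L Z).subtype.baseChange ℂ) := by
  refine Submodule.comap_mono (Submodule.span_le.2 ?_)
  have key : ∀ (s : Slot Z) (X Y : AffineKM g), X ∈ Fpos g n → Y ∈ Fneg g n →
      invVec g s X Y ∈ takFil g Z n := by
    intro s X Y hX hY
    rw [invVec_eq]
    exact add_mem (Submodule.subset_span (Or.inl ⟨s, X, hX, rfl⟩))
      (Submodule.subset_span (Or.inr ⟨s, Y, hY, rfl⟩))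
  rintro v ((((⟨x, p, X, -, hX, rfl⟩ | ⟨x, p, X, -, hX, rfl⟩) | ⟨k, x, p, X, -, hX, rfl⟩) |
    ⟨x, p, X, -, hX, -, rfl⟩) | ⟨q, X, hX, -, rfl⟩)
  · exact Submodule.subset_span (Or.inl ⟨_, X, hX, rfl⟩)
  · exact Submodule.subset_span (Or.inr ⟨_, X, hX, rfl⟩)
  · exact key _ _ _ hX (Submodule.smul_mem _ _ (σt_pow_mem_Fneg L _ (τt_mem_Fneg L hX)))
  · exact key _ _ _ hX (τt_mem_Fneg L hX)
  · exact key _ _ _ hX (τt_mem_Fneg L hX)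

/-- The space of formal fields, a completion of `g̃ ⊗ g̃^D_ℂ`. -/
abbrev Fields : Type _ := Completion (fieldFil g (gDFil L Z))

variable (g) in
/-- The space of complexified formal fields. -/
abbrev FieldsC {ω : ℂ} (Z : Divisor T ω) : Type _ := Completion (fieldFil g (takFil g Z))

/-- The inclusion of `g̃ ⊗ g̃^D_ℂ` in `g̃ ⊗ (ℂ ⊗ ⨁_x g̃[ε_x]/(ε_x ^ (n x)) ⊕ ⋯)`. -/
def fieldIncl : AffineKM g ⊗[ℂ] (ℂ ⊗[ℝ] gD L Z) →ₗ[ℂ] AffineKM g ⊗[ℂ] (ℂ ⊗[ℝ] TakD g Z) :=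
  TensorProduct.map LinearMap.id ((gD L Z).subtype.baseChange ℂ)

theorem fieldFil_le_fieldIncl (n : ℕ) : fieldFil g (gDFil L Z) n ≤
    (fieldFil g (takFil g Z) n).comap (fieldIncl L Z) := by
  refine sup_le (Submodule.map₂_le.2 fun X hX u hu => ?_) (Submodule.map₂_le.2 fun X hX u hu => ?_)
  · obtain ⟨w, hw, rfl⟩ := hu
    refine Submodule.mem_sup_left (Submodule.apply_mem_map₂ _ hX ?_)
    refine ⟨_, gDFil_le L Z n hw, ?_⟩
    clear hw
    induction w using TensorProduct.induction_on with
    | zero => simp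
    | tmul z w => rfl
    | add u v hu hv => rw [map_add, map_add, hu, hv, map_add, map_add]
  · exact Submodule.mem_sup_right (Submodule.apply_mem_map₂ _ hX (gDFil_le L Z n hu))

/-- The resulting map from formal fields to complexified formal fields, tensored with the space of
meromorphic differentials. -/
def fieldsToC : Fields L Z ⊗[ℂ] RatFunc ℂ →ₗ[ℂ] FieldsC g Z ⊗[ℂ] RatFunc ℂ :=
  TensorProduct.map (complMap (fieldIncl L Z) (fieldFil_le_fieldIncl L Z)) LinearMap.id

/-- The map `ζ`, `(X ⊗ ϖ) ⊗ Y ↦ (X ⊗ (1 ⊗ Y)) ⊗ ϖ`. -/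
def zeta [NeZero T] : OmegaPiD L Z ⊗[ℝ] gD L Z →ₛₗ[Complex.ofRealHom]
    (AffineKM g ⊗[ℂ] (ℂ ⊗[ℝ] gD L Z)) ⊗[ℂ] RatFunc ℂ :=
  TensorProduct.lift (LinearMap.mk₂'ₛₗ Complex.ofRealHom Complex.ofRealHom
    (fun φ Y => TensorProduct.map
      ((TensorProduct.mk ℂ (AffineKM g) (ℂ ⊗[ℝ] gD L Z)).flip ((1 : ℂ) ⊗ₜ[ℝ] Y))
      LinearMap.id φ.1)
    (fun φ φ' Y => map_add _ _ _)
    (fun r φ Y => by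
      have e : (r • φ).1 = Complex.ofRealHom r • φ.1 := by
        change r • φ.1 = (r : ℂ) • φ.1
        exact real_smul_eq r φ.1
      exact (congrArg _ e).trans (map_smul _ _ _))
    (fun φ Y Y' => by
      rw [TensorProduct.tmul_add, map_add, TensorProduct.map_add_left]
      rfl)
    (fun r φ Y => by
      have e : (1 : ℂ) ⊗ₜ[ℝ] (r • Y) = Complex.ofRealHom r • ((1 : ℂ) ⊗ₜ[ℝ] Y) := by
        rw [TensorProduct.tmul_smul, TensorProduct.smul_tmul', TensorProduct.smul_tmul']
        simp
      rw [e, map_smul, TensorProduct.map_smul_left]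
      rfl))

/-- The filtration of the tensor product of the spaces in duality, induced by `ζ`. -/
def zetaFil [NeZero T] (n : ℕ) : Submodule ℝ (OmegaPiD L Z ⊗[ℝ] gD L Z) :=
  (omegaOf Z (fieldFil g (gDFil L Z) n)).comap (zeta L Z)

/-- The extension of `ζ` to completions. -/
def zetaHat [NeZero T] : Completion (R := ℝ) (V := OmegaPiD L Z ⊗[ℝ] gD L Z) (zetaFil L Z) →ₛₗ[Complex.ofRealHom]
    Completion (prodFil (fieldFil g (gDFil L Z))) :=
  complMap (zeta L Z) fun _ => Submodule.comap_mono (Submodule.map₂_le_map₂_right le_top)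

end GaudinFields

/-! ### Bases -/

/-- Indices of a basis of a form of the affine Kac-Moody algebra: the modes `n` of `d` vectors of
`g`, and, if the proposition `P` holds, `K` and `D`. -/
inductive ModeIdx (d : ℕ) (P : Prop) : Type
  | loop (a : Fin d) (n : ℤ)
  | K (h : P)
  | D (h : P)

/-- The indices with `|n| < N`, together with those of `K` and `D`. -/
def modes (d : ℕ) (P : Prop) (N : ℕ) : Finset (ModeIdx d P) := by
  classical
  exact ((Finset.univ : Finset (Fin d)) ×ˢ Finset.Ioo (-(N : ℤ)) N).image
      (fun a => ModeIdx.loop a.1 a.2) ∪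
    if h : P then {ModeIdx.K h, ModeIdx.D h} else ∅

section Vectors

variable {g : Type*} [LieRing g] [LieAlgebra ℂ g] {d : ℕ} {P : Prop}

/-- The vectors `(u_a)_n`, `K`, `D`. -/
def expVec (u : Fin d → g) : ModeIdx d P → AffineKM g
  | .loop a n => AffineKM.mode (u a) n
  | .K _ => AffineKM.K g
  | .D _ => AffineKM.D g

/-- The vectors `(v_a)_{-n}`, `D`, `K`. -/
def expDual (v : Fin d → g) : ModeIdx d P → AffineKM g
  | .loop a n => AffineKM.mode (v a) (-n)
  | .K _ => AffineKM.D g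
  | .D _ => AffineKM.K g

/-- The vectors `(u_a)_0`, `(u_a)_n + (u_a)_{-n}` over `√2` for `n > 0`, and
`i ((u_a)_n - (u_a)_{-n})` over `√2` for `n > 0`, the latter having the index `-n`. -/
def trigMode (u : Fin d → g) (a : Fin d) (n : ℤ) : AffineKM g :=
  if n = 0 then AffineKM.mode (u a) 0
  else if 0 < n then
    (1 / (Real.sqrt 2 : ℂ)) • (AffineKM.mode (u a) n + AffineKM.mode (u a) (-n))
  else
    (Complex.I / (Real.sqrt 2 : ℂ)) • (AffineKM.mode (u a) (-n) - AffineKM.mode (u a) n)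

/-- The vectors above, with `κ K` and `κ D`. -/
def trigVec (κ : ℂ) (u : Fin d → g) : ModeIdx d P → AffineKM g
  | .loop a n => trigMode u a n
  | .K _ => κ • AffineKM.K g
  | .D _ => κ • AffineKM.D g

/-- The vectors above, with `κ D` and `κ K`. -/
def trigDual (κ : ℂ) (v : Fin d → g) : ModeIdx d P → AffineKM g
  | .loop a n => trigMode v a n
  | .K _ => κ • AffineKM.D g
  | .D _ => κ • AffineKM.K g

end Vectors

/-- Indices of the formal fields: the fields at a complex point `x` (`false`) and at the conjugate
of `x` (`true`), at a real point, at the origin, and at infinity. -/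
abbrev FIdx {T : ℕ} {ω : ℂ} (Z : Divisor T ω) : Type :=
  (Σ x : {x : ℂ // x ∈ Z.cplxPts}, Fin (Z.n x) × Bool) ⊕
    ((Σ (k : ZMod T) (x : {x : ℂ // x ∈ Z.realPts k}), Fin (Z.n x)) ⊕
      (Fin (Z.n 0) ⊕ Fin (Z.nInf - 1)))

section FIdx

variable {T : ℕ} {ω : ℂ} {Z : Divisor T ω}

abbrev FIdx.cplx (x : {x : ℂ // x ∈ Z.cplxPts}) (p : Fin (Z.n x)) (c : Bool) : FIdx Z :=
  .inl ⟨x, p, c⟩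

abbrev FIdx.real (k : ZMod T) (x : {x : ℂ // x ∈ Z.realPts k}) (p : Fin (Z.n x)) : FIdx Z :=
  .inr (.inl ⟨k, x, p⟩)

abbrev FIdx.zero (p : Fin (Z.n 0)) : FIdx Z := .inr (.inr (.inl p))

abbrev FIdx.inf (q : Fin (Z.nInf - 1)) : FIdx Z := .inr (.inr (.inr q))

/-- The slot of the Takiff algebra to which a formal field is attached. -/
def slotOf : FIdx Z → Slot Z
  | .inl ⟨x, p, _⟩ => .inl ⟨⟨x, Z.mem_of_cplx x.2⟩, p⟩
  | .inr (.inl ⟨_, x, p⟩) => .inl ⟨⟨x, Z.mem_of_real x.2⟩, p⟩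
  | .inr (.inr (.inl p)) => .inl ⟨⟨0, Z.zero_mem p⟩, p⟩
  | .inr (.inr (.inr q)) => .inr q

end FIdx

section Bases

variable {g : Type*} [LieRing g] [LieAlgebra ℂ g] {T : ℕ} {L : LieData g T} (B : BasisData L)
  (Z : Divisor T L.ω)

/-- The number of basis vectors of the relevant real form of `g`. -/
def dimOf {Z : Divisor T L.ω} : FIdx Z → ℕ
  | .inl _ => B.d
  | .inr (.inl _) => B.d
  | .inr (.inr (.inl p)) => B.m ((p : ℕ) : ZMod T)
  | .inr (.inr (.inr q)) => B.m (-(((q : ℕ) + 1 : ℕ) : ZMod T))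

/-- Whether the relevant real form of the affine Kac-Moody algebra contains multiples of `K`
and `D`. -/
def hasKD {ω : ℂ} {Z : Divisor T ω} : FIdx Z → Prop
  | .inl _ => True
  | .inr (.inl _) => True
  | .inr (.inr (.inl p)) => ((p : ℕ) : ZMod T) = 0
  | .inr (.inr (.inr q)) => -(((q : ℕ) + 1 : ℕ) : ZMod T) = 0

/-- Indices of the dual bases of `g̃^D` and of the space of invariant differentials. -/
abbrev Idx : Type := Σ i : FIdx Z, ModeIdx (dimOf B i) (hasKD i)

/-- The indices of modes `|n| < N`. -/
def idxUpTo [NeZero T] (N : ℕ) : Finset (Idx B Z) :=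
  (Finset.univ : Finset (FIdx Z)).sigma fun i => modes (dimOf B i) (hasKD i) N

variable {Z}

/-- The bases of `g̃` as a real vector space (at complex points), of `g̃_{k,p}` (at real points) and
of `g̃_(j)` (at the origin and at infinity). -/
def upVec : (i : FIdx Z) → ModeIdx (dimOf B i) (hasKD i) → AffineKM g
  | .inl ⟨_, _, false⟩, a => expVec (fun a => (B.b 0 0 a : g)) a
  | .inl ⟨_, _, true⟩, a => Complex.I • expVec (fun a => (B.b 0 0 a : g)) a
  | .inr (.inl ⟨k, _, p⟩), a =>
      trigVec (Complex.I * (B.η ^ (k.val * (p : ℕ)))⁻¹)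
        (fun a => (B.b k ((p : ℕ) : ZMod T) a : g)) a
  | .inr (.inr (.inl p)), a => trigVec Complex.I (fun a => (B.c ((p : ℕ) : ZMod T) a : g)) a
  | .inr (.inr (.inr q)), a =>
      trigVec Complex.I (fun a => (B.c (-(((q : ℕ) + 1 : ℕ) : ZMod T)) a : g)) a

/-- The first tensor factors of the formal fields: the basis of `g̃` dual to `I^a_n, K, D` at
a complex point `x`, its image under `τ` at the conjugate point, and the dual bases, in
`g̃_{k,-p}` and `g̃_(-j)`, of those above at the other points. -/
def auxVec : (i : FIdx Z) → ModeIdx (dimOf B i) (hasKD i) → AffineKM g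
  | .inl ⟨_, _, false⟩, a => expDual (fun a => (B.bd 0 0 a : g)) a
  | .inl ⟨_, _, true⟩, a => L.τt (expDual (fun a => (B.bd 0 0 a : g)) a)
  | .inr (.inl ⟨k, _, p⟩), a =>
      trigDual (-Complex.I * B.η ^ (k.val * (p : ℕ)))
        (fun a => (B.bd k ((p : ℕ) : ZMod T) a : g)) a
  | .inr (.inr (.inl p)), a =>
      trigDual (-Complex.I) (fun a => (B.cd ((p : ℕ) : ZMod T) a : g)) a
  | .inr (.inr (.inr q)), a =>
      trigDual (-Complex.I) (fun a => (B.cd (-(((q : ℕ) + 1 : ℕ) : ZMod T)) a : g)) a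

/-- The basis `I^A` of `g̃^D`. -/
def takVec (A : Idx B Z) : TakD g Z := tak (slotOf A.1) (upVec B A.1 A.2)

/-- The terms of the formal fields, for a given basis `I^A` of `g̃^D`. -/
def fieldTerm (I : Idx B Z → gD L Z) :
    (i : FIdx Z) → ModeIdx (dimOf B i) (hasKD i) → AffineKM g ⊗[ℂ] (ℂ ⊗[ℝ] gD L Z)
  | .inl ⟨x, p, false⟩, a => auxVec B (.cplx x p false) a ⊗ₜ[ℂ] ((1 / 2 : ℂ) •
      ((1 : ℂ) ⊗ₜ[ℝ] I ⟨.cplx x p false, a⟩ - Complex.I ⊗ₜ[ℝ] I ⟨.cplx x p true, a⟩))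
  | .inl ⟨x, p, true⟩, a => auxVec B (.cplx x p true) a ⊗ₜ[ℂ] ((1 / 2 : ℂ) •
      ((1 : ℂ) ⊗ₜ[ℝ] I ⟨.cplx x p false, a⟩ + Complex.I ⊗ₜ[ℝ] I ⟨.cplx x p true, a⟩))
  | .inr i, a => auxVec B (.inr i) a ⊗ₜ[ℂ] ((1 : ℂ) ⊗ₜ[ℝ] I ⟨.inr i, a⟩)

/-- The partial sums of the formal fields. -/
def fieldSum (I : Idx B Z → gD L Z) (i : FIdx Z) (N : ℕ) : AffineKM g ⊗[ℂ] (ℂ ⊗[ℝ] gD L Z) :=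
  ∑ a ∈ modes (dimOf B i) (hasKD i) N, fieldTerm B I i a

/-- The partial sums of the complexified formal fields. -/
def fieldSumC (s : Slot Z) (N : ℕ) : AffineKM g ⊗[ℂ] (ℂ ⊗[ℝ] TakD g Z) :=
  ∑ a ∈ modes B.d True N, expDual (fun a => (B.bd 0 0 a : g)) a ⊗ₜ[ℂ]
    cplxVec g s (expVec (fun a => (B.b 0 0 a : g)) a)

end Bases

/-- The differential `dz / (z - x) ^ (p + 1)`. -/
def polarDiff (x : ℂ) (p : ℕ) : RatFunc ℂ := ((RatFunc.X - RatFunc.C x) ^ (p + 1))⁻¹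

end Gaudin

end

open scoped TensorProduct
open Gaudin

/-! The proof rests on averaging over the dihedral group, of order 2T. By partial fractions
(`OmegaD_le_span`), the scalar differentials are spanned by dz/(z - αx)^(p+1) and z^q dz. The group
permutes these up to a scalar, which can be moved onto the coefficient, so every invariant
differential is a sum of averages (`avgDiff`) of polar parts `v ⊗ slotDiff s 1`. In the residue of
such an average at its own slot only the stabiliser survives. Against an invariant vector X, all of
its elements contribute the same real part, and the weight 2T/|Π_x| cancels the normalisation: the
pairing equals Re (v | X_s) (`pairing_avgDiff`). Statement (a) thus becomes local. At each slot the
listed vectors and their duals pair to δ (`dual_pair`) and span the invariants for opposite weights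
(`mem_span_upVec`, `mem_span_dualVec`), and independence follows from duality.

For convergence, the terms of modes n and -n of a field combine into v_n ⊗ c(w) + v_{-n} ⊗ w with w
in the n-th step of the filtration (`trig_pair_mem`, `fieldSum_succ`). Since ζ turns partial sums of
Φ into averages of polar parts whose coefficients are partial sums of fields (`zeta_sum`), the same
estimate makes Φ converge. Uniqueness of limits then identifies ζ(Φ) with `canonicalImage`, which is
invariant because it is an average.

The formula in (c) comes from evaluating this average point by point. At a real point the polar part
is fixed by a reflection, so only the average over rotations remains (`diffAvg_eq_rotAvg`). At 0 and
∞ it is fixed by the whole group. At a complex point the vectors Iε^p and iIε^p together give twice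
the field, and the reflection converts one copy into the field at the conjugate point
(`diffAvg_two_smul`).

For (d), the identity 1 ⊗ X = X_ℂ + c(X_ℂ) writes a field at a point with a stabiliser as a half
plus the reflection of that half (`fieldIncl_inr`). Since the canonical tensor of a form does not
depend on the basis, the half is the complexified field at a real point (`halfSum_real`) and its
mean over rotations at 0 and ∞ (`halfSum_eigen`). Under the average every slot therefore contributes
twice its complexified field, and 1/(2T) becomes 1/T. -/

noncomputable section

set_option linter.unusedSectionVars false

namespace Gaudin

/-! ### Dihedral group actions -/

section Dihedral

variable {V V' : Type*} [AddCommGroup V] [Module ℂ V] [AddCommGroup V'] [Module ℂ V'] {T : ℕ}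

/-- The relations of the dihedral group, for a linear and a conjugate-linear operator. -/
structure IsDihedral (T : ℕ) (S : V →ₗ[ℂ] V) (R : V →ₛₗ[starRingEnd ℂ] V) : Prop where
  pow : (S ^ T : Module.End ℂ V) = 1
  invol : ∀ x, R (R x) = x
  rel : ∀ x, S (R (S x)) = R x

theorem IsDihedral.pow_mod {S : V →ₗ[ℂ] V} {R : V →ₛₗ[starRingEnd ℂ] V} (h : IsDihedral T S R)
    (n : ℕ) : (S ^ (n % T) : Module.End ℂ V) = S ^ n := by
  conv_rhs => rw [← Nat.mod_add_div n T, pow_add, pow_mul, h.pow, one_pow, mul_one]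

theorem IsDihedral.pow_rel {S : V →ₗ[ℂ] V} {R : V →ₛₗ[starRingEnd ℂ] V} (h : IsDihedral T S R)
    (n : ℕ) (x : V) : (S ^ n : Module.End ℂ V) (R ((S ^ n : Module.End ℂ V) x)) = R x := by
  induction n generalizing x with
  | zero => rfl
  | succ n ih =>
    have e1 : (S ^ (n + 1) : Module.End ℂ V) x = S ((S ^ n : Module.End ℂ V) x) := by
      rw [pow_succ']; rfl
    have e2 : ∀ y, (S ^ (n + 1) : Module.End ℂ V) y = (S ^ n : Module.End ℂ V) (S y) := by
      intro y; rw [pow_succ]; rfl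
    rw [e1, e2, h.rel, ih]

/-- Conjugate-linearity of `R` turns the second factor `w` into its conjugate, so S R S acquires w ·
conj w = 1. This is what lets each slot carry its own weight. -/
theorem IsDihedral.smul {S : V →ₗ[ℂ] V} {R : V →ₛₗ[starRingEnd ℂ] V}
    (h : IsDihedral T S R) {w : ℂ} (hw : w ^ T = 1) (hw' : w * starRingEnd ℂ w = 1) :
    IsDihedral T (w • S) R where
  pow := by rw [smul_pow, hw, one_smul, h.pow]
  invol := h.invol
  rel x := by
    rw [LinearMap.smul_apply, LinearMap.smul_apply, R.map_smulₛₗ, map_smul, h.rel, smul_smul, hw',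
      one_smul]

variable [Module ℝ V] [IsScalarTower ℝ ℂ V] [Module ℝ V'] [IsScalarTower ℝ ℂ V']

theorem restrictScalars_pow (S : V →ₗ[ℂ] V) (n : ℕ) :
    (S.restrictScalars ℝ : Module.End ℝ V) ^ n = ((S ^ n : Module.End ℂ V)).restrictScalars ℝ := by
  induction n with
  | zero => rfl
  | succ n ih => rw [pow_succ, ih, pow_succ]; rfl

theorem dihedralAct_r (S : V →ₗ[ℂ] V) (R : V →ₛₗ[starRingEnd ℂ] V) (i : ZMod T) (v : V) :
    dihedralAct (S.restrictScalars ℝ) (toReal R) (.r i) v = (S ^ i.val : Module.End ℂ V) v := by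
  simp only [dihedralAct, restrictScalars_pow]; rfl

theorem dihedralAct_sr (S : V →ₗ[ℂ] V) (R : V →ₛₗ[starRingEnd ℂ] V) (i : ZMod T) (v : V) :
    dihedralAct (S.restrictScalars ℝ) (toReal R) (.sr i) v =
      R ((S ^ i.val : Module.End ℂ V) v) := by
  simp only [dihedralAct, restrictScalars_pow]; rfl

/-- The three relations yield a genuine action of the group; everything about averages depends on
this multiplicativity. -/
theorem IsDihedral.mul [NeZero T] {S : V →ₗ[ℂ] V} {R : V →ₛₗ[starRingEnd ℂ] V}
    (h : IsDihedral T S R) (α β : DihedralGroup T) (v : V) :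
    dihedralAct (S.restrictScalars ℝ) (toReal R) (α * β) v =
      dihedralAct (S.restrictScalars ℝ) (toReal R) α
        (dihedralAct (S.restrictScalars ℝ) (toReal R) β v) := by
  have key : ∀ (i j : ZMod T) (w : V), (S ^ (j - i).val : Module.End ℂ V) w =
      (S ^ (T - i.val) : Module.End ℂ V) ((S ^ j.val : Module.End ℂ V) w) := by
    intro i j w
    have hi := (ZMod.val_lt i).le
    have e : (j - i).val = (T - i.val + j.val) % T := by
      have : j - i = ((T - i.val + j.val : ℕ) : ZMod T) := by
        push_cast [Nat.cast_sub hi]; simp; ring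
      rw [this, ZMod.val_natCast]
    rw [e, h.pow_mod, pow_add]; rfl
  -- Moving `R` past a power of `S` inverts the power; T - i is used instead of -i because the
  -- exponents are natural numbers.
  have inv : ∀ (i : ZMod T) (w : V), (S ^ i.val : Module.End ℂ V) (R w) =
      R ((S ^ (T - i.val) : Module.End ℂ V) w) := by
    intro i w
    have hi := (ZMod.val_lt i).le
    have e : w = (S ^ i.val : Module.End ℂ V) ((S ^ (T - i.val) : Module.End ℂ V) w) := by
      rw [← Module.End.mul_apply, ← pow_add, Nat.add_sub_cancel' hi, h.pow]; rfl
    conv_lhs => rw [e]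
    exact h.pow_rel _ _
  cases α with
  | r i =>
    cases β with
    | r j =>
      rw [DihedralGroup.r_mul_r, dihedralAct_r, dihedralAct_r, dihedralAct_r, ZMod.val_add,
        h.pow_mod, pow_add]; rfl
    | sr j =>
      rw [DihedralGroup.r_mul_sr, dihedralAct_r, dihedralAct_sr, dihedralAct_sr, inv, key]
  | sr i =>
    cases β with
    | r j =>
      rw [DihedralGroup.sr_mul_r, dihedralAct_r, dihedralAct_sr, dihedralAct_sr, ZMod.val_add,
        h.pow_mod, pow_add]; rfl
    | sr j =>
      rw [DihedralGroup.sr_mul_sr, dihedralAct_r, dihedralAct_sr, dihedralAct_sr, inv, key,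
        h.invol]

theorem dihedralAct_one (S : V →ₗ[ℂ] V) (R : V →ₛₗ[starRingEnd ℂ] V) (v : V) :
    dihedralAct (S.restrictScalars ℝ) (toReal R) (1 : DihedralGroup T) v = v := by
  -- `ZMod T` computes its `val` only once T is a constructor.
  rw [DihedralGroup.one_def, dihedralAct_r]; cases T <;> rfl

/-- No linearity of `f` is needed, only that it intertwines the two generators. It serves for
evaluation at a slot and for maps of coefficient spaces. -/
theorem dihedralAct_comm {S : V →ₗ[ℂ] V} {R : V →ₛₗ[starRingEnd ℂ] V} {S' : V' →ₗ[ℂ] V'}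
    {R' : V' →ₛₗ[starRingEnd ℂ] V'} (f : V → V') (hS : ∀ x, f (S x) = S' (f x))
    (hR : ∀ x, f (R x) = R' (f x)) (α : DihedralGroup T) (v : V) :
    f (dihedralAct (S.restrictScalars ℝ) (toReal R) α v) =
      dihedralAct (S'.restrictScalars ℝ) (toReal R') α (f v) := by
  have key : ∀ (n : ℕ), f ((S ^ n : Module.End ℂ V) v) = (S' ^ n : Module.End ℂ V') (f v) := by
    intro n
    induction n with
    | zero => rfl
    | succ n ih => rw [pow_succ', pow_succ', Module.End.mul_apply, Module.End.mul_apply, hS, ih]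
  cases α with
  | r i => rw [dihedralAct_r, dihedralAct_r, key]
  | sr i => rw [dihedralAct_sr, dihedralAct_sr, hR, key]

/-- A subset stable under the two generators is stable under the group. -/
theorem dihedralAct_mem {S : V →ₗ[ℂ] V} {R : V →ₛₗ[starRingEnd ℂ] V} (p : Set V)
    (hS : ∀ x ∈ p, S x ∈ p) (hR : ∀ x ∈ p, R x ∈ p) (α : DihedralGroup T) {v : V} (hv : v ∈ p) :
    dihedralAct (S.restrictScalars ℝ) (toReal R) α v ∈ p := by
  have key : ∀ (n : ℕ), (S ^ n : Module.End ℂ V) v ∈ p := by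
    intro n
    induction n with
    | zero => exact hv
    | succ n ih => rw [pow_succ']; exact hS _ ih
  cases α with
  | r i => rw [dihedralAct_r]; exact key _
  | sr i => rw [dihedralAct_sr]; exact hR _ (key _)

/-- The action of the dihedral group with an additional scalar in the action of `s`. -/
def slotAct (w : ℂ) (S : V →ₗ[ℂ] V) (R : V →ₛₗ[starRingEnd ℂ] V) (α : DihedralGroup T) :
    Module.End ℝ V :=
  dihedralAct ((w • S).restrictScalars ℝ) (toReal R) α

theorem slotAct_r (w : ℂ) (S : V →ₗ[ℂ] V) (R : V →ₛₗ[starRingEnd ℂ] V) (i : ZMod T) (v : V) :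
    slotAct w S R (.r i) v = w ^ i.val • (S ^ i.val : Module.End ℂ V) v := by
  unfold slotAct; rw [dihedralAct_r, smul_pow]; rfl

theorem slotAct_sr (w : ℂ) (S : V →ₗ[ℂ] V) (R : V →ₛₗ[starRingEnd ℂ] V) (i : ZMod T) (v : V) :
    slotAct w S R (.sr i) v = R (w ^ i.val • (S ^ i.val : Module.End ℂ V) v) := by
  unfold slotAct; rw [dihedralAct_sr, smul_pow]; rfl

end Dihedral

section RootOfUnity

variable {T : ℕ} [NeZero T] {ω : ℂ}

theorem mul_conj_root (hω : IsPrimitiveRoot ω T) {n : ℕ} : ω ^ n * starRingEnd ℂ (ω ^ n) = 1 := by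
  rw [Complex.mul_conj, Complex.normSq_eq_norm_sq, norm_pow, hω.norm'_eq_one (NeZero.ne T)]
  simp

theorem conj_root (hω : IsPrimitiveRoot ω T) : starRingEnd ℂ ω = ω⁻¹ := by
  have := mul_conj_root hω (n := 1)
  rw [pow_one] at this
  exact eq_inv_of_mul_eq_one_right this

end RootOfUnity

section Tensor

variable {V : Type*} [AddCommGroup V] [Module ℂ V] {V' : Type*} [AddCommGroup V'] [Module ℂ V']
  {T : ℕ}

theorem IsDihedral.tensor {S : V →ₗ[ℂ] V} {R : V →ₛₗ[starRingEnd ℂ] V} {S' : V' →ₗ[ℂ] V'}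
    {R' : V' →ₛₗ[starRingEnd ℂ] V'} (h : IsDihedral T S R) (h' : IsDihedral T S' R') :
    IsDihedral T (TensorProduct.map S S') (TensorProduct.map R R') where
  pow := by
    rw [TensorProduct.map_pow, h.pow, h'.pow]; exact TensorProduct.map_id
  invol x := by
    induction x using TensorProduct.induction_on with
    | zero => simp
    | tmul a b =>
      rw [TensorProduct.map_tmul, TensorProduct.map_tmul, h.invol, h'.invol]
    | add a b ha hb => rw [map_add, map_add, ha, hb]
  rel x := by
    induction x using TensorProduct.induction_on with
    | zero => simp
    | tmul a b => simp only [TensorProduct.map_tmul, h.rel, h'.rel]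
    | add a b ha hb => simp only [map_add, ha, hb]

end Tensor

/-! ### The automorphisms of the finite and affine algebras as dihedral actions. -/

section LieSection

variable {g : Type*} [LieRing g] [LieAlgebra ℂ g] {T : ℕ} (L : LieData g T)

theorem LieData.σL_pow : (L.σL ^ T : Module.End ℂ g) = 1 := by
  ext x
  rw [Module.End.coe_pow]
  exact L.σ_pow x

/-- The projection onto an eigenspace of `σ`. -/
theorem LieData.σL_sum_eigen [NeZero T] (x : g) (j : ℕ) :
    L.σL (∑ k : Fin T, (L.ω ^ (j * (k : ℕ)))⁻¹ • (L.σL ^ (k : ℕ) : Module.End ℂ g) x) =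
      L.ω ^ j • ∑ k : Fin T, (L.ω ^ (j * (k : ℕ)))⁻¹ • (L.σL ^ (k : ℕ) : Module.End ℂ g) x := by
  rw [map_sum, Finset.smul_sum, Fin.sum_univ_eq_sum_range
    (fun k => L.σL ((L.ω ^ (j * k))⁻¹ • (L.σL ^ k : Module.End ℂ g) x)),
    Fin.sum_univ_eq_sum_range
    (fun k => L.ω ^ j • (L.ω ^ (j * k))⁻¹ • (L.σL ^ k : Module.End ℂ g) x)]
  have e : ∀ k : ℕ, L.σL ((L.ω ^ (j * k))⁻¹ • (L.σL ^ k : Module.End ℂ g) x) =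
      L.ω ^ j • (L.ω ^ (j * (k + 1)))⁻¹ • (L.σL ^ (k + 1) : Module.End ℂ g) x := by
    intro k
    -- Applying σ shifts the summation index by one; the sum is cyclic because both σ and ω have
    -- T-th power 1, which closes the shift below.
    rw [map_smul, smul_smul, pow_succ' L.σL]
    congr 1
    have := L.ω_ne
    rw [mul_add, mul_one, pow_add]
    field_simp
  simp only [e]
  have h1 := Finset.sum_range_succ' (fun k =>
    L.ω ^ j • (L.ω ^ (j * k))⁻¹ • (L.σL ^ k : Module.End ℂ g) x) T
  have h2 := Finset.sum_range_succ (fun k =>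
    L.ω ^ j • (L.ω ^ (j * k))⁻¹ • (L.σL ^ k : Module.End ℂ g) x) T
  rw [h1] at h2
  have h3 : L.ω ^ (j * T) = 1 := by rw [mul_comm, pow_mul, L.ω_prim.pow_eq_one, one_pow]
  rw [h3, L.σL_pow] at h2
  simpa using h2

/-- The orthogonality of characters: summing ω^(-jk) over j leaves only k = 0. Up to the factor T,
every vector is thus a sum of eigenvectors. -/
theorem LieData.sum_eigen [NeZero T] (x : g) :
    ∑ j : Fin T, ∑ k : Fin T, (L.ω ^ ((j : ℕ) * (k : ℕ)))⁻¹ • (L.σL ^ (k : ℕ) : Module.End ℂ g) x =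
      (T : ℂ) • x := by
  rw [Finset.sum_comm]
  have e : ∀ k : Fin T, ∑ j : Fin T, (L.ω ^ ((j : ℕ) * (k : ℕ)))⁻¹ = if k = 0 then (T : ℂ) else 0 := by
    intro k
    split_ifs with hk
    · subst hk; simp
    · have hk' : (k : ℕ) ≠ 0 := fun h => hk (Fin.ext (by simpa using h))
      have h1 : (L.ω⁻¹) ^ (k : ℕ) ≠ 1 := L.ω_prim.inv.pow_ne_one_of_pos_of_lt hk' k.2
      rw [Fin.sum_univ_eq_sum_range (fun j => (L.ω ^ (j * (k : ℕ)))⁻¹)]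
      have e2 : ∀ j, (L.ω ^ (j * (k : ℕ)))⁻¹ = ((L.ω⁻¹) ^ (k : ℕ)) ^ j := by
        intro j; rw [← pow_mul, inv_pow, mul_comm]
      simp only [e2]
      rw [geom_sum_eq h1, ← pow_mul, mul_comm, pow_mul, L.ω_prim.inv.pow_eq_one]
      simp
  simp only [← Finset.sum_smul, e]
  simp

/-- Stability of the eigenspaces under τ is exactly this relation: on an ω^j-eigenvector, the left
side acquires ω^j times its conjugate. The general case follows by decomposing into eigenvectors. -/
theorem LieData.rel [NeZero T] (x : g) : L.σL (L.τ (L.σL x)) = L.τ x := by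
  have hT : (T : ℂ) ≠ 0 := Nat.cast_ne_zero.2 (NeZero.ne T)
  have key : ∀ (j : ℕ) (y : g), L.σL y = L.ω ^ j • y → L.σL (L.τ (L.σL y)) = L.τ y := by
    intro j y hy
    have h1 : L.σL (L.τ y) = L.ω ^ j • L.τ y := L.τ_stable j y hy
    rw [hy, L.τ.map_smulₛₗ, map_smul, h1, smul_smul, mul_comm, mul_conj_root L.ω_prim, one_smul]
  have h := L.sum_eigen x
  have e : x = (T : ℂ)⁻¹ • ((T : ℂ) • x) := by rw [smul_smul, inv_mul_cancel₀ hT, one_smul]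
  rw [e, ← h]
  simp only [map_smul, L.τ.map_smulₛₗ, map_sum]
  congr 1
  refine Finset.sum_congr rfl fun j _ => ?_
  have := key j _ (L.σL_sum_eigen x j)
  simpa only [map_smul, L.τ.map_smulₛₗ, map_sum] using this

theorem LieData.isDihedral [NeZero T] : IsDihedral T L.σL L.τ := ⟨L.σL_pow, L.τ_invol, L.rel⟩

theorem loopPart_σt (X : AffineKM g) (n : ℤ) :
    AffineKM.loopPart (L.σt X) n = L.σL (AffineKM.loopPart X n) := rfl

theorem loopPart_τt (X : AffineKM g) (n : ℤ) :
    AffineKM.loopPart (L.τt X) n = L.τ (AffineKM.loopPart X (-n)) := rfl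

theorem loopPart_mode (x : g) (n m : ℤ) :
    AffineKM.loopPart (AffineKM.mode x n) m = if n = m then x else 0 := by
  classical
  exact Finsupp.single_apply

theorem AffineKM.ext {X Y : AffineKM g}
    (h : ∀ n, AffineKM.loopPart X n = AffineKM.loopPart Y n)
    (hk : AffineKM.kPart X = AffineKM.kPart Y) (hd : AffineKM.dPart X = AffineKM.dPart Y) :
    X = Y :=
  Prod.ext (Finsupp.ext h) (Prod.ext hk hd)

theorem σt_pow (n : ℕ) (X : AffineKM g) (m : ℤ) :
    AffineKM.loopPart ((L.σt ^ n : Module.End ℂ _) X) m =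
      (L.σL ^ n : Module.End ℂ g) (AffineKM.loopPart X m) := by
  induction n with
  | zero => rfl
  | succ n ih =>
    rw [pow_succ', pow_succ', Module.End.mul_apply, Module.End.mul_apply, loopPart_σt, ih]

theorem LieData.isDihedral_t [NeZero T] : IsDihedral T L.σt L.τt where
  pow := by
    have h : ∀ (n : ℕ) (X : AffineKM g), ((L.σt ^ n : Module.End ℂ _) X).2 = X.2 := by
      intro n X
      induction n with
      | zero => rfl
      | succ n ih => rw [pow_succ']; exact ih
    refine LinearMap.ext fun X => AffineKM.ext (fun n => ?_) ?_ ?_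
    · rw [σt_pow, L.σL_pow]; rfl
    · exact congrArg Prod.fst (h T X)
    · exact congrArg Prod.snd (h T X)
  invol X := by
    refine AffineKM.ext (fun n => ?_) ?_ ?_
    · rw [loopPart_τt, loopPart_τt, L.τ_invol, neg_neg]
    · change -starRingEnd ℂ (-starRingEnd ℂ X.2.1) = X.2.1
      simp
    · change -starRingEnd ℂ (-starRingEnd ℂ X.2.2) = X.2.2
      simp
  rel X := by
    refine AffineKM.ext (fun n => ?_) rfl rfl
    rw [loopPart_σt, loopPart_τt, loopPart_σt, loopPart_τt, L.rel]

theorem isDihedral_conj {W : Type*} [AddCommGroup W] [Module ℝ W] :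
    IsDihedral T (LinearMap.id : ℂ ⊗[ℝ] W →ₗ[ℂ] _) (conjC : ℂ ⊗[ℝ] W →ₛₗ[starRingEnd ℂ] _) where
  pow := one_pow T
  invol := conjC_conjC
  rel _ := rfl

theorem LieData.isDihedral_field [NeZero T] {W : Type*} [AddCommGroup W] [Module ℝ W] :
    IsDihedral T (fieldS L : _ ⊗[ℂ] (ℂ ⊗[ℝ] W) →ₗ[ℂ] _) (fieldT L) :=
  L.isDihedral_t.tensor isDihedral_conj

end LieSection

/-! ### Limits in completions of filtered spaces. -/

section Completion

variable {R R' R'' : Type*} [Ring R] [Ring R'] [Ring R''] {ρ : R →+* R'} {ρ' : R' →+* R''}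
  {ρ'' : R →+* R''} {V V' V'' : Type*} [AddCommGroup V]
  [AddCommGroup V'] [AddCommGroup V''] [Module R V] [Module R' V'] [Module R'' V'']

theorem Completion.ext {F : ℕ → Submodule R V} {a b : Completion F}
    (h : ∀ n, a.proj n = b.proj n) : a = b :=
  Subtype.ext (funext h)

theorem proj_complMap {F : ℕ → Submodule R V} {F' : ℕ → Submodule R' V'} (f : V →ₛₗ[ρ] V')
    (hf : ∀ n, F n ≤ (F' n).comap f) (a : Completion F) (n : ℕ) {v : V}
    (h : (F n).mkQ v = a.proj n) : (F' n).mkQ (f v) = (complMap f hf a).proj n :=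
  congrArg (Submodule.mapQ (F n) (F' n) f (hf n)) h

theorem IsLim.unique {F : ℕ → Submodule R V} {v : ℕ → V} {a b : Completion F} (ha : IsLim v a)
    (hb : IsLim v b) : a = b := by
  refine Completion.ext fun n => ?_
  obtain ⟨N, h⟩ := ha n
  obtain ⟨N', h'⟩ := hb n
  exact (h _ (le_max_left N N')).symm.trans (h' _ (le_max_right N N'))

theorem IsLim.map {F : ℕ → Submodule R V} {F' : ℕ → Submodule R' V'} (f : V →ₛₗ[ρ] V')
    (hf : ∀ n, F n ≤ (F' n).comap f) {v : ℕ → V} {a : Completion F} (ha : IsLim v a) :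
    IsLim (fun N => f (v N)) (complMap f hf a) := by
  intro n
  obtain ⟨N, h⟩ := ha n
  exact ⟨N, fun N' hN' => proj_complMap f hf a n (h N' hN')⟩

theorem IsLim.add {F : ℕ → Submodule R V} {v w : ℕ → V} {a b : Completion F} (ha : IsLim v a)
    (hb : IsLim w b) : IsLim (fun N => v N + w N) (a + b) := by
  intro n
  obtain ⟨N, h⟩ := ha n
  obtain ⟨N', h'⟩ := hb n
  refine ⟨max N N', fun M hM => ?_⟩
  rw [map_add, h M (le_trans (le_max_left _ _) hM), h' M (le_trans (le_max_right _ _) hM)]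
  rfl

theorem IsLim.smul {F : ℕ → Submodule R V} {v : ℕ → V} {a : Completion F} (r : R)
    (ha : IsLim v a) : IsLim (fun N => r • v N) (r • a) := by
  intro n
  obtain ⟨N, h⟩ := ha n
  refine ⟨N, fun M hM => ?_⟩
  rw [map_smul, h M hM]
  rfl

theorem isLim_zero {F : ℕ → Submodule R V} : IsLim (fun _ => 0) (0 : Completion F) :=
  fun n => ⟨0, fun _ _ => map_zero (F n).mkQ⟩

theorem IsLim.sum {F : ℕ → Submodule R V} {ι : Type*} (s : Finset ι) {v : ι → ℕ → V}
    {a : ι → Completion F} (h : ∀ i ∈ s, IsLim (v i) (a i)) :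
    IsLim (fun N => ∑ i ∈ s, v i N) (∑ i ∈ s, a i) := by
  classical
  induction s using Finset.induction_on with
  | empty => simpa using isLim_zero
  | insert i s hi ih =>
    simp only [Finset.sum_insert hi]
    exact (h i (Finset.mem_insert_self i s)).add
      (ih fun j hj => h j (Finset.mem_insert_of_mem hj))

/-- A sequence whose differences tend to zero converges. -/
theorem exists_isLim {F : ℕ → Submodule R V} (hF : Antitone F) {v : ℕ → V}
    (hv : ∀ N, 1 ≤ N → v (N + 1) - v N ∈ F N) : ∃ a : Completion F, IsLim v a := by
  have key : ∀ n N, n + 1 ≤ N → (F n).mkQ (v N) = (F n).mkQ (v (n + 1)) := by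
    intro n N hN
    induction N, hN using Nat.le_induction with
    | base => rfl
    | succ N hN ih =>
      rw [← ih, ← sub_eq_zero, ← map_sub]
      exact (Submodule.Quotient.mk_eq_zero _).2 (hF (by omega) (hv N (by omega)))
  -- The index is n + 1 because the differences are controlled only from N = 1 on, so v 0 must be
  -- avoided for n = 0.
  refine ⟨⟨fun n => (F n).mkQ (v (n + 1)), fun n m h => ⟨v (m + 1), rfl, key n _ (by omega)⟩⟩, ?_⟩
  intro n
  exact ⟨n + 1, fun N hN => key n N hN⟩

theorem Completion.exists_isLim_const {F : ℕ → Submodule R V} (a : Completion F) (n : ℕ) :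
    ∃ v, (F n).mkQ v = a.proj n :=
  (F n).mkQ_surjective _

/-- Each relation is tested in every quotient on a representative, where it is the relation of the
original operators. -/
theorem isDihedral_compl {V : Type*} [AddCommGroup V] [Module ℂ V] {T : ℕ}
    {F : ℕ → Submodule ℂ V} {S : V →ₗ[ℂ] V} {R : V →ₛₗ[starRingEnd ℂ] V} (h : IsDihedral T S R)
    (hS : ∀ n, F n ≤ (F n).comap S) (hR : ∀ n, F n ≤ (F n).comap R) :
    IsDihedral T (complMap S hS) (complMap R hR) where
  pow := by
    refine LinearMap.ext fun a => Completion.ext fun n => ?_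
    obtain ⟨v, hv⟩ := a.exists_isLim_const n
    have key : ∀ k : ℕ, (F n).mkQ ((S ^ k : Module.End ℂ V) v) =
        ((complMap S hS ^ k : Module.End ℂ (Completion F)) a).proj n := by
      intro k
      induction k with
      | zero => exact hv
      | succ k ih =>
        rw [pow_succ', pow_succ']
        exact proj_complMap S hS _ n ih
    rw [← key T, h.pow]
    exact hv
  invol a := Completion.ext fun n => by
    obtain ⟨v, hv⟩ := a.exists_isLim_const n
    rw [← proj_complMap R hR _ n (proj_complMap R hR a n hv), h.invol, hv]
  rel a := Completion.ext fun n => by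
    obtain ⟨v, hv⟩ := a.exists_isLim_const n
    rw [← proj_complMap S hS _ n (proj_complMap R hR _ n (proj_complMap S hS a n hv)), h.rel,
      proj_complMap R hR a n hv]

end Completion

/-! ### The action on differentials -/

section Diff

theorem ratComp_algebraMap (u : RatFunc ℂ) (hu : Transcendental ℂ u) (p : Polynomial ℂ) :
    ratComp u hu (algebraMap _ _ p) = Polynomial.aeval u p := by
  unfold ratComp
  rw [IsFractionRing.liftAlgHom_apply]
  exact IsFractionRing.lift_algebraMap _ _

theorem ratComp_X (u : RatFunc ℂ) (hu : Transcendental ℂ u) : ratComp u hu RatFunc.X = u := by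
  rw [← RatFunc.algebraMap_X, ratComp_algebraMap, Polynomial.aeval_X]

theorem ratComp_C (u : RatFunc ℂ) (hu : Transcendental ℂ u) (c : ℂ) :
    ratComp u hu (RatFunc.C c) = RatFunc.C c := by
  rw [← RatFunc.algebraMap_C, ratComp_algebraMap, Polynomial.aeval_C, RatFunc.algebraMap_C]
  rfl

theorem ratConj_algebraMap (p : Polynomial ℂ) :
    ratConj (algebraMap _ _ p) = algebraMap _ _ (p.map (starRingEnd ℂ)) :=
  IsFractionRing.lift_algebraMap _ _

theorem ratConj_X : ratConj RatFunc.X = RatFunc.X := by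
  rw [← RatFunc.algebraMap_X, ratConj_algebraMap, Polynomial.map_X]

theorem ratConj_C (c : ℂ) : ratConj (RatFunc.C c) = RatFunc.C (starRingEnd ℂ c) := by
  rw [← RatFunc.algebraMap_C, ratConj_algebraMap, Polynomial.map_C, RatFunc.algebraMap_C]

theorem diffT_polarDiff (x : ℂ) (p : ℕ) :
    diffT (polarDiff x p) = polarDiff (starRingEnd ℂ x) p := by
  change ratConj _ = _
  unfold polarDiff
  rw [map_inv₀, map_pow, map_sub, ratConj_X, ratConj_C]

theorem diffT_X_pow (q : ℕ) : diffT (RatFunc.X ^ q : RatFunc ℂ) = RatFunc.X ^ q := by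
  change ratConj _ = _
  rw [map_pow, ratConj_X]

/-- Factoring ω⁻¹ out of ω⁻¹z - x produces ω^(p+1), and dz contributes ω⁻¹. -/
theorem diffS_polarDiff {ω : ℂ} (hω : ω ≠ 0) (x : ℂ) (p : ℕ) :
    diffS hω (polarDiff x p) = ω ^ p • polarDiff (ω * x) p := by
  change ω⁻¹ • ratComp _ (transcendental_scale_X (inv_ne_zero hω)) _ = _
  unfold polarDiff
  rw [map_inv₀, map_pow, map_sub, ratComp_X, ratComp_C, RatFunc.smul_eq_C_mul,
    RatFunc.smul_eq_C_mul]
  have h : (RatFunc.C ω⁻¹ * RatFunc.X - RatFunc.C x : RatFunc ℂ) =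
      (RatFunc.C ω)⁻¹ * (RatFunc.X - RatFunc.C (ω * x)) := by
    have h0 : (RatFunc.C ω : RatFunc ℂ) ≠ 0 := by simpa using hω
    rw [map_inv₀, map_mul]
    field_simp
  have h0 : (RatFunc.C ω : RatFunc ℂ) ≠ 0 := by simpa using hω
  rw [h, mul_pow, mul_inv, map_inv₀, map_pow, inv_pow, inv_inv, pow_succ (RatFunc.C ω)]
  field_simp

theorem diffS_X_pow {ω : ℂ} (hω : ω ≠ 0) (q : ℕ) :
    diffS hω (RatFunc.X ^ q) = (ω ^ (q + 1))⁻¹ • (RatFunc.X ^ q : RatFunc ℂ) := by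
  change ω⁻¹ • ratComp _ (transcendental_scale_X (inv_ne_zero hω)) _ = _
  rw [map_pow, ratComp_X, RatFunc.smul_eq_C_mul, RatFunc.smul_eq_C_mul, mul_pow, ← mul_assoc,
    ← map_pow, ← map_mul, pow_succ]
  congr 2
  rw [mul_inv, inv_pow, mul_comm]

/-- The sequence `f` is the orbit of a differential under `s`, with the scalar `w` acquired at each
step. -/
theorem diff_pow {V : Type*} [AddCommGroup V] [Module ℂ V] (S : V →ₗ[ℂ] V) {ω : ℂ} (hω : ω ≠ 0)
    {w : ℂ} {f : ℕ → RatFunc ℂ} (hf : ∀ n, diffS hω (f n) = w • f (n + 1)) (n : ℕ) (v : V) :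
    (TensorProduct.map S (diffS hω) ^ n : Module.End ℂ _) (v ⊗ₜ[ℂ] f 0) =
      (w ^ n • (S ^ n : Module.End ℂ V) v) ⊗ₜ[ℂ] f n := by
  induction n with
  | zero => simp
  | succ n ih =>
    rw [pow_succ', Module.End.mul_apply, ih, TensorProduct.map_tmul, hf, map_smul,
      TensorProduct.tmul_smul, TensorProduct.smul_tmul', smul_smul, ← pow_succ', pow_succ' S]
    rfl

theorem ratFunc_induction {P : RatFunc ℂ → Prop} (h0 : ∀ p : Polynomial ℂ, P (algebraMap _ _ p))
    (h1 : ∀ f h, P f → P h → P (f * h)) (h2 : ∀ f, P f → P f⁻¹) (f : RatFunc ℂ) : P f := by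
  induction f using RatFunc.induction_on with
  | f p q hq => rw [div_eq_mul_inv]; exact h1 _ _ (h0 p) (h2 _ (h0 q))

theorem isDihedral_diff {T : ℕ} [NeZero T] {ω : ℂ} (hω : IsPrimitiveRoot ω T) (h : ω ≠ 0) :
    IsDihedral T (diffS h) diffT := by
  -- Ring endomorphisms of ℂ(z) are determined by z and the constants, so each relation reduces to a
  -- check on these.
  have key : ∀ (φ ψ : RatFunc ℂ →+* RatFunc ℂ), φ RatFunc.X = ψ RatFunc.X →
      (∀ c, φ (RatFunc.C c) = ψ (RatFunc.C c)) → φ = ψ := by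
    intro φ ψ hX hC
    have hp : ∀ p : Polynomial ℂ, φ (algebraMap _ _ p) = ψ (algebraMap _ _ p) := by
      intro p
      induction p using Polynomial.induction_on' with
      | add p q hp hq => simp only [map_add, hp, hq]
      | monomial n a =>
        rw [← Polynomial.C_mul_X_pow_eq_monomial, map_mul, map_pow, RatFunc.algebraMap_C,
          RatFunc.algebraMap_X, map_mul, map_mul, map_pow, map_pow, hX, hC]
    ext f
    refine ratFunc_induction (P := fun f => φ f = ψ f) hp (fun f k hf hk => ?_)
      (fun f hf => ?_) f
    · rw [map_mul, map_mul, hf, hk]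
    · rw [map_inv₀, map_inv₀, hf]
  set s := ratComp _ (transcendental_scale_X (inv_ne_zero h)) with hs
  have hsX : s RatFunc.X = RatFunc.C ω⁻¹ * RatFunc.X := ratComp_X _ _
  have hsC : ∀ c, s (RatFunc.C c) = RatFunc.C c := ratComp_C _ _
  have e : ∀ f, diffS h f = ω⁻¹ • s f := fun f => rfl
  -- The scalar is the one coming from dz; it is split off so that what remains is a ring
  -- homomorphism and `key` applies.
  have hpow : ∀ (n : ℕ) (f : RatFunc ℂ), (diffS h ^ n : Module.End ℂ _) f =
      (ω⁻¹) ^ n • (s ^ n : RatFunc ℂ →ₐ[ℂ] RatFunc ℂ) f := by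
    intro n f
    induction n with
    | zero => simp
    | succ n ih =>
      rw [pow_succ', Module.End.mul_apply, ih, map_smul, e, pow_succ' s, AlgHom.mul_apply,
        smul_smul, pow_succ]
  have hsnX : ∀ n : ℕ, (s ^ n : RatFunc ℂ →ₐ[ℂ] RatFunc ℂ) RatFunc.X =
      RatFunc.C ((ω⁻¹) ^ n) * RatFunc.X := by
    intro n
    induction n with
    | zero => simp
    | succ n ih =>
      rw [pow_succ', AlgHom.mul_apply, ih, map_mul, hsC, hsX, ← mul_assoc, ← map_mul, pow_succ]
  have hsnC : ∀ (n : ℕ) (c : ℂ), (s ^ n : RatFunc ℂ →ₐ[ℂ] RatFunc ℂ) (RatFunc.C c) =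
      RatFunc.C c := by
    intro n c
    induction n with
    | zero => simp
    | succ n ih => rw [pow_succ', AlgHom.mul_apply, ih, hsC]
  have hT : (ω⁻¹) ^ T = 1 := by rw [inv_pow, hω.pow_eq_one, inv_one]
  refine ⟨?_, ?_, ?_⟩
  · refine LinearMap.ext fun f => ?_
    rw [hpow, hT, one_smul]
    have := key ((s ^ T : RatFunc ℂ →ₐ[ℂ] RatFunc ℂ) : RatFunc ℂ →+* RatFunc ℂ) (RingHom.id _)
      ((hsnX T).trans (by rw [hT]; simp)) (fun c => hsnC T c)
    exact congrArg (fun φ : RatFunc ℂ →+* RatFunc ℂ => φ f) this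
  · intro f
    have := key (ratConj.comp ratConj) (RingHom.id _) (by simp [ratConj_X]) (by simp [ratConj_C])
    exact congrArg (fun φ : RatFunc ℂ →+* RatFunc ℂ => φ f) this
  · intro f
    have h0 : (RatFunc.C ω : RatFunc ℂ) ≠ 0 := by simpa using h
    have := key ((s : RatFunc ℂ →+* RatFunc ℂ).comp (ratConj.comp s)) ratConj
      (by simp [ratConj_X, hsX, hsC, ratConj_C, conj_root hω, h0])
      (by simp [ratConj_C, hsC])
    have h2 : s (ratConj (s f)) = ratConj f :=
      congrArg (fun φ : RatFunc ℂ →+* RatFunc ℂ => φ f) this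
    have h3 : diffT (ω⁻¹ • s f) = starRingEnd ℂ ω⁻¹ • diffT (s f) := diffT.map_smulₛₗ _ _
    rw [e f, h3, map_smul, e, smul_smul]
    have h4 : starRingEnd ℂ ω⁻¹ * ω⁻¹ = 1 := by
      rw [map_inv₀, conj_root hω, inv_inv, mul_inv_cancel₀ h]
    rw [h4, one_smul]
    exact h2

end Diff

/-! ### Elementary polar differentials and how the group moves them. -/

section SlotDiff

variable {T : ℕ} [NeZero T] {ω : ℂ} {Z : Divisor T ω}

/-- The differential `dz / (z - α x) ^ (p + 1)`, respectively `- z ^ q dz`. -/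
def slotDiff : Slot Z → DihedralGroup T → RatFunc ℂ
  | .inl s, α => polarDiff (mob ω α (s.1 : ℂ)) (s.2 : ℕ)
  | .inr q, _ => -RatFunc.X ^ (q : ℕ)

theorem mob_one (x : ℂ) : mob ω (1 : DihedralGroup T) x = x := by
  rw [DihedralGroup.one_def]
  simp [mob]

theorem slotDiff_fixes {s : Slot Z} {α : DihedralGroup T} (h : Fixes s α) :
    slotDiff s α = slotDiff s 1 := by
  cases s with
  | inl s =>
    change polarDiff (mob ω α (s.1 : ℂ)) _ = polarDiff (mob ω 1 (s.1 : ℂ)) _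
    rw [mob_one, show mob ω α (s.1 : ℂ) = s.1 from h]
  | inr q => rfl

theorem slotWeight_conj (hω : IsPrimitiveRoot ω T) (s : Slot Z) :
    slotWeight s * starRingEnd ℂ (slotWeight s) = 1 := by
  cases s with
  | inl s =>
    change (ω ^ (s.2 : ℕ))⁻¹ * starRingEnd ℂ (ω ^ (s.2 : ℕ))⁻¹ = 1
    rw [map_inv₀, ← mul_inv, mul_conj_root hω, inv_one]
  | inr q => exact mul_conj_root hω

theorem slotWeight_ne (hω : IsPrimitiveRoot ω T) (s : Slot Z) : slotWeight s ≠ 0 :=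
  left_ne_zero_of_mul_eq_one (slotWeight_conj hω s)

theorem slotWeight_pow (hω : IsPrimitiveRoot ω T) (s : Slot Z) : slotWeight s ^ T = 1 := by
  cases s with
  | inl s =>
    change ((ω ^ (s.2 : ℕ))⁻¹) ^ T = 1
    rw [inv_pow, ← pow_mul, mul_comm, pow_mul, hω.pow_eq_one, one_pow, inv_one]
  | inr q =>
    change (ω ^ ((q : ℕ) + 1)) ^ T = 1
    rw [← pow_mul, mul_comm, pow_mul, hω.pow_eq_one, one_pow]

variable {V : Type*} [AddCommGroup V] [Module ℂ V]

theorem diffAct_polarDiff (h0 : ω ≠ 0) (S : V →ₗ[ℂ] V) (R : V →ₛₗ[starRingEnd ℂ] V)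
    (α : DihedralGroup T) (v : V) (x : ℂ) (p : ℕ) :
    diffAct h0 S R α (v ⊗ₜ[ℂ] polarDiff x p) =
      slotAct (ω ^ p) S R α v ⊗ₜ[ℂ] polarDiff (mob ω α x) p := by
  have h1 := diff_pow S h0 (w := ω ^ p) (f := fun n => polarDiff (ω ^ n * x) p)
    (fun n => by rw [diffS_polarDiff, pow_succ', mul_assoc])
  simp only [pow_zero, one_mul] at h1
  cases α with
  | r i =>
    unfold diffAct
    rw [slotAct_r, dihedralAct_r, h1]
    rfl
  | sr i =>
    unfold diffAct
    rw [slotAct_sr, dihedralAct_sr, h1, TensorProduct.map_tmul, diffT_polarDiff]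
    rfl

theorem diffAct_X_pow (h0 : ω ≠ 0) (S : V →ₗ[ℂ] V) (R : V →ₛₗ[starRingEnd ℂ] V)
    (α : DihedralGroup T) (v : V) (q : ℕ) :
    diffAct h0 S R α (v ⊗ₜ[ℂ] (RatFunc.X ^ q : RatFunc ℂ)) =
      slotAct (ω ^ (q + 1))⁻¹ S R α v ⊗ₜ[ℂ] (RatFunc.X ^ q : RatFunc ℂ) := by
  have h1 := diff_pow S h0 (w := (ω ^ (q + 1))⁻¹) (f := fun n => (RatFunc.X ^ q : RatFunc ℂ))
    (fun n => diffS_X_pow h0 q)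
  cases α with
  | r i =>
    unfold diffAct
    rw [slotAct_r, dihedralAct_r, h1]
  | sr i =>
    unfold diffAct
    rw [slotAct_sr, dihedralAct_sr, h1, TensorProduct.map_tmul, diffT_X_pow]

/-- The weight is inverse to that of the Takiff generator because ε_x^p and dz/(z - x)^(p+1), and
likewise ε_∞^(q+1) and z^q dz, scale oppositely; this keeps the residue pairing invariant. -/
theorem diffAct_slotDiff (h0 : ω ≠ 0) (S : V →ₗ[ℂ] V) (R : V →ₛₗ[starRingEnd ℂ] V)
    (α : DihedralGroup T) (v : V) (s : Slot Z) :
    diffAct h0 S R α (v ⊗ₜ[ℂ] slotDiff s 1) =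
      slotAct (slotWeight s)⁻¹ S R α v ⊗ₜ[ℂ] slotDiff s α := by
  cases s with
  | inl s =>
    change diffAct h0 S R α (v ⊗ₜ[ℂ] polarDiff (mob ω 1 (s.1 : ℂ)) _) =
      slotAct ((ω ^ (s.2 : ℕ))⁻¹)⁻¹ S R α v ⊗ₜ[ℂ] polarDiff (mob ω α (s.1 : ℂ)) _
    rw [mob_one, diffAct_polarDiff, inv_inv]
  | inr q =>
    change diffAct h0 S R α (v ⊗ₜ[ℂ] (-RatFunc.X ^ (q : ℕ))) =
      slotAct (ω ^ ((q : ℕ) + 1))⁻¹ S R α v ⊗ₜ[ℂ] (-RatFunc.X ^ (q : ℕ))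
    rw [TensorProduct.tmul_neg, map_neg, diffAct_X_pow, TensorProduct.tmul_neg]

theorem IsDihedral.diffAct_mul (hω : IsPrimitiveRoot ω T) (h0 : ω ≠ 0) {S : V →ₗ[ℂ] V}
    {R : V →ₛₗ[starRingEnd ℂ] V} (h : IsDihedral T S R) (α β : DihedralGroup T)
    (v : V ⊗[ℂ] RatFunc ℂ) :
    diffAct h0 S R (α * β) v = diffAct h0 S R α (diffAct h0 S R β v) :=
  (h.tensor (isDihedral_diff hω h0)).mul α β v

theorem diffAct_one (h0 : ω ≠ 0) (S : V →ₗ[ℂ] V) (R : V →ₛₗ[starRingEnd ℂ] V)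
    (v : V ⊗[ℂ] RatFunc ℂ) : diffAct h0 S R (1 : DihedralGroup T) v = v :=
  dihedralAct_one _ _ v

end SlotDiff

/-! ### Laurent coefficients and partial fractions -/

section Laurent

theorem germZero_algebraMap (p : Polynomial ℂ) :
    germZero (algebraMap _ _ p) = polyToLaurent p :=
  IsFractionRing.lift_algebraMap _ _

theorem coeff_ofPowerSeries_neg (p : PowerSeries ℂ) {m : ℤ} (hm : m < 0) :
    (HahnSeries.ofPowerSeries ℤ ℂ p).coeff m = 0 := by
  rw [PowerSeries.coeff_coe, if_pos hm]

theorem germZero_X : germZero RatFunc.X = HahnSeries.single 1 1 := by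
  rw [← RatFunc.algebraMap_X, germZero_algebraMap]
  change HahnSeries.ofPowerSeries ℤ ℂ ((Polynomial.X : Polynomial ℂ) : PowerSeries ℂ) = _
  rw [Polynomial.coe_X, HahnSeries.ofPowerSeries_X]

theorem coeffAt_algebraMap (x : ℂ) (p : Polynomial ℂ) {m : ℤ} (hm : m < 0) :
    coeffAt x m (algebraMap _ _ p) = 0 := by
  change (germZero (RatFunc.laurent x (algebraMap _ _ p))).coeff m = 0
  rw [RatFunc.laurent_algebraMap, germZero_algebraMap]
  exact coeff_ofPowerSeries_neg _ hm

theorem coeffAt_X_pow (x : ℂ) (q : ℕ) {m : ℤ} (hm : m < 0) :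
    coeffAt x m (RatFunc.X ^ q) = 0 := by
  rw [← RatFunc.algebraMap_X, ← map_pow]
  exact coeffAt_algebraMap x _ hm

theorem coeffAt_polarDiff_self (x : ℂ) (p : ℕ) (m : ℤ) :
    coeffAt x m (polarDiff x p) = if m = -(p : ℤ) - 1 then 1 else 0 := by
  change (germZero (RatFunc.laurent x ((RatFunc.X - RatFunc.C x) ^ (p + 1))⁻¹)).coeff m = _
  rw [map_inv₀, map_pow, map_sub, RatFunc.laurent_X, RatFunc.laurent_C, add_sub_cancel_right,
    map_inv₀, map_pow, germZero_X, HahnSeries.single_pow, HahnSeries.inv_single]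
  rw [HahnSeries.coeff_single]
  simp only [one_pow, inv_one]
  congr 1
  simp only [eq_iff_iff]
  constructor <;> intro h <;> simp only [nsmul_eq_mul] at * <;> push_cast at * <;> linarith

/-- A polynomial with non-zero constant term is a unit among power series; this detects the absence
of a pole. -/
theorem exists_germ_inv (p : Polynomial ℂ) (hp : p.coeff 0 ≠ 0) :
    ∃ h : PowerSeries ℂ, (polyToLaurent p)⁻¹ = HahnSeries.ofPowerSeries ℤ ℂ h := by
  refine ⟨(p : PowerSeries ℂ)⁻¹, inv_eq_of_mul_eq_one_right ?_⟩
  change HahnSeries.ofPowerSeries ℤ ℂ (p : PowerSeries ℂ) * _ = 1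
  rw [← map_mul, PowerSeries.mul_inv_cancel, map_one]
  rwa [← PowerSeries.coeff_zero_eq_constantCoeff_apply, Polynomial.coeff_coe]

theorem coeffAt_polarDiff_ne {x y : ℂ} (hxy : x ≠ y) (p : ℕ) {m : ℤ} (hm : m < 0) :
    coeffAt x m (polarDiff y p) = 0 := by
  change (germZero (RatFunc.laurent x ((RatFunc.X - RatFunc.C y) ^ (p + 1))⁻¹)).coeff m = _
  have e : (RatFunc.X + RatFunc.C x - RatFunc.C y : RatFunc ℂ) ^ (p + 1) =
      algebraMap _ _ ((Polynomial.X + Polynomial.C x - Polynomial.C y) ^ (p + 1)) := by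
    simp [RatFunc.algebraMap_X, RatFunc.algebraMap_C]
  rw [map_inv₀, map_pow, map_sub, RatFunc.laurent_X, RatFunc.laurent_C, e, map_inv₀,
    germZero_algebraMap]
  obtain ⟨h, hh⟩ := exists_germ_inv ((Polynomial.X + Polynomial.C x - Polynomial.C y) ^ (p + 1))
    (by
      rw [Polynomial.coeff_zero_eq_eval_zero]
      simp [sub_eq_zero, hxy])
  rw [hh]
  exact coeff_ofPowerSeries_neg _ hm

theorem coeffInf_X_pow (q : ℕ) (m : ℤ) :
    coeffInf m (RatFunc.X ^ q) = if m = -(q : ℤ) then 1 else 0 := by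
  change (germZero (ratComp RatFunc.X⁻¹ transcendental_inv_X _)).coeff m = _
  rw [map_pow, ratComp_X, map_pow, map_inv₀, germZero_X, HahnSeries.inv_single,
    HahnSeries.single_pow, HahnSeries.coeff_single]
  simp

/-- In the coordinate u = 1/z the function is u^(p+1)/(1 - yu)^(p+1), which vanishes at u = 0; hence
m = 0 is included. -/
theorem coeffInf_polarDiff (y : ℂ) (p : ℕ) {m : ℤ} (hm : m ≤ 0) :
    coeffInf m (polarDiff y p) = 0 := by
  change (germZero (ratComp RatFunc.X⁻¹ transcendental_inv_X _)).coeff m = _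
  unfold polarDiff
  have e : (RatFunc.X⁻¹ - RatFunc.C y : RatFunc ℂ) = RatFunc.X⁻¹ *
      algebraMap _ _ (1 - Polynomial.C y * Polynomial.X) := by
    have : (RatFunc.X : RatFunc ℂ) ≠ 0 := RatFunc.X_ne_zero
    simp only [map_sub, map_one, map_mul, RatFunc.algebraMap_X, RatFunc.algebraMap_C]
    field_simp
  rw [map_inv₀, map_pow, map_sub, ratComp_X, ratComp_C, e, mul_pow, mul_inv, inv_pow, inv_inv,
    ← map_pow, map_mul, map_inv₀, germZero_algebraMap, map_pow, germZero_X]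
  obtain ⟨h, hh⟩ := exists_germ_inv ((1 - Polynomial.C y * Polynomial.X) ^ (p + 1)) (by
      rw [Polynomial.coeff_zero_eq_eval_zero]
      simp)
  have e2 : (HahnSeries.single 1 1 : LaurentSeries ℂ) =
    HahnSeries.ofPowerSeries ℤ ℂ PowerSeries.X := (HahnSeries.ofPowerSeries_X).symm
  rw [hh, e2, ← map_pow, ← map_mul]
  rcases hm.lt_or_eq with hm | rfl
  · exact coeff_ofPowerSeries_neg _ hm
  · rw [show (0 : ℤ) = ((0 : ℕ) : ℤ) from rfl, LaurentSeries.coeff_coe_powerSeries,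
      PowerSeries.coeff_zero_eq_constantCoeff_apply]
    simp

/-- A rational function without poles in the complex plane is a polynomial. -/
theorem exists_polynomial {f : RatFunc ℂ} (hf : ∀ (x : ℂ) (m : ℤ), m < 0 → coeffAt x m f = 0) :
    ∃ p : Polynomial ℂ, f = algebraMap _ _ p := by
  -- At a root of the denominator, a regular expansion of f would force the numerator to vanish too,
  -- against coprimality.
  have hd : IsUnit f.denom := by
    by_contra hu
    have hdeg : f.denom.degree ≠ 0 := fun h => hu (Polynomial.isUnit_iff_degree_eq_zero.2 h)
    obtain ⟨x, hx⟩ := IsAlgClosed.exists_root f.denom hdeg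
    set F := germZero (RatFunc.laurent x f) with hF
    have hF0 : ∀ m : ℤ, m < 0 → F.coeff m = 0 := hf x
    obtain ⟨h, hh⟩ : ∃ h : PowerSeries ℂ, HahnSeries.ofPowerSeries ℤ ℂ h = F := by
      refine ⟨PowerSeries.mk fun n => F.coeff n, ?_⟩
      ext m
      rcases lt_or_ge m 0 with hm | hm
      · rw [coeff_ofPowerSeries_neg _ hm, hF0 m hm]
      · lift m to ℕ using hm
        rw [LaurentSeries.coeff_coe_powerSeries, PowerSeries.coeff_mk]
    have h1 : f * algebraMap _ _ f.denom = algebraMap _ _ f.num := by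
      conv_lhs => rw [← RatFunc.num_div_denom f]
      rw [RatFunc.num_div_denom]
      have := RatFunc.algebraMap_ne_zero f.denom_ne_zero
      conv_lhs => rw [← RatFunc.num_div_denom f]
      rw [RatFunc.num_div_denom]
      nth_rewrite 1 [← RatFunc.num_div_denom f]
      field_simp
    have h2 : F * polyToLaurent (Polynomial.taylor x f.denom) =
        polyToLaurent (Polynomial.taylor x f.num) := by
      rw [hF, ← germZero_algebraMap, ← germZero_algebraMap, ← RatFunc.laurent_algebraMap,
        ← RatFunc.laurent_algebraMap, ← map_mul, ← map_mul, h1]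
    have h3 : h * (Polynomial.taylor x f.denom : PowerSeries ℂ) = Polynomial.taylor x f.num := by
      apply HahnSeries.ofPowerSeries_injective (Γ := ℤ) (R := ℂ)
      rw [map_mul, hh]
      exact h2
    -- After translation by x, constant terms are values at x, so this reads 0 = num(x).
    have h4 := congrArg (PowerSeries.coeff 0) h3
    rw [PowerSeries.coeff_zero_eq_constantCoeff_apply, map_mul,
      ← PowerSeries.coeff_zero_eq_constantCoeff_apply, ← PowerSeries.coeff_zero_eq_constantCoeff_apply,
      Polynomial.coeff_coe, Polynomial.coeff_coe,
      Polynomial.taylor_coeff_zero, Polynomial.taylor_coeff_zero,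
      show f.denom.eval x = 0 from hx, mul_zero] at h4
    obtain ⟨a, b, hab⟩ := f.isCoprime_num_denom
    have := congrArg (Polynomial.eval x) hab
    simp [← h4, show f.denom.eval x = 0 from hx] at this
  refine ⟨f.num, ?_⟩
  have h5 : f.denom = 1 := (RatFunc.monic_denom f).eq_one_of_isUnit hd
  conv_lhs => rw [← RatFunc.num_div_denom f, h5, map_one, div_one]

/-- Without finite poles f is a polynomial, and its coefficient of z^n is its coefficient of index
-n at ∞. -/
theorem eq_zero_of_coeff {f : RatFunc ℂ} (hf : ∀ (x : ℂ) (m : ℤ), m < 0 → coeffAt x m f = 0)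
    (hf' : ∀ m : ℤ, m ≤ 0 → coeffInf m f = 0) : f = 0 := by
  obtain ⟨p, rfl⟩ := exists_polynomial hf
  have : p = 0 := by
    ext n
    have h := hf' (-(n : ℤ)) (by omega)
    have e : algebraMap (Polynomial ℂ) (RatFunc ℂ) p =
        ∑ i ∈ p.support, p.coeff i • (RatFunc.X ^ i : RatFunc ℂ) := by
      conv_lhs => rw [p.as_sum_support_C_mul_X_pow]
      rw [map_sum]
      refine Finset.sum_congr rfl fun i _ => ?_
      rw [map_mul, map_pow, RatFunc.algebraMap_X, RatFunc.algebraMap_C, RatFunc.smul_eq_C_mul]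
    rw [e, map_sum] at h
    simp only [map_smul, coeffInf_X_pow, neg_inj, Nat.cast_inj, smul_eq_mul, mul_ite, mul_one,
      mul_zero] at h
    rw [Finset.sum_ite_eq] at h
    by_contra hn
    rw [Polynomial.coeff_zero] at hn
    rw [if_pos (Polynomial.mem_support_iff.2 hn)] at h
    exact hn h
  rw [this, map_zero]

end Laurent

/-! ### Orbits of points, partial fractions and residues. -/

section Orbits

variable {T : ℕ} [NeZero T] {ω : ℂ} {Z : Divisor T ω}

/-- Complex conjugation as a semilinear map. -/
def conjL : ℂ →ₛₗ[starRingEnd ℂ] ℂ where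
  toFun := starRingEnd ℂ
  map_add' := map_add _
  map_smul' := map_mul _

/-- The action on points is itself of dihedral type, with S = id, weight ω and R = conjugation, so
`mob_mul` is an instance of `IsDihedral.mul`. -/
theorem mob_eq_slotAct (α : DihedralGroup T) (x : ℂ) :
    mob ω α x = slotAct ω LinearMap.id conjL α x := by
  cases α with
  | r i => rw [slotAct_r, ← Module.End.one_eq_id, one_pow]; rfl
  | sr i => rw [slotAct_sr, ← Module.End.one_eq_id, one_pow]; rfl

theorem mob_mul (hω : IsPrimitiveRoot ω T) (α β : DihedralGroup T) (x : ℂ) :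
    mob ω (α * β) x = mob ω α (mob ω β x) := by
  have h : IsDihedral T (LinearMap.id : ℂ →ₗ[ℂ] ℂ) conjL :=
    ⟨one_pow T, Complex.conj_conj, fun _ => rfl⟩
  have h' := h.smul hω.pow_eq_one (by simpa using mul_conj_root hω (n := 1))
  simp only [mob_eq_slotAct]
  exact h'.mul α β x

theorem Divisor.eq_of_mob (Z : Divisor T ω) {x y : ℂ} (hx : x ∈ Z.n.support)
    (hy : y ∈ Z.n.support) {α : DihedralGroup T} (h : mob ω α x = y) : x = y := by
  by_contra hxy
  exact Z.disjoint x hx y hy hxy α h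

theorem mob_inv_eq (hω : IsPrimitiveRoot ω T) {α : DihedralGroup T} {x y : ℂ}
    (h : mob ω α x = y) : mob ω α⁻¹ y = x := by
  rw [← h, ← mob_mul hω, inv_mul_cancel, mob_one]

/-- Disjointness of the orbits leaves a single term in the sum defining `orbitOrder`. -/
theorem Divisor.orbitOrder_mob (hω : IsPrimitiveRoot ω T) (Z : Divisor T ω) {x : ℂ}
    (hx : x ∈ Z.n.support) (α : DihedralGroup T) : Z.orbitOrder (mob ω α x) = Z.n x := by
  classical
  unfold Divisor.orbitOrder
  rw [Finset.sum_eq_single x]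
  · rw [if_pos ⟨α, rfl⟩]
  · intro y hy hyx
    rw [if_neg]
    rintro ⟨β, hβ⟩
    refine hyx (Z.eq_of_mob hy hx (α := α⁻¹ * β) ?_)
    rw [mob_mul hω, hβ, ← mob_mul hω, inv_mul_cancel, mob_one]
  · exact fun h => absurd hx h

theorem Divisor.exists_of_orbitOrder (Z : Divisor T ω) {y : ℂ} (hy : Z.orbitOrder y ≠ 0) :
    ∃ x ∈ Z.n.support, ∃ α : DihedralGroup T, mob ω α x = y := by
  classical
  obtain ⟨x, hx, h⟩ := Finset.exists_ne_zero_of_sum_ne_zero hy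
  refine ⟨x, hx, ?_⟩
  by_contra hn
  exact h (if_neg hn)

theorem mem_OmegaD {f : RatFunc ℂ} : f ∈ OmegaD Z ↔
    (∀ (x : ℂ) (m : ℤ), m < -(Z.orbitOrder x : ℤ) → coeffAt x m f = 0) ∧
      ∀ m : ℤ, m < 2 - (Z.nInf : ℤ) → coeffInf m f = 0 := by
  simp only [OmegaD, Submodule.mem_inf, Submodule.mem_iInf, LinearMap.mem_ker]

theorem slotDiff_mem (hω : IsPrimitiveRoot ω T) (s : Slot Z) (α : DihedralGroup T) :
    slotDiff s α ∈ OmegaD Z := by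
  rw [mem_OmegaD]
  have hn := Z.nInf_pos
  cases s with
  | inl s =>
    obtain ⟨⟨x, hx⟩, p⟩ := s
    have hp : (p : ℕ) < Z.n x := p.2
    refine ⟨fun y m hm => ?_, fun m hm => coeffInf_polarDiff _ _ (by omega)⟩
    change coeffAt y m (polarDiff (mob ω α x) p) = 0
    by_cases hy : y = mob ω α x
    · subst hy
      rw [Z.orbitOrder_mob hω hx] at hm
      rw [coeffAt_polarDiff_self, if_neg (by omega)]
    · exact coeffAt_polarDiff_ne hy _ (by omega)
  | inr q =>
    -- Here q ≤ nInf - 2: since dz has a double pole at ∞, the differential z^q dz has a pole of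
    -- order q + 2 there.
    have hq := q.2
    refine ⟨fun y m hm => ?_, fun m hm => ?_⟩
    · change coeffAt y m (-RatFunc.X ^ (q : ℕ)) = 0
      rw [map_neg, coeffAt_X_pow _ _ (by omega), neg_zero]
    · change coeffInf m (-RatFunc.X ^ (q : ℕ)) = 0
      rw [map_neg, coeffInf_X_pow, if_neg (by omega), neg_zero]

/-- Partial fractions. -/
theorem OmegaD_le_span (hω : IsPrimitiveRoot ω T) :
    OmegaD Z ≤ Submodule.span ℂ (Set.range fun a : Slot Z × DihedralGroup T => slotDiff a.1 a.2) := by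
  classical
  intro f hf
  rw [mem_OmegaD] at hf
  obtain ⟨hf1, hf2⟩ := hf
  set U := Submodule.span ℂ (Set.range fun a : Slot Z × DihedralGroup T => slotDiff a.1 a.2)
  -- All possible finite poles: the orbits of the support, finitely many as the group is finite.
  let O : Finset ℂ := (Z.n.support ×ˢ (Finset.univ : Finset (DihedralGroup T))).image
    fun a => mob ω a.2 a.1
  have hO : ∀ y, y ∉ O → Z.orbitOrder y = 0 := by
    intro y hy
    by_contra hne
    obtain ⟨x, hx, α, h⟩ := Z.exists_of_orbitOrder hne
    exact hy (Finset.mem_image.2 ⟨(x, α), Finset.mem_product.2 ⟨hx, Finset.mem_univ _⟩, h⟩)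
  -- `f1` collects the principal parts at the finite poles and `f2` the polynomial part; the
  -- remainder has no poles and vanishes at ∞.
  let f1 : RatFunc ℂ := ∑ y ∈ O, ∑ p ∈ Finset.range (Z.orbitOrder y),
    coeffAt y (-(p : ℤ) - 1) f • polarDiff y p
  let f2 : RatFunc ℂ := ∑ q ∈ Finset.range (Z.nInf - 1),
    coeffInf (-(q : ℤ)) f • (RatFunc.X ^ q : RatFunc ℂ)
  have h1 : f1 ∈ U := by
    refine Submodule.sum_mem _ fun y hy => Submodule.sum_mem _ fun p hp => Submodule.smul_mem _ _ ?_
    obtain ⟨⟨x, α⟩, hx, rfl⟩ := Finset.mem_image.1 hy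
    have hx := (Finset.mem_product.1 hx).1
    rw [Finset.mem_range, Z.orbitOrder_mob hω hx] at hp
    exact Submodule.subset_span ⟨(.inl ⟨⟨x, hx⟩, ⟨p, hp⟩⟩, α), rfl⟩
  have h2 : f2 ∈ U := by
    refine Submodule.sum_mem _ fun q hq => Submodule.smul_mem _ _ ?_
    rw [← neg_neg (RatFunc.X ^ q : RatFunc ℂ)]
    exact Submodule.neg_mem _
      (Submodule.subset_span ⟨(.inr ⟨q, Finset.mem_range.1 hq⟩, 1), rfl⟩)
  have h3 : f - f1 - f2 = 0 := by
    refine eq_zero_of_coeff (fun x m hm => ?_) (fun m hm => ?_)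
    · have e2 : coeffAt x m f2 = 0 := by
        simp only [f2, map_sum, map_smul, coeffAt_X_pow x _ hm, smul_zero, Finset.sum_const_zero]
      have e1 : coeffAt x m f1 = coeffAt x m f := by
        simp only [f1, map_sum, map_smul]
        have key : ∀ y ∈ O, y ≠ x → ∑ p ∈ Finset.range (Z.orbitOrder y),
            coeffAt y (-(p : ℤ) - 1) f • coeffAt x m (polarDiff y p) = 0 := by
          intro y _ hyx
          refine Finset.sum_eq_zero fun p _ => ?_
          rw [coeffAt_polarDiff_ne (Ne.symm hyx) p hm, smul_zero]
        by_cases hlt : m < -(Z.orbitOrder x : ℤ)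
        · rw [hf1 x m hlt]
          refine Finset.sum_eq_zero fun y hy => ?_
          by_cases hyx : y = x
          · subst hyx
            refine Finset.sum_eq_zero fun p hp => ?_
            rw [coeffAt_polarDiff_self, if_neg, smul_zero]
            rw [Finset.mem_range] at hp
            omega
          · exact key y hy hyx
        · have hx : x ∈ O := by
            by_contra hx
            have := hO x hx
            omega
          rw [Finset.sum_eq_single x key (fun h => absurd hx h),
            Finset.sum_eq_single (-m - 1).toNat]
          · have e : -(((-m - 1).toNat : ℕ) : ℤ) - 1 = m := by omega
            rw [coeffAt_polarDiff_self, if_pos e.symm, e, smul_eq_mul, mul_one]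
          · intro p _ hp
            rw [coeffAt_polarDiff_self, if_neg (by omega), smul_zero]
          · intro hp
            rw [Finset.mem_range] at hp
            omega
      rw [map_sub, map_sub, e1, e2, sub_self, sub_zero]
    · have e1 : coeffInf m f1 = 0 := by
        simp only [f1, map_sum, map_smul, coeffInf_polarDiff _ _ hm, smul_zero,
          Finset.sum_const_zero]
      have e2 : coeffInf m f2 = coeffInf m f := by
        simp only [f2, map_sum, map_smul, coeffInf_X_pow]
        by_cases hlt : m < 2 - (Z.nInf : ℤ)
        · rw [hf2 m hlt]
          refine Finset.sum_eq_zero fun q hq => ?_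
          rw [Finset.mem_range] at hq
          rw [if_neg (by omega), smul_zero]
        · rw [Finset.sum_eq_single (-m).toNat]
          · have e : -(((-m).toNat : ℕ) : ℤ) = m := by omega
            rw [e, if_pos rfl, smul_eq_mul, mul_one]
          · intro q _ hq
            rw [if_neg (by omega), smul_zero]
          · intro hq
            rw [Finset.mem_range] at hq
            omega
      rw [map_sub, map_sub, e1, e2, sub_zero, sub_self]
  have h4 : f = f1 + f2 := by rw [← sub_eq_zero, ← h3]; abel
  rw [h4]
  exact Submodule.add_mem _ h1 h2

/-- At ∞ the residue of dz/z is -1, and the sign in `slotDiff` compensates for it. This is the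
origin of the minus sign in front of z^q dz. -/
theorem slotRes_slotDiff_self {s : Slot Z} {α : DihedralGroup T} (h : Fixes s α) :
    slotRes s (slotDiff s α) = 1 := by
  rw [slotDiff_fixes h]
  cases s with
  | inl s =>
    change coeffAt (s.1 : ℂ) _ (polarDiff (mob ω 1 (s.1 : ℂ)) _) = 1
    rw [mob_one, coeffAt_polarDiff_self, if_pos rfl]
  | inr q =>
    change (-coeffInf (-((q : ℕ) : ℤ))) (-RatFunc.X ^ (q : ℕ)) = 1
    rw [LinearMap.neg_apply, map_neg, neg_neg, coeffInf_X_pow, if_pos rfl]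

/-- A non-zero residue requires the pole αx to lie in the support; disjoint orbits then give αx = x,
and the order fixes p. -/
theorem slotRes_slotDiff_of_not {s s' : Slot Z} {α : DihedralGroup T}
    (h : ¬ (s' = s ∧ Fixes s α)) : slotRes s' (slotDiff s α) = 0 := by
  cases s with
  | inl s =>
    obtain ⟨⟨x, hx⟩, p⟩ := s
    cases s' with
    | inl s' =>
      obtain ⟨⟨x', hx'⟩, p'⟩ := s'
      change coeffAt x' (-(p' : ℕ) - 1) (polarDiff (mob ω α x) p) = 0
      by_cases he : x' = mob ω α x
      · have hxx := Z.eq_of_mob hx hx' he.symm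
        subst hxx
        rw [← he, coeffAt_polarDiff_self, if_neg]
        intro hp
        refine h ⟨?_, he.symm⟩
        have : p' = p := Fin.ext (by omega)
        rw [this]
      · exact coeffAt_polarDiff_ne he _ (by omega)
    | inr q => 
      change (-coeffInf (-((q : ℕ) : ℤ))) (polarDiff (mob ω α x) p) = 0
      rw [LinearMap.neg_apply, coeffInf_polarDiff _ _ (by omega), neg_zero]
  | inr q =>
    cases s' with
    | inl s' =>
      change coeffAt (s'.1 : ℂ) (-((s'.2 : ℕ) : ℤ) - 1) (-RatFunc.X ^ (q : ℕ)) = 0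
      rw [map_neg, coeffAt_X_pow _ _ (by omega), neg_zero]
    | inr q' =>
      change (-coeffInf (-((q' : ℕ) : ℤ))) (-RatFunc.X ^ (q : ℕ)) = 0
      rw [LinearMap.neg_apply, map_neg, neg_neg, coeffInf_X_pow, if_neg]
      intro hq
      refine h ⟨?_, trivial⟩
      have : q' = q := Fin.ext (by omega)
      rw [this]

end Orbits

/-! ### Averages over the dihedral group -/

section Average

variable {T : ℕ} [NeZero T] {ω : ℂ} {V : Type*} [AddCommGroup V] [Module ℂ V]

/-- The average of a differential over the dihedral group. -/
def diffAvg (h0 : ω ≠ 0) (S : V →ₗ[ℂ] V) (R : V →ₛₗ[starRingEnd ℂ] V) :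
    Module.End ℝ (V ⊗[ℂ] RatFunc ℂ) :=
  (1 / (2 * T) : ℝ) • ∑ α : DihedralGroup T, diffAct h0 S R α

theorem diffAvg_apply (h0 : ω ≠ 0) (S : V →ₗ[ℂ] V) (R : V →ₛₗ[starRingEnd ℂ] V)
    (φ : V ⊗[ℂ] RatFunc ℂ) : diffAvg (T := T) h0 S R φ =
      (1 / (2 * T) : ℝ) • ∑ α : DihedralGroup T, diffAct h0 S R α φ := by
  simp [diffAvg]

variable {S : V →ₗ[ℂ] V} {R : V →ₛₗ[starRingEnd ℂ] V}

/-- Right translation reindexes the sum over the group. It allows any polar part to be moved along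
its orbit, or along its stabiliser, before averaging. -/
theorem diffAvg_act (hω : IsPrimitiveRoot ω T) (h0 : ω ≠ 0) (h : IsDihedral T S R)
    (β : DihedralGroup T) (φ : V ⊗[ℂ] RatFunc ℂ) :
    diffAvg (T := T) h0 S R (diffAct h0 S R β φ) = diffAvg (T := T) h0 S R φ := by
  rw [diffAvg_apply, diffAvg_apply]
  congr 1
  simp only [← h.diffAct_mul hω]
  exact Fintype.sum_equiv (Equiv.mulRight β) _ _ fun α => rfl

theorem act_diffAvg (hω : IsPrimitiveRoot ω T) (h0 : ω ≠ 0) (h : IsDihedral T S R)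
    (β : DihedralGroup T) (φ : V ⊗[ℂ] RatFunc ℂ) :
    diffAct h0 S R β (diffAvg (T := T) h0 S R φ) = diffAvg (T := T) h0 S R φ := by
  rw [diffAvg_apply, map_smul, map_sum]
  congr 1
  simp only [← h.diffAct_mul hω]
  exact Fintype.sum_equiv (Equiv.mulLeft β) _ _ fun α => rfl

theorem diffAvg_of_fixed (h0 : ω ≠ 0) {φ : V ⊗[ℂ] RatFunc ℂ}
    (hφ : ∀ α : DihedralGroup T, diffAct h0 S R α φ = φ) : diffAvg (T := T) h0 S R φ = φ := by
  have hT : (T : ℝ) ≠ 0 := Nat.cast_ne_zero.2 (NeZero.ne T)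
  rw [diffAvg_apply]
  simp only [hφ]
  have e : (2 * T : ℕ) • φ = (2 * T : ℝ) • φ := by
    have := (Nat.cast_smul_eq_nsmul ℝ (2 * T) φ).symm
    push_cast at this
    exact this
  rw [Finset.sum_const, Finset.card_univ, DihedralGroup.card, e]
  refine (smul_smul (1 / (2 * T) : ℝ) (2 * T : ℝ) φ).trans ?_
  rw [one_div, inv_mul_cancel₀ (mul_ne_zero two_ne_zero hT)]
  exact one_smul ℝ φ

theorem slotAct_mem_of (E : Set V) (w : ℂ) (hw : ∀ x ∈ E, w • x ∈ E)
    (hS : ∀ x ∈ E, S x ∈ E) (hR : ∀ x ∈ E, R x ∈ E) (α : DihedralGroup T) {v : V} (hv : v ∈ E) :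
    slotAct w S R α v ∈ E :=
  dihedralAct_mem E (fun x hx => hw _ (hS x hx)) hR α hv

/-- Keeping track of a stable subspace `E` matters later, when `E` is a step of a filtration and the
lemma bounds the tails of the canonical sum. -/
theorem diffAvg_slotDiff_mem (hω : IsPrimitiveRoot ω T) (h0 : ω ≠ 0) {Z : Divisor T ω}
    (E : Submodule ℂ V) (hS : ∀ x ∈ E, S x ∈ E) (hR : ∀ x ∈ E, R x ∈ E) {v : V} (hv : v ∈ E)
    (s : Slot Z) : diffAvg (T := T) h0 S R (v ⊗ₜ[ℂ] slotDiff s 1) ∈ omegaOf Z E := by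
  rw [diffAvg_apply]
  refine Submodule.smul_of_tower_mem _ _ (Submodule.sum_mem _ fun α _ => ?_)
  rw [diffAct_slotDiff]
  exact Submodule.apply_mem_map₂ _
    (slotAct_mem_of (E : Set V) _ (fun x hx => E.smul_mem _ hx) hS hR α hv) (slotDiff_mem hω s α)

end Average

/-! ### The form of the affine Kac-Moody algebra -/

section Form

variable {g : Type*} [LieRing g] [LieAlgebra ℂ g] {T : ℕ} (L : LieData g T)

open AffineKM

theorem AffineKM.mode_add (x y : g) (n : ℤ) : mode (x + y) n = mode x n + mode y n :=
  AffineKM.ext (fun m => by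
    rw [map_add, Finsupp.add_apply, loopPart_mode, loopPart_mode, loopPart_mode]
    split_ifs <;> simp) (add_zero (0 : ℂ)).symm (add_zero (0 : ℂ)).symm

theorem AffineKM.mode_smul (c : ℂ) (x : g) (n : ℤ) : mode (c • x) n = c • mode x n :=
  AffineKM.ext (fun m => by
    rw [map_smul, Finsupp.smul_apply, loopPart_mode, loopPart_mode]
    split_ifs <;> simp) (mul_zero c).symm (mul_zero c).symm

/-- The linear map `x ↦ x_n`. -/
def AffineKM.modeL (n : ℤ) : g →ₗ[ℂ] AffineKM g where
  toFun x := mode x n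
  map_add' x y := mode_add x y n
  map_smul' c x := mode_smul c x n

theorem AffineKM.kPart_mode (x : g) (n : ℤ) : kPart (mode x n) = 0 := rfl
theorem AffineKM.dPart_mode (x : g) (n : ℤ) : dPart (mode x n) = 0 := rfl
theorem AffineKM.kPart_K : kPart (K g) = 1 := rfl
theorem AffineKM.dPart_K : dPart (K g) = 0 := rfl
theorem AffineKM.kPart_D : kPart (D g) = 0 := rfl
theorem AffineKM.dPart_D : dPart (D g) = 1 := rfl
theorem AffineKM.loopPart_K : loopPart (K g) = 0 := rfl
theorem AffineKM.loopPart_D : loopPart (D g) = 0 := rfl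

theorem AffineKM.eq_sum (X : AffineKM g) (s : Finset ℤ) (hs : ∀ n, n ∉ s → loopPart X n = 0) :
    X = ∑ n ∈ s, mode (loopPart X n) n + kPart X • K g + dPart X • D g := by
  refine AffineKM.ext (fun m => ?_) ?_ ?_
  · rw [map_add, map_add, map_smul, map_smul, loopPart_K, loopPart_D, map_sum]
    simp only [smul_zero, add_zero, Finsupp.coe_finsetSum, Finset.sum_apply, loopPart_mode]
    rw [Finset.sum_ite_eq']
    split_ifs with h
    · rfl
    · exact hs m h
  · simp [kPart_mode, kPart_K, kPart_D]
  · simp [dPart_mode, dPart_K, dPart_D]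

theorem AffineKM.induction {P : AffineKM g → Prop} (h1 : ∀ x n, P (mode x n))
    (h2 : ∀ c : ℂ, P (c • K g)) (h3 : ∀ c : ℂ, P (c • D g)) (h4 : ∀ X Y, P X → P Y → P (X + Y))
    (X : AffineKM g) : P X := by
  rw [X.eq_sum (loopPart X).support (fun n hn => Finsupp.notMem_support_iff.1 hn)]
  refine h4 _ _ (h4 _ _ ?_ (h2 _)) (h3 _)
  refine Finset.sum_induction _ P h4 ?_ (fun n _ => h1 _ _)
  simpa using h2 0

theorem kmForm_mode_left (x : g) (n : ℤ) (Y : AffineKM g) :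
    L.kmForm (mode x n) Y = L.form x (loopPart Y (-n)) := by
  change (Finsupp.lsum ℂ fun n : ℤ => L.form.compl₂ (Finsupp.lapply (-n) : (ℤ →₀ g) →ₗ[ℂ] g))
    (Finsupp.single n x) (loopPart Y) + 0 * _ + 0 * _ = _
  rw [Finsupp.lsum_single]
  simp

theorem kmForm_K_left (Y : AffineKM g) : L.kmForm (K g) Y = dPart Y := by
  change (Finsupp.lsum ℂ fun n : ℤ => L.form.compl₂ (Finsupp.lapply (-n) : (ℤ →₀ g) →ₗ[ℂ] g))
    0 (loopPart Y) + 1 * dPart Y + 0 * _ = _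
  simp

theorem kmForm_D_left (Y : AffineKM g) : L.kmForm (D g) Y = kPart Y := by
  change (Finsupp.lsum ℂ fun n : ℤ => L.form.compl₂ (Finsupp.lapply (-n) : (ℤ →₀ g) →ₗ[ℂ] g))
    0 (loopPart Y) + 0 * _ + 1 * kPart Y = _
  simp

theorem kmForm_symm (X Y : AffineKM g) : L.kmForm X Y = L.kmForm Y X := by
  induction X using AffineKM.induction with
  | h1 x n =>
    rw [kmForm_mode_left]
    induction Y using AffineKM.induction with
    | h1 y m =>
      rw [kmForm_mode_left, loopPart_mode, loopPart_mode, L.form_symm]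
      by_cases h : m = -n
      · rw [if_pos h, if_pos (by omega)]
      · rw [if_neg h, if_neg (by omega)]; simp
    | h2 c => rw [map_smul, map_smul, LinearMap.smul_apply, kmForm_K_left]; simp [loopPart_K, dPart_mode]
    | h3 c => rw [map_smul, map_smul, LinearMap.smul_apply, kmForm_D_left]; simp [loopPart_D, kPart_mode]
    | h4 X Y hX hY => rw [map_add, Finsupp.add_apply, map_add, hX, hY, map_add, LinearMap.add_apply]
  | h2 c =>
    rw [map_smul, LinearMap.smul_apply, map_smul, kmForm_K_left]
    congr 1
    induction Y using AffineKM.induction with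
    | h1 y m => rw [kmForm_mode_left]; simp [loopPart_K, dPart_mode]
    | h2 c => rw [map_smul, map_smul, LinearMap.smul_apply, kmForm_K_left]
    | h3 c => rw [map_smul, map_smul, LinearMap.smul_apply, kmForm_D_left]; rfl
    | h4 X Y hX hY => rw [map_add, hX, hY, map_add, LinearMap.add_apply]
  | h3 c =>
    rw [map_smul, LinearMap.smul_apply, map_smul, kmForm_D_left]
    congr 1
    induction Y using AffineKM.induction with
    | h1 y m => rw [kmForm_mode_left]; simp [loopPart_D, kPart_mode]
    | h2 c => rw [map_smul, map_smul, LinearMap.smul_apply, kmForm_K_left]; rfl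
    | h3 c => rw [map_smul, map_smul, LinearMap.smul_apply, kmForm_D_left]
    | h4 X Y hX hY => rw [map_add, hX, hY, map_add, LinearMap.add_apply]
  | h4 X X' hX hX' => rw [map_add, LinearMap.add_apply, hX, hX', map_add]

theorem kmForm_mode_right (X : AffineKM g) (y : g) (n : ℤ) :
    L.kmForm X (mode y n) = L.form (loopPart X (-n)) y := by
  rw [kmForm_symm, kmForm_mode_left, L.form_symm]

theorem σt_mode (x : g) (n : ℤ) : L.σt (mode x n) = mode (L.σL x) n :=
  AffineKM.ext (fun m => by
    change L.σL (loopPart (mode x n) m) = _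
    rw [loopPart_mode, loopPart_mode]
    split_ifs <;> simp) rfl rfl

theorem τt_mode (x : g) (n : ℤ) : L.τt (mode x n) = mode (L.τ x) (-n) :=
  AffineKM.ext (fun m => by
    change L.τ (loopPart (mode x n) (-m)) = _
    rw [loopPart_mode, loopPart_mode]
    by_cases h : n = -m
    · rw [if_pos h, if_pos (by omega)]
    · rw [if_neg h, if_neg (by omega), map_zero]) (by
    change -starRingEnd ℂ 0 = 0; simp) (by change -starRingEnd ℂ 0 = 0; simp)

theorem σt_K : L.σt (K g) = K g := AffineKM.ext (fun _ => map_zero L.σL) rfl rfl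

theorem σt_D : L.σt (D g) = D g := AffineKM.ext (fun _ => map_zero L.σL) rfl rfl

theorem τt_K : L.τt (K g) = -K g :=
  AffineKM.ext (fun m => by
    change L.τ 0 = (-(0 : ℤ →₀ g)) m
    simp) (by change -starRingEnd ℂ 1 = -1; simp) (by change -starRingEnd ℂ 0 = -0; simp)

theorem τt_D : L.τt (D g) = -D g :=
  AffineKM.ext (fun m => by
    change L.τ 0 = (-(0 : ℤ →₀ g)) m
    simp) (by change -starRingEnd ℂ 0 = -0; simp) (by change -starRingEnd ℂ 1 = -1; simp)

theorem kmForm_σt (X Y : AffineKM g) : L.kmForm (L.σt X) (L.σt Y) = L.kmForm X Y := by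
  induction X using AffineKM.induction with
  | h1 x n => rw [σt_mode, kmForm_mode_left, kmForm_mode_left]; exact L.form_σ _ _
  | h2 c => rw [map_smul, map_smul, map_smul, LinearMap.smul_apply, LinearMap.smul_apply, σt_K,
      kmForm_K_left, kmForm_K_left]; rfl
  | h3 c => rw [map_smul, map_smul, map_smul, LinearMap.smul_apply, LinearMap.smul_apply, σt_D,
      kmForm_D_left, kmForm_D_left]; rfl
  | h4 X X' hX hX' => rw [map_add, map_add, map_add, LinearMap.add_apply, hX, hX',
      LinearMap.add_apply]

theorem kmForm_τt (X Y : AffineKM g) :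
    L.kmForm (L.τt X) (L.τt Y) = starRingEnd ℂ (L.kmForm X Y) := by
  induction X using AffineKM.induction with
  | h1 x n =>
    rw [τt_mode, kmForm_mode_left, kmForm_mode_left, ← L.form_τ, loopPart_τt, neg_neg]
  | h2 c =>
    rw [L.τt.map_smulₛₗ, map_smul, map_smul, LinearMap.smul_apply, LinearMap.smul_apply, τt_K,
      map_neg, LinearMap.neg_apply, kmForm_K_left, kmForm_K_left, smul_eq_mul, smul_eq_mul, map_mul]
    congr 1
    exact neg_neg _
  | h3 c =>
    rw [L.τt.map_smulₛₗ, map_smul, map_smul, LinearMap.smul_apply, LinearMap.smul_apply, τt_D,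
      map_neg, LinearMap.neg_apply, kmForm_D_left, kmForm_D_left, smul_eq_mul, smul_eq_mul, map_mul]
    congr 1
    exact neg_neg _
  | h4 X X' hX hX' => rw [map_add, map_add, map_add, LinearMap.add_apply, LinearMap.add_apply, hX,
      hX', map_add]

theorem kmForm_σt_pow (n : ℕ) (X Y : AffineKM g) :
    L.kmForm ((L.σt ^ n : Module.End ℂ _) X) ((L.σt ^ n : Module.End ℂ _) Y) = L.kmForm X Y := by
  induction n with
  | zero => rfl
  | succ n ih => rw [pow_succ', Module.End.mul_apply, Module.End.mul_apply, kmForm_σt, ih]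

/-- The weights cancel, σ preserves the form, and τ only conjugates its value; this is why the
pairing takes real parts. -/
theorem kmForm_slotAct {w : ℂ} (hw : w ≠ 0) (α : DihedralGroup T) (v X : AffineKM g) :
    (L.kmForm (slotAct w⁻¹ L.σt L.τt α v) (slotAct w L.σt L.τt α X)).re = (L.kmForm v X).re := by
  have h1 : ∀ n, w⁻¹ ^ n * w ^ n = 1 := fun n => by
    rw [← mul_pow, inv_mul_cancel₀ hw, one_pow]
  have h2 : ∀ n : ℕ, L.kmForm (w⁻¹ ^ n • (L.σt ^ n : Module.End ℂ _) v)
      (w ^ n • (L.σt ^ n : Module.End ℂ _) X) = L.kmForm v X := by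
    intro n
    rw [map_smul, map_smul, LinearMap.smul_apply, kmForm_σt_pow, smul_smul, mul_comm, h1, one_smul]
  cases α with
  | r i => rw [slotAct_r, slotAct_r, h2]
  | sr i => rw [slotAct_sr, slotAct_sr, kmForm_τt, h2, Complex.conj_re]

end Form

/-! ### Sums over modes -/

section Modes

variable {M : Type*} [AddCommGroup M] {d : ℕ} {P : Prop}

/-- The range of loop modes is empty at level 0, so `modes d P 0` is just the K, D part. -/
theorem sum_modes (f : ModeIdx d P → M) (N : ℕ) :
    ∑ a ∈ modes d P N, f a = ∑ n ∈ Finset.Ioo (-(N : ℤ)) N, ∑ a, f (.loop a n) +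
      ∑ a ∈ modes d P 0, f a := by
  classical
  have key : ∀ N, ∑ a ∈ modes d P N, f a = ∑ n ∈ Finset.Ioo (-(N : ℤ)) N, ∑ a, f (.loop a n) +
      ∑ a ∈ (if h : P then {ModeIdx.K h, ModeIdx.D h} else ∅ : Finset (ModeIdx d P)), f a := by
    intro N
    unfold modes
    rw [Finset.sum_union, Finset.sum_image, Finset.sum_product_right]
    · rintro ⟨a, n⟩ _ ⟨b, m⟩ _ h
      simp only [ModeIdx.loop.injEq] at h
      exact Prod.ext h.1 h.2
    · rw [Finset.disjoint_left]
      intro x hx hx'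
      obtain ⟨⟨a, n⟩, _, rfl⟩ := Finset.mem_image.1 hx
      split_ifs at hx' <;> simp at hx'
  rw [key N, key 0]
  simp

theorem sum_modes_zero (f : ModeIdx d P → M) (h : P) :
    ∑ a ∈ modes d P 0, f a = f (.K h) + f (.D h) := by
  classical
  unfold modes
  simp [h]

theorem sum_modes_zero_of_not (f : ModeIdx d P → M) (h : ¬ P) :
    ∑ a ∈ modes d P 0, f a = 0 := by
  classical
  unfold modes
  simp [h]

/-- The bound 1 ≤ N makes N and -N distinct; at N = 0 the mode would be counted twice. -/
theorem sum_modes_succ (f : ModeIdx d P → M) {N : ℕ} (hN : 1 ≤ N) :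
    ∑ a ∈ modes d P (N + 1), f a - ∑ a ∈ modes d P N, f a =
      ∑ a, (f (.loop a N) + f (.loop a (-N))) := by
  rw [sum_modes f (N + 1), sum_modes f N]
  have e : Finset.Ioo (-((N + 1 : ℕ) : ℤ)) ((N + 1 : ℕ) : ℤ) =
      insert (N : ℤ) (insert (-(N : ℤ)) (Finset.Ioo (-(N : ℤ)) N)) := by
    ext n
    simp only [Finset.mem_Ioo, Finset.mem_insert]
    push_cast
    omega
  rw [e, Finset.sum_insert, Finset.sum_insert, Finset.sum_add_distrib]
  · abel
  · simp
  · simp; omega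

theorem sum_Ioo_neg (f : ℤ → M) (N : ℕ) :
    ∑ n ∈ Finset.Ioo (-(N : ℤ)) N, f (-n) = ∑ n ∈ Finset.Ioo (-(N : ℤ)) N, f n := by
  refine Finset.sum_nbij' (fun n => -n) (fun n => -n) ?_ ?_ ?_ ?_ ?_ <;>
    simp only [Finset.mem_Ioo] <;> intros <;> first | omega | simp

end Modes

/-! ### Exponential and trigonometric modes: canonical tensors and duality. -/

section Trig

variable {g : Type*} [LieRing g] [LieAlgebra ℂ g] {T : ℕ} (L : LieData g T)
  {M : Type*} [AddCommGroup M] [Module ℂ M] {d : ℕ} {P : Prop}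

open AffineKM

theorem trigMode_zero (u : Fin d → g) (a : Fin d) : trigMode u a 0 = mode (u a) 0 := if_pos rfl

theorem trigMode_pos (u : Fin d → g) (a : Fin d) {n : ℤ} (h : 0 < n) : trigMode u a n =
    (1 / (Real.sqrt 2 : ℂ)) • (mode (u a) n + mode (u a) (-n)) := by
  unfold trigMode; rw [if_neg (by omega), if_pos h]

theorem trigMode_neg (u : Fin d → g) (a : Fin d) {n : ℤ} (h : 0 < n) : trigMode u a (-n) =
    (Complex.I / (Real.sqrt 2 : ℂ)) • (mode (u a) n - mode (u a) (-n)) := by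
  unfold trigMode; rw [if_neg (by omega), if_neg (by omega), neg_neg]

theorem sqrt_two_mul : (Real.sqrt 2 : ℂ) * (Real.sqrt 2 : ℂ) = 2 := by
  rw [← Complex.ofReal_mul, Real.mul_self_sqrt (by norm_num)]; norm_num

/-- Polarisation: ½(A + B)(A' + B') - ½(A - B)(A' - B') = AB' + BA', the minus sign being i². -/
theorem trig_pair (β : AffineKM g →ₗ[ℂ] AffineKM g →ₗ[ℂ] M) (u v : Fin d → g) (a : Fin d)
    {n : ℤ} (h : 0 < n) :
    β (trigMode v a n) (trigMode u a n) + β (trigMode v a (-n)) (trigMode u a (-n)) =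
      β (mode (v a) (-n)) (mode (u a) n) + β (mode (v a) n) (mode (u a) (-n)) := by
  have h2 : (1 / (Real.sqrt 2 : ℂ)) * (1 / (Real.sqrt 2 : ℂ)) = 1 / 2 := by
    rw [div_mul_div_comm, sqrt_two_mul, one_mul]
  have h3 : (Complex.I / (Real.sqrt 2 : ℂ)) * (Complex.I / (Real.sqrt 2 : ℂ)) = -(1 / 2) := by
    rw [div_mul_div_comm, sqrt_two_mul, Complex.I_mul_I]; norm_num
  have hr : ∀ (c : ℂ) (X Y : AffineKM g), β (c • X) (c • Y) = (c * c) • β X Y := by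
    intro c X Y
    rw [map_smul, map_smul, LinearMap.smul_apply, smul_smul]
  rw [trigMode_pos _ _ h, trigMode_pos _ _ h, trigMode_neg _ _ h, trigMode_neg _ _ h, hr, hr, h2, h3]
  simp only [map_add, map_sub, LinearMap.add_apply, LinearMap.sub_apply]
  module

/-- For any complex bilinear `β`, the real and the exponential bases have the same truncated
canonical tensor at each level, since the change of basis mixes only n with -n. -/
theorem trig_sum (β : AffineKM g →ₗ[ℂ] AffineKM g →ₗ[ℂ] M) (u v : Fin d → g) {κ κ' : ℂ}
    (hκ : κ' * κ = 1) (N : ℕ) :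
    ∑ a ∈ modes d P N, β (trigDual κ' v a) (trigVec κ u a) =
      ∑ a ∈ modes d P N, β (expDual v a) (expVec u a) := by
  rw [sum_modes _ N, sum_modes _ N]
  congr 1
  · have key : ∀ n : ℤ, ∀ a, β (trigMode v a n) (trigMode u a n) +
        β (trigMode v a (-n)) (trigMode u a (-n)) =
        β (mode (v a) (-n)) (mode (u a) n) + β (mode (v a) (- -n)) (mode (u a) (-n)) := by
      intro n a
      rcases lt_trichotomy n 0 with h | h | h
      · have := trig_pair β u v a (n := -n) (by omega)
        rw [neg_neg] at this ⊢
        rw [add_comm, this, add_comm]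
      · subst h
        simp only [neg_zero, trigMode_zero]
      · rw [neg_neg, trig_pair β u v a h]
    -- Doubling the sum pairs n with -n without splitting the range by sign; the factor 2 is
    -- cancelled at the end.
    have h1 : ∀ f : ℤ → M, (2 : ℂ) • ∑ n ∈ Finset.Ioo (-(N : ℤ)) N, f n =
        ∑ n ∈ Finset.Ioo (-(N : ℤ)) N, (f n + f (-n)) := by
      intro f
      rw [Finset.sum_add_distrib, sum_Ioo_neg, two_smul]
    refine smul_right_injective M (two_ne_zero : (2 : ℂ) ≠ 0) ?_
    change (2 : ℂ) • _ = (2 : ℂ) • _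
    rw [h1, h1]
    refine Finset.sum_congr rfl fun n _ => ?_
    rw [← Finset.sum_add_distrib, ← Finset.sum_add_distrib]
    exact Finset.sum_congr rfl fun a _ => key n a
  · by_cases h : P
    · rw [sum_modes_zero _ h, sum_modes_zero _ h]
      simp only [trigDual, trigVec, expDual, expVec, map_smul, LinearMap.smul_apply, smul_smul,
        mul_comm κ κ', hκ, one_smul]
    · rw [sum_modes_zero_of_not _ h, sum_modes_zero_of_not _ h]

/-- The hypotheses are needed mode by mode only, so the lemma covers both the full algebra and an
eigenspace of σ, where the K, D part is absent unless `P` holds. -/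
theorem exp_reproduce (u v : Fin d → g) (X : AffineKM g)
    (hX : ∀ n, ∑ a, L.form (v a) (loopPart X n) • u a = loopPart X n)
    (hP : ¬ P → kPart X = 0 ∧ dPart X = 0) {N : ℕ}
    (hN : ∀ n, n ∉ Finset.Ioo (-(N : ℤ)) N → loopPart X n = 0) :
    ∑ a ∈ modes d P N, L.kmForm (expDual v a) X • expVec u a = X := by
  rw [sum_modes]
  conv_rhs => rw [X.eq_sum _ hN, add_assoc]
  congr 1
  · refine Finset.sum_congr rfl fun n _ => ?_
    conv_rhs => rw [← hX n]
    change _ = modeL n _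
    rw [map_sum]
    refine Finset.sum_congr rfl fun a _ => ?_
    rw [map_smul]
    change L.kmForm (mode (v a) (-n)) X • mode (u a) n = _
    rw [kmForm_mode_left, neg_neg]
    rfl
  · by_cases h : P
    · rw [sum_modes_zero _ h]
      change L.kmForm (D g) X • K g + L.kmForm (K g) X • D g = _
      rw [kmForm_D_left, kmForm_K_left]
    · rw [sum_modes_zero_of_not _ h, (hP h).1, (hP h).2, zero_smul, zero_smul, add_zero]

theorem exp_reproduce_dual (u v : Fin d → g) (X : AffineKM g)
    (hX : ∀ n, ∑ a, L.form (loopPart X n) (u a) • v a = loopPart X n)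
    (hP : ¬ P → kPart X = 0 ∧ dPart X = 0) {N : ℕ}
    (hN : ∀ n, n ∉ Finset.Ioo (-(N : ℤ)) N → loopPart X n = 0) :
    ∑ a ∈ modes d P N, L.kmForm X (expVec u a) • expDual v a = X := by
  rw [sum_modes]
  conv_rhs => rw [X.eq_sum _ hN, add_assoc]
  congr 1
  · rw [← sum_Ioo_neg]
    refine Finset.sum_congr rfl fun n _ => ?_
    conv_rhs => rw [← hX n]
    change _ = modeL n _
    rw [map_sum]
    refine Finset.sum_congr rfl fun a _ => ?_
    rw [map_smul]
    change L.kmForm X (mode (u a) (-n)) • mode (v a) (- -n) = _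
    rw [kmForm_mode_right, neg_neg]
    rfl
  · by_cases h : P
    · rw [sum_modes_zero _ h]
      change L.kmForm X (K g) • D g + L.kmForm X (D g) • K g = _
      rw [kmForm_symm, kmForm_symm L X (D g), kmForm_D_left, kmForm_K_left, add_comm]
    · rw [sum_modes_zero_of_not _ h, (hP h).1, (hP h).2, zero_smul, zero_smul, add_zero]

theorem exp_dual {u v : Fin d → g} (h : ∀ a b, L.form (v a) (u b) = if a = b then 1 else 0)
    (a b : ModeIdx d P) [Decidable (a = b)] :
    L.kmForm (expDual v a) (expVec u b) = if a = b then 1 else 0 := by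
  cases a with
  | loop a n =>
    change L.kmForm (mode (v a) (-n)) _ = _
    rw [kmForm_mode_left, neg_neg]
    cases b with
    | loop b m =>
      change L.form (v a) (loopPart (mode (u b) m) n) = _
      rw [loopPart_mode]
      by_cases hm : m = n
      · subst hm
        rw [if_pos rfl, h]
        congr 1
        simp
      · rw [if_neg hm, map_zero, if_neg]
        simp only [ModeIdx.loop.injEq, not_and]
        exact fun _ h => hm h.symm
    | K h => rw [if_neg (by simp)]; exact map_zero _
    | D h => rw [if_neg (by simp)]; exact map_zero _
  | K h' =>
    change L.kmForm (D g) _ = _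
    rw [kmForm_D_left]
    cases b with
    | loop b m => rw [if_neg (by simp)]; rfl
    | K h => rw [if_pos rfl]; rfl
    | D h => rw [if_neg (by simp)]; rfl
  | D h' =>
    change L.kmForm (K g) _ = _
    rw [kmForm_K_left]
    cases b with
    | loop b m => rw [if_neg (by simp)]; rfl
    | K h => rw [if_neg (by simp)]; rfl
    | D h => rw [if_pos rfl]; rfl

theorem trigMode_dual {u v : Fin d → g} (h : ∀ a b, L.form (v a) (u b) = if a = b then 1 else 0)
    (a b : Fin d) (n m : ℤ) :
    L.kmForm (trigMode v a n) (trigMode u b m) = if a = b ∧ n = m then 1 else 0 := by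
  have h0 : ∀ n m : ℤ, L.kmForm (mode (v a) n) (mode (u b) m) =
      if m = -n then (if a = b then 1 else 0) else 0 := by
    intro n m
    rw [kmForm_mode_left, loopPart_mode]
    split_ifs <;> simp [*]
  have hr : (1 / (Real.sqrt 2 : ℂ)) * (1 / (Real.sqrt 2 : ℂ)) = 1 / 2 := by
    rw [div_mul_div_comm, sqrt_two_mul, one_mul]
  have hi : (Complex.I / (Real.sqrt 2 : ℂ)) * (Complex.I / (Real.sqrt 2 : ℂ)) = -(1 / 2) := by
    rw [div_mul_div_comm, sqrt_two_mul, Complex.I_mul_I]; norm_num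
  -- This reduces the pairing to nine cases according to the signs of n and m.
  have h1 : ∀ n : ℤ, ∃ k : ℤ, 0 < k ∧ (n = 0 ∨ n = k ∨ n = -k) := by
    intro n
    rcases lt_trichotomy n 0 with h | h | h
    · exact ⟨-n, by omega, Or.inr (Or.inr (by omega))⟩
    · exact ⟨1, one_pos, Or.inl h⟩
    · exact ⟨n, h, Or.inr (Or.inl rfl)⟩
  have h2 : ∀ (X X' Y Y' : AffineKM g) (c c' : ℂ), L.kmForm (c • (X + X')) (c' • (Y - Y')) =
      c * c' * (L.kmForm X Y - L.kmForm X Y' + L.kmForm X' Y - L.kmForm X' Y') := by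
    intro X X' Y Y' c c'
    simp only [map_smul, LinearMap.smul_apply, map_add, map_sub, LinearMap.add_apply,
      smul_eq_mul]
    ring
  have h3 : ∀ (X X' Y Y' : AffineKM g) (c c' : ℂ), L.kmForm (c • (X - X')) (c' • (Y + Y')) =
      c * c' * (L.kmForm X Y + L.kmForm X Y' - L.kmForm X' Y - L.kmForm X' Y') := by
    intro X X' Y Y' c c'
    simp only [map_smul, LinearMap.smul_apply, map_add, map_sub, LinearMap.sub_apply,
      smul_eq_mul]
    ring
  have h4 : ∀ (X X' Y Y' : AffineKM g) (c c' : ℂ), L.kmForm (c • (X + X')) (c' • (Y + Y')) =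
      c * c' * (L.kmForm X Y + L.kmForm X Y' + L.kmForm X' Y + L.kmForm X' Y') := by
    intro X X' Y Y' c c'
    simp only [map_smul, LinearMap.smul_apply, map_add, LinearMap.add_apply, smul_eq_mul]
    ring
  have h5 : ∀ (X X' Y Y' : AffineKM g) (c c' : ℂ), L.kmForm (c • (X - X')) (c' • (Y - Y')) =
      c * c' * (L.kmForm X Y - L.kmForm X Y' - L.kmForm X' Y + L.kmForm X' Y') := by
    intro X X' Y Y' c c'
    simp only [map_smul, LinearMap.smul_apply, map_sub, LinearMap.sub_apply, smul_eq_mul]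
    ring
  -- The zero mode is written in the shape of a cosine so that the four expansions above cover it
  -- too.
  have hz : ∀ (u : Fin d → g) (b : Fin d), trigMode u b 0 =
      (1 / 2 : ℂ) • (mode (u b) 0 + mode (u b) 0) := by
    intro u b
    rw [trigMode_zero, ← two_smul ℂ, smul_smul]
    norm_num
  by_cases hab : a = b
  · simp only [hab, true_and, if_true] at h0 ⊢
    obtain ⟨k, hk, rfl | rfl | rfl⟩ := h1 n <;> obtain ⟨l, hl, rfl | rfl | rfl⟩ := h1 m <;>
      simp only [hz, trigMode_pos _ _ hk, trigMode_neg _ _ hk, trigMode_pos _ _ hl,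
        trigMode_neg _ _ hl, h2, h3, h4, h5, h0, hr, hi] <;>
      split_ifs <;> first | omega | norm_num
  · simp only [hab, false_and, if_false, ite_self] at h0 ⊢
    obtain ⟨k, hk, rfl | rfl | rfl⟩ := h1 n <;> obtain ⟨l, hl, rfl | rfl | rfl⟩ := h1 m <;>
      simp only [hz, trigMode_pos _ _ hk, trigMode_neg _ _ hk, trigMode_pos _ _ hl,
        trigMode_neg _ _ hl, h2, h3, h4, h5, h0] <;> simp

theorem trig_dual {u v : Fin d → g} (h : ∀ a b, L.form (v a) (u b) = if a = b then 1 else 0)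
    {κ κ' : ℂ} (hκ : κ' * κ = 1) (a b : ModeIdx d P) [Decidable (a = b)] :
    L.kmForm (trigDual κ' v a) (trigVec κ u b) = if a = b then 1 else 0 := by
  have hK : ∀ (u : Fin d → g) (b : Fin d) (n : ℤ), dPart (trigMode u b n) = 0 := by
    intro u b n
    unfold trigMode
    split_ifs <;> simp [dPart_mode]
  have hD : ∀ (u : Fin d → g) (b : Fin d) (n : ℤ), kPart (trigMode u b n) = 0 := by
    intro u b n
    unfold trigMode
    split_ifs <;> simp [kPart_mode]
  cases a with
  | loop a n =>
    cases b with
    | loop b m =>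
      change L.kmForm (trigMode v a n) (trigMode u b m) = _
      rw [trigMode_dual L h]
      congr 1
      simp
    | K h =>
      rw [if_neg (by simp)]
      change L.kmForm (trigMode v a n) (κ • K g) = 0
      rw [kmForm_symm, map_smul, LinearMap.smul_apply, kmForm_K_left, hK, smul_zero]
    | D h =>
      rw [if_neg (by simp)]
      change L.kmForm (trigMode v a n) (κ • D g) = 0
      rw [kmForm_symm, map_smul, LinearMap.smul_apply, kmForm_D_left, hD, smul_zero]
  | K h' =>
    change L.kmForm (κ' • D g) _ = _
    rw [map_smul, LinearMap.smul_apply, kmForm_D_left]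
    cases b with
    | loop b m =>
      rw [if_neg (by simp)]
      change κ' • kPart (trigMode u b m) = 0
      rw [hD, smul_zero]
    | K h =>
      rw [if_pos rfl]
      change κ' • kPart (κ • K g) = 1
      rw [map_smul, kPart_K]
      simpa using hκ
    | D h =>
      rw [if_neg (by simp)]
      change κ' • kPart (κ • D g) = 0
      rw [map_smul, kPart_D]
      simp
  | D h' =>
    change L.kmForm (κ' • K g) _ = _
    rw [map_smul, LinearMap.smul_apply, kmForm_K_left]
    cases b with
    | loop b m =>
      rw [if_neg (by simp)]
      change κ' • dPart (trigMode u b m) = 0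
      rw [hK, smul_zero]
    | K h =>
      rw [if_neg (by simp)]
      change κ' • dPart (κ • K g) = 0
      rw [map_smul, dPart_K]
      simp
    | D h =>
      rw [if_pos rfl]
      change κ' • dPart (κ • D g) = 1
      rw [map_smul, dPart_D]
      simpa using hκ

end Trig

/-! ### Real forms -/

section RealForms

variable {g : Type*} [LieRing g] [LieAlgebra ℂ g] {T : ℕ} (L : LieData g T)

open AffineKM

theorem mem_gkp {k p : ZMod T} {x : g} : x ∈ L.gkp k p ↔
    (L.σL ^ k.val : Module.End ℂ g) (L.τ x) = L.ω ^ (k.val * p.val) • x := by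
  unfold LieData.gkp
  rw [LinearMap.mem_eqLocus, restrictScalars_pow]
  rfl

theorem mem_gj {j : ZMod T} {x : g} :
    x ∈ L.gj j ↔ L.σL x = L.ω ^ j.val • x ∧ L.τ x = x := Iff.rfl

theorem omega_pow_val [NeZero T] (p : ℕ) : L.ω ^ ((p : ZMod T)).val = L.ω ^ p := by
  rw [ZMod.val_natCast]
  conv_rhs => rw [← Nat.mod_add_div p T, pow_add, pow_mul, L.ω_prim.pow_eq_one, one_pow, mul_one]

theorem omega_pow_val_neg [NeZero T] (j : ZMod T) : L.ω ^ (-j).val = (L.ω ^ j.val)⁻¹ := by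
  refine eq_inv_of_mul_eq_one_left ?_
  rw [← pow_add, ← omega_pow_val]
  push_cast
  simp

/-- A real basis of a real form is a complex basis of what the form spans: split x into real and
imaginary parts for the conjugation `θ`, expand each in W, and use complex linearity of `ℓ`. -/
theorem basis_reproduce {W : Submodule ℝ g} {d : ℕ} (u : Module.Basis (Fin d) ℝ W)
    (ℓ : Fin d → g →ₗ[ℂ] ℂ) (h : ∀ a b, ℓ a (u b : g) = if a = b then 1 else 0)
    {θ : g →ₛₗ[starRingEnd ℂ] g} {x : g} (h1 : (1 / 2 : ℂ) • (x + θ x) ∈ W)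
    (h2 : (-Complex.I / 2 : ℂ) • (x - θ x) ∈ W) : ∑ a, ℓ a x • (u a : g) = x := by
  have key : ∀ y ∈ W, ∑ a, ℓ a y • (u a : g) = y := by
    intro y hy
    have e : y = ∑ b, ((u.repr ⟨y, hy⟩ b : ℝ) : ℂ) • (u b : g) := by
      have := congrArg (Submodule.subtype W) (u.sum_repr ⟨y, hy⟩)
      rw [map_sum] at this
      exact this.symm
    have e2 : ∀ a, ℓ a y = ((u.repr ⟨y, hy⟩ a : ℝ) : ℂ) := by
      intro a
      conv_lhs => rw [e]
      rw [map_sum]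
      simp [h]
    simp only [e2]
    exact e.symm
  have hx : x = (1 / 2 : ℂ) • (x + θ x) + Complex.I • (-Complex.I / 2 : ℂ) • (x - θ x) := by
    rw [smul_smul, mul_div_assoc', mul_neg, Complex.I_mul_I, neg_neg]
    module
  have e := congrArg₂ (· + ·) (key _ h1) (congrArg (fun y => Complex.I • y) (key _ h2))
  simp only [← hx, Finset.smul_sum, ← Finset.sum_add_distrib] at e
  conv_rhs => rw [← e]
  refine Finset.sum_congr rfl fun a _ => ?_
  conv_lhs => rw [hx]
  simp only [map_add, map_smul, smul_eq_mul, add_smul, mul_smul]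

theorem conj_half : starRingEnd ℂ (1 / 2 : ℂ) = 1 / 2 := by
  rw [map_div₀, map_one, map_ofNat]

theorem conj_neg_I_half : starRingEnd ℂ (-Complex.I / 2 : ℂ) = Complex.I / 2 := by
  rw [map_div₀, map_neg, Complex.conj_I, neg_neg, map_ofNat]

variable {L} (B : BasisData L) [NeZero T]

/-- The conjugation is θ = ω^(-kp) σ^k τ, an involution by the dihedral relation, whose fixed points
are g_{k,p}. -/
theorem gkp_halves (k p : ZMod T) (x : g) : ∃ θ : g →ₛₗ[starRingEnd ℂ] g,
    (1 / 2 : ℂ) • (x + θ x) ∈ L.gkp k p ∧ (-Complex.I / 2 : ℂ) • (x - θ x) ∈ L.gkp k p := by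
  have h0 : L.ω ^ (k.val * p.val) ≠ 0 := pow_ne_zero _ L.ω_ne
  have hc := mul_conj_root L.ω_prim (n := k.val * p.val)
  have hθ : ∀ y, (L.σL ^ k.val : Module.End ℂ g) (L.τ ((L.σL ^ k.val : Module.End ℂ g) (L.τ y)))
      = y := fun y => by
    rw [L.isDihedral.pow_rel, L.τ_invol]
  refine ⟨(L.ω ^ (k.val * p.val))⁻¹ • (((L.σL ^ k.val : Module.End ℂ g) : g →ₗ[ℂ] g).comp L.τ),
    ?_, ?_⟩
  · rw [mem_gkp]
    change (L.σL ^ k.val : Module.End ℂ g) (L.τ ((1 / 2 : ℂ) • (x + (L.ω ^ (k.val * p.val))⁻¹ •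
      (L.σL ^ k.val : Module.End ℂ g) (L.τ x)))) = _ • ((1 / 2 : ℂ) • (x +
        (L.ω ^ (k.val * p.val))⁻¹ • (L.σL ^ k.val : Module.End ℂ g) (L.τ x)))
    rw [L.τ.map_smulₛₗ, map_add, L.τ.map_smulₛₗ, map_smul, map_add, map_smul, hθ, map_inv₀,
      inv_eq_of_mul_eq_one_left hc, conj_half, smul_comm _ (1 / 2 : ℂ),
      smul_add (L.ω ^ (k.val * p.val)), smul_inv_smul₀ h0, add_comm]
  · rw [mem_gkp]
    change (L.σL ^ k.val : Module.End ℂ g) (L.τ ((-Complex.I / 2 : ℂ) • (x -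
      (L.ω ^ (k.val * p.val))⁻¹ • (L.σL ^ k.val : Module.End ℂ g) (L.τ x)))) =
        _ • ((-Complex.I / 2 : ℂ) • (x -
        (L.ω ^ (k.val * p.val))⁻¹ • (L.σL ^ k.val : Module.End ℂ g) (L.τ x)))
    rw [L.τ.map_smulₛₗ, map_sub, L.τ.map_smulₛₗ, map_smul, map_sub, map_smul, hθ, map_inv₀,
      inv_eq_of_mul_eq_one_left hc, conj_neg_I_half, smul_comm _ (-Complex.I / 2 : ℂ),
      smul_sub (L.ω ^ (k.val * p.val)), smul_inv_smul₀ h0]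
    module

/-- Here the conjugation is τ itself, which preserves the eigenspace; hence the restriction to
eigenvectors. -/
theorem gj_halves (j : ZMod T) {x : g} (hx : L.σL x = L.ω ^ j.val • x) :
    (1 / 2 : ℂ) • (x + L.τ x) ∈ L.gj j ∧ (-Complex.I / 2 : ℂ) • (x - L.τ x) ∈ L.gj j := by
  have h := L.τ_stable j.val x hx
  change L.σL (L.τ x) = _ at h
  constructor
  · rw [mem_gj, map_smul, map_add, hx, h, L.τ.map_smulₛₗ, map_add, L.τ_invol, add_comm (L.τ x),
      ← smul_add, smul_comm]
    exact ⟨rfl, congrArg (· • _) conj_half⟩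
  · rw [mem_gj, map_smul, map_sub, hx, h, L.τ.map_smulₛₗ, map_sub, L.τ_invol, ← neg_sub x,
      ← smul_sub, smul_comm, smul_neg, ← neg_smul]
    refine ⟨rfl, congrArg (· • _) ?_⟩
    rw [conj_neg_I_half, neg_div]

theorem BasisData.b_reproduce (k p : ZMod T) (x : g) :
    ∑ a, L.form (B.bd k p a : g) x • (B.b k p a : g) = x := by
  obtain ⟨θ, h1, h2⟩ := gkp_halves (L := L) k p x
  exact basis_reproduce (B.b k p) (fun a => L.form (B.bd k p a : g)) (B.b_dual k p) h1 h2

theorem BasisData.bd_reproduce (k p : ZMod T) (x : g) :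
    ∑ a, L.form x (B.b k p a : g) • (B.bd k p a : g) = x := by
  obtain ⟨θ, h1, h2⟩ := gkp_halves (L := L) k (-p) x
  refine basis_reproduce (B.bd k p) (fun a => LinearMap.flip L.form (B.b k p a : g)) (fun a b => ?_) h1 h2
  rw [LinearMap.flip_apply L.form, B.b_dual]
  simp only [eq_comm]

theorem BasisData.c_reproduce (j : ZMod T) {x : g} (hx : L.σL x = L.ω ^ j.val • x) :
    ∑ a, L.form (B.cd j a : g) x • (B.c j a : g) = x :=
  basis_reproduce (B.c j) (fun a => L.form (B.cd j a : g)) (B.c_dual j)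
    (gj_halves j hx).1 (gj_halves j hx).2

theorem BasisData.cd_reproduce (j : ZMod T) {x : g} (hx : L.σL x = L.ω ^ (-j).val • x) :
    ∑ a, L.form x (B.c j a : g) • (B.cd j a : g) = x := by
  refine basis_reproduce (B.cd j) (fun a => LinearMap.flip L.form (B.c j a : g)) (fun a b => ?_)
    (gj_halves (-j) hx).1 (gj_halves (-j) hx).2
  rw [LinearMap.flip_apply L.form, B.c_dual]
  simp only [eq_comm]

end RealForms

/-! ### Invariant vectors of the affine Kac-Moody algebra -/

section Invariant

variable {g : Type*} [LieRing g] [LieAlgebra ℂ g] {T : ℕ} (L : LieData g T) {d : ℕ} {P : Prop}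

open AffineKM

/-- The conjugation `X ↦ c σ ^ l τ X`. -/
def twist (c : ℂ) (l : ℕ) : AffineKM g →ₛₗ[starRingEnd ℂ] AffineKM g :=
  c • ((L.σt ^ l : Module.End ℂ (AffineKM g)) : AffineKM g →ₗ[ℂ] AffineKM g).comp L.τt

theorem twist_apply (c : ℂ) (l : ℕ) (X : AffineKM g) :
    twist L c l X = c • (L.σt ^ l : Module.End ℂ _) (L.τt X) := rfl

theorem σt_pow_mode (l : ℕ) (x : g) (n : ℤ) :
    (L.σt ^ l : Module.End ℂ _) (mode x n) = mode ((L.σL ^ l : Module.End ℂ g) x) n := by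
  induction l with
  | zero => rfl
  | succ l ih => rw [pow_succ', pow_succ', Module.End.mul_apply, ih, σt_mode]; rfl

theorem σt_pow_K (l : ℕ) : (L.σt ^ l : Module.End ℂ _) (K g) = K g := by
  induction l with
  | zero => rfl
  | succ l ih => rw [pow_succ', Module.End.mul_apply, ih, σt_K]

theorem σt_pow_D (l : ℕ) : (L.σt ^ l : Module.End ℂ _) (D g) = D g := by
  induction l with
  | zero => rfl
  | succ l ih => rw [pow_succ', Module.End.mul_apply, ih, σt_D]

theorem twist_mode {c : ℂ} {l : ℕ} {x : g} (hx : c • (L.σL ^ l : Module.End ℂ g) (L.τ x) = x)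
    (n : ℤ) : twist L c l (mode x n) = mode x (-n) := by
  rw [twist_apply, τt_mode, σt_pow_mode, ← mode_smul, hx]

theorem twist_K (c : ℂ) (l : ℕ) : twist L c l (K g) = (-c) • K g := by
  rw [twist_apply, τt_K, map_neg, σt_pow_K, smul_neg, neg_smul]

theorem twist_D (c : ℂ) (l : ℕ) : twist L c l (D g) = (-c) • D g := by
  rw [twist_apply, τt_D, map_neg, σt_pow_D, smul_neg, neg_smul]

theorem twist_trigMode {c : ℂ} {l : ℕ} {u : Fin d → g}
    (hu : ∀ a, c • (L.σL ^ l : Module.End ℂ g) (L.τ (u a)) = u a) (a : Fin d) (n : ℤ) :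
    twist L c l (trigMode u a n) = trigMode u a n := by
  have h1 : starRingEnd ℂ (1 / (Real.sqrt 2 : ℂ)) = 1 / (Real.sqrt 2 : ℂ) := by
    rw [map_div₀, map_one, Complex.conj_ofReal]
  have h2 : starRingEnd ℂ (Complex.I / (Real.sqrt 2 : ℂ)) = -(Complex.I / (Real.sqrt 2 : ℂ)) := by
    rw [map_div₀, Complex.conj_I, Complex.conj_ofReal, neg_div]
  rcases lt_trichotomy n 0 with h | rfl | h
  · obtain ⟨k, rfl⟩ : ∃ k, n = -k := ⟨-n, by omega⟩
    rw [trigMode_neg _ _ (by omega), LinearMap.map_smulₛₗ, h2, map_sub, twist_mode L (hu a),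
      twist_mode L (hu a), neg_neg, neg_smul, ← smul_neg, neg_sub]
  · rw [trigMode_zero, twist_mode L (hu a), neg_zero]
  · rw [trigMode_pos _ _ h, LinearMap.map_smulₛₗ, h1, map_add, twist_mode L (hu a),
      twist_mode L (hu a), neg_neg, add_comm]

/-- τ exchanges the modes n and -n, which the cosine and sine combinations absorb. It sends K and D
to their negatives, and the condition on `κ` makes up for that sign. -/
theorem twist_trigVec {c κ : ℂ} {l : ℕ} {u : Fin d → g}
    (hu : ∀ a, c • (L.σL ^ l : Module.End ℂ g) (L.τ (u a)) = u a)
    (hκ : -(c * starRingEnd ℂ κ) = κ) (a : ModeIdx d P) :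
    twist L c l (trigVec κ u a) = trigVec κ u a := by
  have e : starRingEnd ℂ κ * -c = κ := by rw [mul_neg, mul_comm, hκ]
  cases a with
  | loop a n => exact twist_trigMode L hu a n
  | K h => 
    change twist L c l (κ • K g) = κ • K g
    rw [LinearMap.map_smulₛₗ, twist_K, smul_smul, e]
  | D h =>
    change twist L c l (κ • D g) = κ • D g
    rw [LinearMap.map_smulₛₗ, twist_D, smul_smul, e]

theorem twist_trigDual {c κ : ℂ} {l : ℕ} {u : Fin d → g}
    (hu : ∀ a, c • (L.σL ^ l : Module.End ℂ g) (L.τ (u a)) = u a)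
    (hκ : -(c * starRingEnd ℂ κ) = κ) (a : ModeIdx d P) :
    twist L c l (trigDual κ u a) = trigDual κ u a := by
  have e : starRingEnd ℂ κ * -c = κ := by rw [mul_neg, mul_comm, hκ]
  cases a with
  | loop a n => exact twist_trigMode L hu a n
  | K h => 
    change twist L c l (κ • D g) = κ • D g
    rw [LinearMap.map_smulₛₗ, twist_D, smul_smul, e]
  | D h =>
    change twist L c l (κ • K g) = κ • K g
    rw [LinearMap.map_smulₛₗ, twist_K, smul_smul, e]

theorem kmForm_twist {c c' : ℂ} (hc : c' * c = 1) (l : ℕ) (X Y : AffineKM g) :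
    L.kmForm (twist L c' l X) (twist L c l Y) = starRingEnd ℂ (L.kmForm X Y) := by
  rw [twist_apply, twist_apply, map_smul, map_smul, LinearMap.smul_apply, kmForm_σt_pow,
    kmForm_τt, smul_smul, mul_comm, hc, one_smul]

/-- Inverse scalars make the form of two twist-invariant vectors equal to its own conjugate, so
expansion coefficients in the real forms are real. -/
theorem kmForm_real {c c' : ℂ} (hc : c' * c = 1) {l : ℕ} {X Y : AffineKM g}
    (hX : twist L c' l X = X) (hY : twist L c l Y = Y) :
    ((L.kmForm X Y).re : ℂ) = L.kmForm X Y := by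
  have := kmForm_twist L hc l X Y
  rw [hX, hY] at this
  exact Complex.conj_eq_iff_re.1 this.symm

/-- The component-wise reproducing property in the real forms. -/
theorem exists_level (X : AffineKM g) :
    ∃ N : ℕ, ∀ n, n ∉ Finset.Ioo (-(N : ℤ)) N → loopPart X n = 0 := by
  refine ⟨(∑ n ∈ (loopPart X).support, n.natAbs) + 1, fun n hn => ?_⟩
  by_contra h
  have := Finset.single_le_sum (f := fun n : ℤ => n.natAbs) (fun _ _ => Nat.zero_le _)
    (Finsupp.mem_support_iff.2 h)
  generalize ∑ n ∈ (loopPart X).support, n.natAbs = S at *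
  simp only [Finset.mem_Ioo] at hn
  omega

/-- Expand in exponential modes, pass to the trigonometric basis by `trig_sum`, and observe that the
coefficients have become real. -/
theorem mem_span_trigVec {c c' κ κ' : ℂ} (hc : c' * c = 1) {l : ℕ} {u v : Fin d → g}
    (hv : ∀ a, c' • (L.σL ^ l : Module.End ℂ g) (L.τ (v a)) = v a)
    (hκ' : -(c' * starRingEnd ℂ κ') = κ') (hκ : κ' * κ = 1)
    {X : AffineKM g} (hX : twist L c l X = X)
    (hr : ∀ n, ∑ a, L.form (v a) (loopPart X n) • u a = loopPart X n)
    (hP : ¬ P → kPart X = 0 ∧ dPart X = 0) :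
    X ∈ Submodule.span ℝ (Set.range (trigVec κ u : ModeIdx d P → AffineKM g)) := by
  obtain ⟨N, hN⟩ := exists_level X
  have h1 := exp_reproduce L u v (P := P) X hr hP hN
  -- The bilinear map used is (Y, Y') ↦ (Y | X) Y'.
  have h2 := trig_sum (P := P) ((LinearMap.lsmul ℂ (AffineKM g)).comp (L.kmForm.flip X)) u v hκ N
  change ∑ a ∈ modes d P N, L.kmForm (trigDual κ' v a) X • trigVec κ u a =
    ∑ a ∈ modes d P N, L.kmForm (expDual v a) X • expVec u a at h2
  rw [← h1, ← h2]
  refine Submodule.sum_mem _ fun a _ => ?_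
  rw [← kmForm_real L hc (twist_trigDual L hv hκ' a) hX, Complex.coe_smul]
  exact Submodule.smul_mem _ _ (Submodule.subset_span ⟨a, rfl⟩)

theorem mem_span_trigDual {c c' κ κ' : ℂ} (hc : c' * c = 1) {l : ℕ} {u v : Fin d → g}
    (hu : ∀ a, c • (L.σL ^ l : Module.End ℂ g) (L.τ (u a)) = u a)
    (hκ0 : -(c * starRingEnd ℂ κ) = κ) (hκ : κ' * κ = 1)
    {X : AffineKM g} (hX : twist L c' l X = X)
    (hr : ∀ n, ∑ a, L.form (loopPart X n) (u a) • v a = loopPart X n)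
    (hP : ¬ P → kPart X = 0 ∧ dPart X = 0) :
    X ∈ Submodule.span ℝ (Set.range (trigDual κ' v : ModeIdx d P → AffineKM g)) := by
  obtain ⟨N, hN⟩ := exists_level X
  have h1 := exp_reproduce_dual L u v (P := P) X hr hP hN
  have h2 := trig_sum (P := P) ((LinearMap.lsmul ℂ (AffineKM g)).comp (L.kmForm X)).flip u v hκ N
  change ∑ a ∈ modes d P N, L.kmForm X (trigVec κ u a) • trigDual κ' v a =
    ∑ a ∈ modes d P N, L.kmForm X (expVec u a) • expDual v a at h2
  rw [← h1, ← h2]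
  refine Submodule.sum_mem _ fun a _ => ?_
  rw [← kmForm_real L hc hX (twist_trigVec L hu hκ0 a), Complex.coe_smul]
  exact Submodule.smul_mem _ _ (Submodule.subset_span ⟨a, rfl⟩)

end Invariant

/-! ### Stabilisers of the points and the correspondence between field indices and slots. -/

section Stabilisers

variable {T : ℕ} [NeZero T] {ω : ℂ} {Z : Divisor T ω}

theorem omega_val_inj (hω : IsPrimitiveRoot ω T) {i j : ZMod T} (h : ω ^ i.val = ω ^ j.val) :
    i = j :=
  ZMod.val_injective T (hω.pow_inj (ZMod.val_lt i) (ZMod.val_lt j) h)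

theorem mob_r (i : ZMod T) (x : ℂ) : mob ω (.r i) x = ω ^ i.val * x := rfl

/-- In Mathlib's convention `sr i` is t s^i = s^(-i) t, so s^k t is `sr (-k)`; this explains the
signs below. -/
theorem mob_sr (hω : IsPrimitiveRoot ω T) (i : ZMod T) (x : ℂ) :
    mob ω (.sr i) x = ω ^ (-i).val * starRingEnd ℂ x := by
  have e : (DihedralGroup.sr i : DihedralGroup T) = .r (-i) * .sr 0 := by simp
  rw [e, mob_mul hω, mob_r]
  simp [mob]

theorem fixes_r (hω : IsPrimitiveRoot ω T) {x : ℂ} (hx : x ≠ 0) {i : ZMod T}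
    (h : mob ω (.r i) x = x) : (DihedralGroup.r i : DihedralGroup T) = 1 := by
  have h1 : ω ^ i.val = ω ^ (0 : ZMod T).val := by
    rw [ZMod.val_zero, pow_zero]
    exact (mul_eq_right₀ hx).1 h
  rw [omega_val_inj hω h1]
  rfl

theorem Divisor.mem_cplxPts {x : ℂ} : x ∈ Z.cplxPts ↔ x ∈ Z.n.support ∧ x ≠ 0 ∧
    ∀ k : ZMod T, ω ^ k.val * starRingEnd ℂ x ≠ x := by
  unfold Divisor.cplxPts
  exact @Finset.mem_filter _ _ (_) _ _

theorem Divisor.mem_realPts {x : ℂ} {k : ZMod T} : x ∈ Z.realPts k ↔ x ∈ Z.n.support ∧ x ≠ 0 ∧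
    ω ^ k.val * starRingEnd ℂ x = x := by
  classical
  unfold Divisor.realPts
  rw [Finset.mem_filter]

theorem fixes_one (s : Slot Z) : Fixes s 1 := by
  cases s with
  | inl s => exact mob_one _
  | inr q => trivial

theorem fixes_cplx (hω : IsPrimitiveRoot ω T) (x : {x : ℂ // x ∈ Z.cplxPts}) (p : Fin (Z.n x))
    (c : Bool) (α : DihedralGroup T) : Fixes (slotOf (.cplx x p c)) α ↔ α = 1 := by
  constructor
  · intro h
    have h : mob ω α (x : ℂ) = x := h
    obtain ⟨_, hx, hk⟩ := Divisor.mem_cplxPts.1 x.2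
    cases α with
    | r i => exact fixes_r hω hx h
    | sr i => rw [mob_sr hω] at h; exact absurd h (hk _)
  · rintro rfl; exact fixes_one _

theorem fixes_real (hω : IsPrimitiveRoot ω T) (l : ZMod T) (x : {x : ℂ // x ∈ Z.realPts l})
    (p : Fin (Z.n x)) (α : DihedralGroup T) :
    Fixes (slotOf (.real l x p)) α ↔ α = 1 ∨ α = .sr (-l) := by
  obtain ⟨_, hx, hk⟩ := Divisor.mem_realPts.1 x.2
  constructor
  · intro h
    have h : mob ω α (x : ℂ) = x := h
    cases α with
    | r i => exact Or.inl (fixes_r hω hx h)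
    | sr i =>
      right
      -- The rewriting expresses both sides as multiples of conj x, giving ω^(-i) = ω^l.
      rw [mob_sr hω, ← hk] at h
      nth_rewrite 2 [hk] at h
      have hx' : starRingEnd ℂ (x : ℂ) ≠ 0 := by simpa using hx
      rw [hk] at h
      nth_rewrite 2 [← hk] at h
      have := omega_val_inj hω (mul_right_cancel₀ hx' h)
      rw [← this, neg_neg]
  · rintro (rfl | rfl)
    · exact fixes_one _
    · change mob ω _ (x : ℂ) = x
      rw [mob_sr hω, neg_neg, hk]

theorem fixes_zero (p : Fin (Z.n 0)) (α : DihedralGroup T) : Fixes (slotOf (.zero p : FIdx Z)) α := by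
  change mob ω α 0 = 0
  cases α <;> simp [mob]

theorem exists_slotOf (s : Slot Z) :
    ∃ i : FIdx Z, slotOf i = s := by
  cases s with
  | inl s =>
    obtain ⟨⟨x, hx⟩, p⟩ := s
    by_cases h0 : x = 0
    · subst h0; exact ⟨.zero p, rfl⟩
    by_cases hk : ∃ k : ZMod T, ω ^ k.val * starRingEnd ℂ x = x
    · obtain ⟨k, hk⟩ := hk
      exact ⟨.real k ⟨x, Divisor.mem_realPts.2 ⟨hx, h0, hk⟩⟩ p, rfl⟩
    · push Not at hk
      exact ⟨.cplx ⟨x, Divisor.mem_cplxPts.2 ⟨hx, h0, hk⟩⟩ p false, rfl⟩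
  | inr q => exact ⟨.inf q, rfl⟩

/-- The Boolean at complex points is the only ambiguity: the class of a point is determined by its
stabiliser, and k by ω^k = x / conj x. -/
theorem slotOf_eq (hω : IsPrimitiveRoot ω T) {i j : FIdx Z} (h : slotOf i = slotOf j) :
    i = j ∨ ∃ (x : {x : ℂ // x ∈ Z.cplxPts}) (p : Fin (Z.n x)) (b b' : Bool),
      i = .cplx x p b ∧ j = .cplx x p b' := by
  rcases i with ⟨⟨x, hx⟩, p, b⟩ | ⟨l, ⟨x, hx⟩, p⟩ | p | q <;>
    rcases j with ⟨⟨x', hx'⟩, p', b'⟩ | ⟨l', ⟨x', hx'⟩, p'⟩ | p' | q' <;>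
    simp only [slotOf, Sum.inl.injEq, Sum.inr.injEq, Sigma.mk.injEq, Subtype.mk.injEq,
      reduceCtorEq] at h
  · obtain ⟨rfl, h⟩ := h
    obtain rfl := eq_of_heq h
    exact Or.inr ⟨_, _, _, _, rfl, rfl⟩
  · obtain ⟨rfl, h⟩ := h
    exact absurd (Divisor.mem_realPts.1 hx').2.2 ((Divisor.mem_cplxPts.1 hx).2.2 _)
  · exact absurd h.1 (Divisor.mem_cplxPts.1 hx).2.1
  · obtain ⟨rfl, h⟩ := h
    exact absurd (Divisor.mem_realPts.1 hx).2.2 ((Divisor.mem_cplxPts.1 hx').2.2 _)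
  · obtain ⟨rfl, h⟩ := h
    obtain rfl := eq_of_heq h
    have h0 : starRingEnd ℂ x ≠ 0 := by simpa using (Divisor.mem_realPts.1 hx).2.1
    have h1 := (Divisor.mem_realPts.1 hx).2.2.trans (Divisor.mem_realPts.1 hx').2.2.symm
    obtain rfl := omega_val_inj hω (mul_right_cancel₀ h0 h1)
    exact Or.inl rfl
  · exact absurd h.1 (Divisor.mem_realPts.1 hx).2.1
  · exact absurd h.1.symm (Divisor.mem_cplxPts.1 hx').2.1
  · exact absurd h.1.symm (Divisor.mem_realPts.1 hx').2.1
  · obtain rfl := eq_of_heq h.2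
    exact Or.inl rfl
  · subst h
    exact Or.inl rfl

end Stabilisers

section SlotFixed

variable {V : Type*} [AddCommGroup V] [Module ℂ V] [Module ℝ V] [IsScalarTower ℝ ℂ V]
  {T : ℕ} [NeZero T] {S : V →ₗ[ℂ] V} {R : V →ₛₗ[starRingEnd ℂ] V}

theorem slotAct_one (w : ℂ) (S : V →ₗ[ℂ] V) (R : V →ₛₗ[starRingEnd ℂ] V) (v : V) :
    slotAct w S R (1 : DihedralGroup T) v = v := dihedralAct_one _ _ v

/-- Rewrites the generator of a real stabiliser as w^l S^l R, the form in which `twist` appears. -/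
theorem slotAct_sr_neg (h : IsDihedral T S R) {w : ℂ} (hw : w ^ T = 1)
    (hw' : w * starRingEnd ℂ w = 1) (l : ZMod T) (v : V) :
    slotAct w S R (.sr (-l)) v = w ^ l.val • (S ^ l.val : Module.End ℂ V) (R v) := by
  have e : (DihedralGroup.sr (-l) : DihedralGroup T) = .r l * .sr 0 := by simp
  have := (h.smul hw hw').mul (.r l) (.sr 0) v
  rw [← e] at this
  refine this.trans ?_
  rw [dihedralAct_sr, ZMod.val_zero, pow_zero]
  exact slotAct_r w S R l (R v)

theorem slotAct_r_one (h : IsDihedral T S R) {w : ℂ} (hw : w ^ T = 1)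
    (hw' : w * starRingEnd ℂ w = 1) (v : V) :
    slotAct w S R (.r 1 : DihedralGroup T) v = w • S v := by
  unfold slotAct
  rw [dihedralAct_r, ZMod.val_one_eq_one_mod, (h.smul hw hw').pow_mod, pow_one]
  rfl

theorem slotAct_sr_zero (w : ℂ) (S : V →ₗ[ℂ] V) (R : V →ₛₗ[starRingEnd ℂ] V) (v : V) :
    slotAct w S R (.sr 0 : DihedralGroup T) v = R v := by
  unfold slotAct
  rw [dihedralAct_sr, ZMod.val_zero, pow_zero]
  rfl

theorem slotAct_fixed {w : ℂ} {v : V} (hS : w • S v = v) (hR : R v = v) (α : DihedralGroup T) :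
    slotAct w S R α v = v :=
  dihedralAct_mem {v} (fun x hx => by rw [Set.mem_singleton_iff.1 hx]; exact hS)
    (fun x hx => by rw [Set.mem_singleton_iff.1 hx]; exact hR) α rfl

end SlotFixed

/-! ### Phases, eigenvalues and reality of the chosen basis vectors. -/

section BasisFacts

variable {g : Type*} [LieRing g] [LieAlgebra ℂ g] {T : ℕ} [NeZero T] {L : LieData g T}
  (B : BasisData L) {Z : Divisor T L.ω}

open AffineKM

/-- The basis dual to `upVec` with respect to the real part of the form. -/
def dualVec : (i : FIdx Z) → ModeIdx (dimOf B i) (hasKD i) → AffineKM g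
  | .inl ⟨_, _, false⟩, a => expDual (fun a => (B.bd 0 0 a : g)) a
  | .inl ⟨_, _, true⟩, a => -Complex.I • expDual (fun a => (B.bd 0 0 a : g)) a
  | .inr i, a => auxVec B (.inr i) a

/-- A square root of a number of modulus 1 also has modulus 1. -/
theorem conj_eta (k : ℕ) : B.η ^ k * starRingEnd ℂ (B.η ^ k) = 1 := by
  have h : ‖B.η‖ = 1 := by
    have h1 : ‖B.η‖ ^ 2 = 1 := by
      rw [← norm_pow, B.η_sq, L.ω_prim.norm'_eq_one (NeZero.ne T)]
    exact (pow_eq_one_iff_of_nonneg (norm_nonneg _) two_ne_zero).1 h1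
  rw [Complex.mul_conj, Complex.normSq_eq_norm_sq, norm_pow, h]
  simp

theorem eta_ne (k : ℕ) : B.η ^ k ≠ 0 := left_ne_zero_of_mul_eq_one (conj_eta B k)

theorem eta_mul (k : ℕ) : B.η ^ k * B.η ^ k = L.ω ^ k := by
  rw [← mul_pow, ← sq, B.η_sq]

theorem conj_eta_eq (k : ℕ) : starRingEnd ℂ (B.η ^ k) = (B.η ^ k)⁻¹ :=
  eq_inv_of_mul_eq_one_right (conj_eta B k)

theorem kappa_mul (k : ℕ) : (-Complex.I * B.η ^ k) * (Complex.I * (B.η ^ k)⁻¹) = 1 := by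
  have := eta_ne B k
  field_simp
  simp

/-- This is the reason for the factor iω^(-kp/2) on K and D: it solves the reality condition -(c ·
conj κ) = κ for c = ω^(-kp). The dual factor solves it for ω^(kp). -/
theorem kappa_up (k : ℕ) : -((L.ω ^ k)⁻¹ * starRingEnd ℂ (Complex.I * (B.η ^ k)⁻¹)) =
    Complex.I * (B.η ^ k)⁻¹ := by
  have := eta_ne B k
  rw [map_mul, map_inv₀, conj_eta_eq, ← eta_mul, Complex.conj_I, inv_inv]
  field_simp

theorem kappa_dn (k : ℕ) : -(L.ω ^ k * starRingEnd ℂ (-Complex.I * B.η ^ k)) =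
    -Complex.I * B.η ^ k := by
  have := eta_ne B k
  rw [map_mul, map_neg, conj_eta_eq, ← eta_mul, Complex.conj_I]
  field_simp

theorem kappa_one_up : -((1 : ℂ) * starRingEnd ℂ Complex.I) = Complex.I := by simp
theorem kappa_one_dn : -((1 : ℂ) * starRingEnd ℂ (-Complex.I)) = -Complex.I := by simp
theorem kappa_one : (-Complex.I) * Complex.I = 1 := by simp

theorem b_twist (k : ZMod T) (p : ℕ) (a : Fin B.d) :
    (L.ω ^ (k.val * p))⁻¹ • (L.σL ^ k.val : Module.End ℂ g) (L.τ (B.b k p a)) = B.b k p a := by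
  have h := (mem_gkp L).1 (B.b k p a).2
  have h0 : L.ω ^ (k.val * p) ≠ 0 := pow_ne_zero _ L.ω_ne
  rw [mul_comm k.val, pow_mul, omega_pow_val, ← pow_mul, mul_comm] at h
  rw [h, inv_smul_smul₀ h0]

theorem bd_twist (k : ZMod T) (p : ℕ) (a : Fin B.d) :
    (L.ω ^ (k.val * p)) • (L.σL ^ k.val : Module.End ℂ g) (L.τ (B.bd k p a)) = B.bd k p a := by
  have h := (mem_gkp L).1 (B.bd k p a).2
  have h0 : L.ω ^ (k.val * p) ≠ 0 := pow_ne_zero _ L.ω_ne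
  rw [mul_comm k.val, pow_mul, omega_pow_val_neg, omega_pow_val, inv_pow, ← pow_mul, mul_comm] at h
  rw [h, smul_inv_smul₀ h0]

theorem c_twist (j : ZMod T) (a : Fin (B.m j)) :
    (1 : ℂ) • (L.σL ^ 0 : Module.End ℂ g) (L.τ (B.c j a)) = B.c j a := by
  rw [one_smul]
  exact ((mem_gj L).1 (B.c j a).2).2

theorem cd_twist (j : ZMod T) (a : Fin (B.m j)) :
    (1 : ℂ) • (L.σL ^ 0 : Module.End ℂ g) (L.τ (B.cd j a)) = B.cd j a := by
  rw [one_smul]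
  exact ((mem_gj L).1 (B.cd j a).2).2

theorem twist_one (X : AffineKM g) : twist L 1 0 X = L.τt X := by
  rw [twist_apply, one_smul]; rfl

/-- The `σ`-eigenvectors among the `trigVec`. -/
theorem σt_trigVec {d : ℕ} {P : Prop} {u : Fin d → g} {w : ℂ}
    (hu : ∀ a, L.σL (u a) = w • u a) (hP : P → w = 1) (κ : ℂ) (a : ModeIdx d P) :
    L.σt (trigVec κ u a) = w • trigVec κ u a := by
  cases a with
  | loop a n =>
    change L.σt (trigMode u a n) = w • trigMode u a n
    unfold trigMode
    split_ifs <;>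
      simp only [map_smul, map_add, map_sub, σt_mode, hu, mode_smul, smul_add, smul_sub,
        smul_comm w]
  | K h => rw [hP h, one_smul]; change L.σt (κ • K g) = κ • K g; rw [map_smul, σt_K]
  | D h => rw [hP h, one_smul]; change L.σt (κ • D g) = κ • D g; rw [map_smul, σt_D]

theorem σt_trigDual {d : ℕ} {P : Prop} {u : Fin d → g} {w : ℂ}
    (hu : ∀ a, L.σL (u a) = w • u a) (hP : P → w = 1) (κ : ℂ) (a : ModeIdx d P) :
    L.σt (trigDual κ u a) = w • trigDual κ u a := by
  cases a with
  | loop a n => exact σt_trigVec (P := P) hu hP κ (.loop a n)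
  | K h => exact σt_trigVec (P := P) hu hP κ (.D h)
  | D h => exact σt_trigVec (P := P) hu hP κ (.K h)

theorem c_eigen (j : ZMod T) (a : Fin (B.m j)) :
    L.σL (B.c j a : g) = L.ω ^ j.val • (B.c j a : g) := ((mem_gj L).1 (B.c j a).2).1

theorem cd_eigen (j : ZMod T) (a : Fin (B.m j)) :
    L.σL (B.cd j a : g) = (L.ω ^ j.val)⁻¹ • (B.cd j a : g) := by
  rw [← omega_pow_val_neg]; exact ((mem_gj L).1 (B.cd j a).2).1

theorem slotWeight_real (l : ZMod T) (x : {x : ℂ // x ∈ Z.realPts l}) (p : Fin (Z.n x)) :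
    slotWeight (slotOf (.real l x p)) ^ l.val = (L.ω ^ (l.val * (p : ℕ)))⁻¹ := by
  change ((L.ω ^ (p : ℕ))⁻¹) ^ l.val = _
  rw [inv_pow, ← pow_mul, mul_comm]

theorem slotWeight_zero (p : Fin (Z.n 0)) :
    slotWeight (slotOf (.zero p : FIdx Z)) = (L.ω ^ (((p : ℕ) : ZMod T)).val)⁻¹ := by
  rw [omega_pow_val]; rfl

theorem slotWeight_inf (q : Fin (Z.nInf - 1)) :
    slotWeight (slotOf (.inf q : FIdx Z)) =
      (L.ω ^ (-(((q : ℕ) + 1 : ℕ) : ZMod T)).val)⁻¹ := by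
  rw [omega_pow_val_neg, omega_pow_val, inv_inv]; rfl

theorem loop_eigen {w : ℂ} (hw : w ≠ 0) {X : AffineKM g} (h : w • L.σt X = X) (n : ℤ) :
    L.σL (loopPart X n) = w⁻¹ • loopPart X n := by
  conv_rhs => rw [← h]
  rw [map_smul, Finsupp.smul_apply, inv_smul_smul₀ hw]
  rfl

/-- σ fixes K and D, so they survive only in the trivial eigenspace; hence the condition `hasKD`. -/
theorem kd_eigen {w : ℂ} {X : AffineKM g} (h : w • L.σt X = X) (hw : w ≠ 1) :
    kPart X = 0 ∧ dPart X = 0 := by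
  have h1 : w * kPart X = kPart X := congrArg kPart h
  have h2 : w * dPart X = dPart X := congrArg dPart h
  constructor
  · by_contra h0; exact hw ((mul_eq_right₀ h0).1 h1)
  · by_contra h0; exact hw ((mul_eq_right₀ h0).1 h2)

theorem omega_val_eq_one {j : ZMod T} : L.ω ^ j.val = 1 ↔ j = 0 := by
  constructor
  · intro h
    exact omega_val_inj L.ω_prim (by rw [h, ZMod.val_zero, pow_zero])
  · rintro rfl; rw [ZMod.val_zero, pow_zero]

theorem inv_eigen_up (j : ZMod T) (X : AffineKM g) (hS : (L.ω ^ j.val)⁻¹ • L.σt X = X)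
    (hR : L.τt X = X) : X ∈ Submodule.span ℝ (Set.range
      (trigVec Complex.I (fun a => (B.c j a : g)) : ModeIdx (B.m j) (j = 0) → AffineKM g)) := by
  have hw : (L.ω ^ j.val)⁻¹ ≠ 0 := inv_ne_zero (pow_ne_zero _ L.ω_ne)
  refine mem_span_trigVec L (one_mul 1) (l := 0) (cd_twist B j) kappa_one_dn kappa_one
    ((twist_one X).trans hR) (fun n => ?_) (fun hP => kd_eigen hS ?_)
  · refine B.c_reproduce j ?_
    have := loop_eigen hw hS n
    rwa [inv_inv] at this
  · rw [ne_eq, inv_eq_one, omega_val_eq_one]; exact hP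

theorem inv_eigen_dn (j : ZMod T) (X : AffineKM g) (hS : (L.ω ^ j.val) • L.σt X = X)
    (hR : L.τt X = X) : X ∈ Submodule.span ℝ (Set.range
      (trigDual (-Complex.I) (fun a => (B.cd j a : g)) :
        ModeIdx (B.m j) (j = 0) → AffineKM g)) := by
  have hw : (L.ω ^ j.val) ≠ 0 := (pow_ne_zero _ L.ω_ne)
  refine mem_span_trigDual L (one_mul 1) (l := 0) (c_twist B j) kappa_one_up kappa_one
    ((twist_one X).trans hR) (fun n => ?_) (fun hP => kd_eigen hS ?_)
  · refine B.cd_reproduce j ?_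
    have := loop_eigen hw hS n
    rwa [← omega_pow_val_neg] at this
  · rw [ne_eq, omega_val_eq_one]; exact hP

end BasisFacts

/-! ### Invariance, duality and spanning at each slot. -/

section IndexFacts

variable {g : Type*} [LieRing g] [LieAlgebra ℂ g] {T : ℕ} [NeZero T] {L : LieData g T}
  (B : BasisData L) {Z : Divisor T L.ω}

open AffineKM

theorem slotWeight_inv_pow (s : Slot Z) : (slotWeight s)⁻¹ ^ T = 1 := by
  rw [inv_pow, slotWeight_pow L.ω_prim, inv_one]

theorem slotWeight_inv_conj (s : Slot Z) :
    (slotWeight s)⁻¹ * starRingEnd ℂ (slotWeight s)⁻¹ = 1 := by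
  rw [map_inv₀, ← mul_inv, slotWeight_conj L.ω_prim, inv_one]

/-- The two operators fixing the vectors attached to an index which is not a complex point. -/
theorem upVec_fixed (i : (Σ (k : ZMod T) (x : {x : ℂ // x ∈ Z.realPts k}), Fin (Z.n x)) ⊕
      (Fin (Z.n 0) ⊕ Fin (Z.nInf - 1))) (a : ModeIdx (dimOf B (.inr i : FIdx Z)) (hasKD (.inr i : FIdx Z)))
    {α : DihedralGroup T} (hα : Fixes (slotOf (.inr i : FIdx Z)) α) :
    slotAct (slotWeight (slotOf (.inr i : FIdx Z))) L.σt L.τt α (upVec B (.inr i) a) =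
      upVec B (.inr i) a := by
  rcases i with ⟨l, x, p⟩ | p | q
  · rcases (fixes_real L.ω_prim l x p α).1 hα with rfl | rfl
    · exact slotAct_one _ _ _ _
    · rw [slotAct_sr_neg L.isDihedral_t (slotWeight_pow L.ω_prim _) (slotWeight_conj L.ω_prim _),
        slotWeight_real]
      exact twist_trigVec L (b_twist B l p) (kappa_up B _) a
  · refine slotAct_fixed ?_ ?_ α
    · rw [slotWeight_zero]
      refine (congrArg _ (σt_trigVec (c_eigen B ((p : ℕ) : ZMod T)) omega_val_eq_one.2 _ a)).trans ?_
      exact inv_smul_smul₀ (pow_ne_zero _ L.ω_ne) _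
    · rw [← twist_one]
      exact twist_trigVec L (c_twist B _) kappa_one_up a
  · refine slotAct_fixed ?_ ?_ α
    · rw [slotWeight_inf]
      refine (congrArg _ (σt_trigVec (c_eigen B _) omega_val_eq_one.2 _ a)).trans ?_
      exact inv_smul_smul₀ (pow_ne_zero _ L.ω_ne) _
    · rw [← twist_one]
      exact twist_trigVec L (c_twist B _) kappa_one_up a

/-- The dual vectors are invariant for the inverse weight, the one with which the group acts on
coefficients of polar differentials. -/
theorem auxVec_fixed (i : (Σ (k : ZMod T) (x : {x : ℂ // x ∈ Z.realPts k}), Fin (Z.n x)) ⊕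
      (Fin (Z.n 0) ⊕ Fin (Z.nInf - 1))) (a : ModeIdx (dimOf B (.inr i : FIdx Z)) (hasKD (.inr i : FIdx Z)))
    {α : DihedralGroup T} (hα : Fixes (slotOf (.inr i : FIdx Z)) α) :
    slotAct (slotWeight (slotOf (.inr i : FIdx Z)))⁻¹ L.σt L.τt α (auxVec B (.inr i) a) =
      auxVec B (.inr i) a := by
  rcases i with ⟨l, x, p⟩ | p | q
  · rcases (fixes_real L.ω_prim l x p α).1 hα with rfl | rfl
    · exact slotAct_one _ _ _ _
    · rw [slotAct_sr_neg L.isDihedral_t (slotWeight_inv_pow _) (slotWeight_inv_conj _), inv_pow,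
        slotWeight_real, inv_inv]
      exact twist_trigDual L (bd_twist B l p) (kappa_dn B _) a
  · refine slotAct_fixed ?_ ?_ α
    · rw [slotWeight_zero, inv_inv]
      refine (congrArg _ (σt_trigDual (cd_eigen B ((p : ℕ) : ZMod T))
        (fun h => inv_eq_one.2 (omega_val_eq_one.2 h)) _ a)).trans ?_
      exact smul_inv_smul₀ (pow_ne_zero _ L.ω_ne) _
    · rw [← twist_one]
      exact twist_trigDual L (cd_twist B _) kappa_one_dn a
  · refine slotAct_fixed ?_ ?_ α
    · rw [slotWeight_inf, inv_inv]
      refine (congrArg _ (σt_trigDual (cd_eigen B _)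
        (fun h => inv_eq_one.2 (omega_val_eq_one.2 h)) _ a)).trans ?_
      exact smul_inv_smul₀ (pow_ne_zero _ L.ω_ne) _
    · rw [← twist_one]
      exact twist_trigDual L (cd_twist B _) kappa_one_dn a

theorem aux_dual (i : (Σ (k : ZMod T) (x : {x : ℂ // x ∈ Z.realPts k}), Fin (Z.n x)) ⊕
      (Fin (Z.n 0) ⊕ Fin (Z.nInf - 1)))
    (a b : ModeIdx (dimOf B (.inr i : FIdx Z)) (hasKD (.inr i : FIdx Z))) [inst : Decidable (a = b)] :
    L.kmForm (auxVec B (.inr i) a) (upVec B (.inr i) b) = if a = b then 1 else 0 := by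
  rcases i with ⟨l, x, p⟩ | p | q
  · exact @trig_dual _ _ _ _ L _ _ _ _ (B.b_dual l _) _ _ (kappa_mul B _) a b inst
  · exact @trig_dual _ _ _ _ L _ _ _ _ (B.c_dual _) _ _ kappa_one a b inst
  · exact @trig_dual _ _ _ _ L _ _ _ _ (B.c_dual _) _ _ kappa_one a b inst

theorem re_ite_sigma {ι : Type*} {κ : ι → Type*} {i : ι} (a b : κ i) [Decidable (a = b)]
    [Decidable ((⟨i, a⟩ : Σ i, κ i) = ⟨i, b⟩)] :
    (if a = b then (1 : ℂ) else 0).re = if (⟨i, a⟩ : Σ i, κ i) = ⟨i, b⟩ then 1 else 0 := by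
  by_cases h : a = b
  · rw [if_pos h, if_pos (congrArg _ h)]; rfl
  · rw [if_neg h, if_neg fun h' => h (eq_of_heq (Sigma.mk.inj h').2)]; rfl

/-- At a complex point both I and iI belong to the basis; their duals I' and -iI' have purely
imaginary cross pairings, which the real part kills. -/
theorem dual_pair (A A' : Idx B Z) [Decidable (A = A')] (h : slotOf A.1 = slotOf A'.1) :
    (L.kmForm (dualVec B A.1 A.2) (upVec B A'.1 A'.2)).re = if A = A' then 1 else 0 := by
  classical
  obtain ⟨i, a⟩ := A
  obtain ⟨j, b⟩ := A'
  rcases slotOf_eq L.ω_prim h with h | ⟨x, p, c, c', h, h'⟩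
  · dsimp only at h
    subst h
    rcases i with ⟨x, p, c⟩ | i
    · have e : L.kmForm (expDual (fun a => (B.bd 0 0 a : g)) a) (expVec (fun a => (B.b 0 0 a : g)) b)
          = if a = b then 1 else 0 := exp_dual L (B.b_dual 0 0) a b
      cases c with
      | false =>
        exact (congrArg Complex.re e).trans (re_ite_sigma (κ := fun i : FIdx Z => ModeIdx (dimOf B i) (hasKD i)) a b)
      | true =>
        change (L.kmForm (-Complex.I • expDual (fun a => (B.bd 0 0 a : g)) a)
          (Complex.I • expVec (fun a => (B.b 0 0 a : g)) b)).re = _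
        rw [map_smul, map_smul, LinearMap.smul_apply, smul_smul, mul_neg, Complex.I_mul_I, neg_neg,
          one_smul, e]
        exact re_ite_sigma (κ := fun i : FIdx Z => ModeIdx (dimOf B i) (hasKD i)) a b
    · change (L.kmForm (auxVec B (.inr i) a) (upVec B (.inr i) b)).re = _
      rw [aux_dual B i]
      exact re_ite_sigma (κ := fun i : FIdx Z => ModeIdx (dimOf B i) (hasKD i)) a b
  · dsimp only at h h'
    subst h h'
    have e : ∀ a b : ModeIdx B.d True, L.kmForm (expDual (fun a => (B.bd 0 0 a : g)) a)
        (expVec (fun a => (B.b 0 0 a : g)) b) = if a = b then 1 else 0 :=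
      fun a b => exp_dual L (B.b_dual 0 0) a b
    have e1 : ∀ a b : ModeIdx B.d True, (L.kmForm (expDual (fun a => (B.bd 0 0 a : g)) a)
        (Complex.I • expVec (fun a => (B.b 0 0 a : g)) b)).re = 0 := by
      intro a b
      rw [map_smul, e]
      split_ifs <;> simp
    have e2 : ∀ a b : ModeIdx B.d True, (L.kmForm (-Complex.I • expDual
        (fun a => (B.bd 0 0 a : g)) a) (expVec (fun a => (B.b 0 0 a : g)) b)).re = 0 := by
      intro a b
      rw [map_smul, LinearMap.smul_apply, e]
      split_ifs <;> simp
    have e3 : ∀ a b : ModeIdx B.d True, L.kmForm (-Complex.I • expDual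
        (fun a => (B.bd 0 0 a : g)) a) (Complex.I • expVec (fun a => (B.b 0 0 a : g)) b) =
        if a = b then 1 else 0 := by
      intro a b
      rw [map_smul, map_smul, LinearMap.smul_apply, smul_smul, mul_neg, Complex.I_mul_I, neg_neg,
        one_smul, e]
    cases c <;> cases c'
    · exact (congrArg Complex.re (e a b)).trans (re_ite_sigma (κ := fun i : FIdx Z => ModeIdx (dimOf B i) (hasKD i)) a b)
    · rw [if_neg (fun h => by have := (Sigma.mk.inj h).1; simp at this)]
      exact e1 a b
    · rw [if_neg (fun h => by have := (Sigma.mk.inj h).1; simp at this)]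
      exact e2 a b
    · exact (congrArg Complex.re (e3 a b)).trans (re_ite_sigma (κ := fun i : FIdx Z => ModeIdx (dimOf B i) (hasKD i)) a b)

/-- Only the generators of the stabiliser matter: none at a complex point, one reflection at a real
point, and s together with t at 0 and ∞. -/
theorem mem_span_upVec (s : Slot Z) (X : AffineKM g)
    (hX : ∀ α, Fixes s α → slotAct (slotWeight s) L.σt L.τt α X = X) :
    X ∈ Submodule.span ℝ {Y | ∃ A : Idx B Z, slotOf A.1 = s ∧ Y = upVec B A.1 A.2} := by
  obtain ⟨i, rfl⟩ := exists_slotOf s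
  rcases i with ⟨x, p, c⟩ | ⟨l, x, p⟩ | p | q
  · obtain ⟨N, hN⟩ := exists_level X
    have h1 := exp_reproduce L (P := True) (fun a => (B.b 0 0 a : g)) (fun a => (B.bd 0 0 a : g)) X
      (fun n => B.b_reproduce 0 0 _) (fun h => absurd trivial h) hN
    rw [← h1]
    refine Submodule.sum_mem _ fun a _ => ?_
    -- A complex coefficient is distributed over the two real basis vectors Y and iY.
    have e : ∀ (z : ℂ) (Y : AffineKM g), z • Y = z.re • Y + z.im • (Complex.I • Y) := by
      intro z Y
      rw [real_smul_eq, real_smul_eq, smul_smul, ← add_smul, Complex.re_add_im]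
    rw [e]
    refine Submodule.add_mem _ (Submodule.smul_mem _ _ (Submodule.subset_span ?_))
      (Submodule.smul_mem _ _ (Submodule.subset_span ?_))
    · exact ⟨⟨.cplx x p false, a⟩, rfl, rfl⟩
    · exact ⟨⟨.cplx x p true, a⟩, rfl, rfl⟩
  · have h := hX (.sr (-l)) ((fixes_real L.ω_prim l x p _).2 (Or.inr rfl))
    rw [slotAct_sr_neg L.isDihedral_t (slotWeight_pow L.ω_prim _) (slotWeight_conj L.ω_prim _),
        slotWeight_real] at h
    refine Submodule.span_mono ?_ (mem_span_trigVec L (P := True) (inv_mul_cancel₀ (inv_ne_zero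
      (pow_ne_zero _ L.ω_ne))) (u := fun a => (B.b l ((p : ℕ) : ZMod T) a : g))
      (by rw [inv_inv]; exact bd_twist B l p) (by rw [inv_inv]; exact kappa_dn B _) (kappa_mul B _) h
      (fun n => B.b_reproduce _ _ _)
      (fun h => absurd trivial h))
    rintro Y ⟨a, rfl⟩
    exact ⟨⟨.real l x p, a⟩, rfl, rfl⟩
  · have h1 := hX (.r 1) (fixes_zero p _)
    have h2 := hX (.sr 0) (fixes_zero p _)
    rw [slotAct_r_one L.isDihedral_t (slotWeight_pow L.ω_prim _) (slotWeight_conj L.ω_prim _),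
      slotWeight_zero] at h1
    rw [slotAct_sr_zero] at h2
    refine Submodule.span_mono ?_ (inv_eigen_up B _ X h1 h2)
    rintro Y ⟨a, rfl⟩
    exact ⟨⟨.zero p, a⟩, rfl, rfl⟩
  · have h1 := hX (.r 1) trivial
    have h2 := hX (.sr 0) trivial
    rw [slotAct_r_one L.isDihedral_t (slotWeight_pow L.ω_prim _) (slotWeight_conj L.ω_prim _),
      slotWeight_inf] at h1
    rw [slotAct_sr_zero] at h2
    refine Submodule.span_mono ?_ (inv_eigen_up B _ X h1 h2)
    rintro Y ⟨a, rfl⟩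
    exact ⟨⟨.inf q, a⟩, rfl, rfl⟩

theorem mem_span_dualVec (s : Slot Z) (X : AffineKM g)
    (hX : ∀ α, Fixes s α → slotAct (slotWeight s)⁻¹ L.σt L.τt α X = X) :
    X ∈ Submodule.span ℝ {Y | ∃ A : Idx B Z, slotOf A.1 = s ∧ Y = dualVec B A.1 A.2} := by
  obtain ⟨i, rfl⟩ := exists_slotOf s
  rcases i with ⟨x, p, c⟩ | ⟨l, x, p⟩ | p | q
  · obtain ⟨N, hN⟩ := exists_level X
    have h1 := exp_reproduce_dual L (P := True) (fun a => (B.b 0 0 a : g))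
      (fun a => (B.bd 0 0 a : g)) X (fun n => B.bd_reproduce 0 0 _) (fun h => absurd trivial h) hN
    rw [← h1]
    refine Submodule.sum_mem _ fun a _ => ?_
    have e : ∀ (z : ℂ) (Y : AffineKM g), z • Y = z.re • Y - z.im • (-Complex.I • Y) := by
      intro z Y
      rw [real_smul_eq, real_smul_eq, smul_smul, ← sub_smul, mul_neg, sub_neg_eq_add,
        Complex.re_add_im]
    rw [e]
    refine Submodule.sub_mem _ (Submodule.smul_mem _ _ (Submodule.subset_span ?_))
      (Submodule.smul_mem _ _ (Submodule.subset_span ?_))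
    · exact ⟨⟨.cplx x p false, a⟩, rfl, rfl⟩
    · exact ⟨⟨.cplx x p true, a⟩, rfl, rfl⟩
  · have h := hX (.sr (-l)) ((fixes_real L.ω_prim l x p _).2 (Or.inr rfl))
    rw [slotAct_sr_neg L.isDihedral_t (slotWeight_inv_pow _) (slotWeight_inv_conj _), inv_pow,
        slotWeight_real, inv_inv] at h
    refine Submodule.span_mono ?_ (mem_span_trigDual L (P := True) (mul_inv_cancel₀
      (pow_ne_zero _ L.ω_ne)) (v := fun a => (B.bd l ((p : ℕ) : ZMod T) a : g))
      (b_twist B l p) (kappa_up B _) (kappa_mul B _) h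
      (fun n => B.bd_reproduce _ _ _)
      (fun h => absurd trivial h))
    rintro Y ⟨a, rfl⟩
    exact ⟨⟨.real l x p, a⟩, rfl, rfl⟩
  · have h1 := hX (.r 1) (fixes_zero p _)
    have h2 := hX (.sr 0) (fixes_zero p _)
    rw [slotAct_r_one L.isDihedral_t (slotWeight_inv_pow _) (slotWeight_inv_conj _),
      slotWeight_zero, inv_inv] at h1
    rw [slotAct_sr_zero] at h2
    refine Submodule.span_mono ?_ (inv_eigen_dn B _ X h1 h2)
    rintro Y ⟨a, rfl⟩
    exact ⟨⟨.zero p, a⟩, rfl, rfl⟩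
  · have h1 := hX (.r 1) trivial
    have h2 := hX (.sr 0) trivial
    rw [slotAct_r_one L.isDihedral_t (slotWeight_inv_pow _) (slotWeight_inv_conj _),
      slotWeight_inf, inv_inv] at h1
    rw [slotAct_sr_zero] at h2
    refine Submodule.span_mono ?_ (inv_eigen_dn B _ X h1 h2)
    rintro Y ⟨a, rfl⟩
    exact ⟨⟨.inf q, a⟩, rfl, rfl⟩

end IndexFacts

/-! ### The dual bases of the invariant Takiff vectors and of the invariant differentials. -/

section DualBases

variable {g : Type*} [LieRing g] [LieAlgebra ℂ g] {T : ℕ} [NeZero T] {L : LieData g T}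
  (B : BasisData L) {Z : Divisor T L.ω}

open AffineKM

theorem mem_gD {X : TakD g Z} : X ∈ gD L Z ↔ ∀ (s : Slot Z) (α : DihedralGroup T), Fixes s α →
    slotAct (slotWeight s) L.σt L.τt α (X s) = X s := by
  have key : ∀ (s : Slot Z) (α : DihedralGroup T),
      dihedralAct ((takS L Z).restrictScalars ℝ) (toReal (takT L Z)) α X s =
      slotAct (slotWeight s) L.σt L.τt α (X s) := by
    intro s α
    exact dihedralAct_comm (S := takS L Z) (R := takT L Z) (S' := slotWeight s • L.σt)
      (R' := L.τt) (fun X : TakD g Z => X s) (fun X => rfl) (fun X => rfl) α X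
  constructor
  · intro h s α hα
    rw [← key]
    exact h s α hα
  · intro h s α hα
    rw [key]
    exact h s α hα

theorem tak_same (s : Slot Z) (X : AffineKM g) : (tak s X : TakD g Z) s = X := by
  classical
  exact Pi.single_eq_same (M := fun _ : Slot Z => AffineKM g) s X

theorem tak_ne {s s' : Slot Z} (h : s' ≠ s) (X : AffineKM g) : (tak s X : TakD g Z) s' = 0 := by
  classical
  exact Pi.single_eq_of_ne (M := fun _ : Slot Z => AffineKM g) h X

theorem tak_mem_gD {s : Slot Z} {X : AffineKM g}
    (hX : ∀ α, Fixes s α → slotAct (slotWeight s) L.σt L.τt α X = X) : tak s X ∈ gD L Z := by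
  rw [mem_gD]
  intro s' α hα
  by_cases h : s' = s
  · subst h
    rw [tak_same]
    exact hX α hα
  · rw [tak_ne h, map_zero]

theorem upVec_invariant (i : FIdx Z) (a : ModeIdx (dimOf B i) (hasKD i)) (α : DihedralGroup T)
    (hα : Fixes (slotOf i) α) :
    slotAct (slotWeight (slotOf i)) L.σt L.τt α (upVec B i a) = upVec B i a := by
  rcases i with ⟨x, p, c⟩ | i
  · rw [(fixes_cplx L.ω_prim x p c α).1 hα]
    exact slotAct_one _ _ _ _
  · exact upVec_fixed B i a hα

variable (Z) in
/-- The vectors `takVec` as elements of `g̃^D`. -/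
def gDVec (A : Idx B Z) : gD L Z := ⟨takVec B A, tak_mem_gD (upVec_invariant B A.1 A.2)⟩

theorem diffAvg_complex {ω : ℂ} (h0 : ω ≠ 0) {V : Type*} [AddCommGroup V] [Module ℂ V]
    (S : V →ₗ[ℂ] V) (R : V →ₛₗ[starRingEnd ℂ] V) (φ : V ⊗[ℂ] RatFunc ℂ) :
    diffAvg (T := T) h0 S R φ =
      (1 / (2 * T) : ℂ) • ∑ α : DihedralGroup T, diffAct h0 S R α φ := by
  rw [diffAvg_apply]
  refine (real_smul_eq _ _).trans ?_
  congr 1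
  push_cast
  rfl

theorem mem_OmegaPiD {φ : AffineKM g ⊗[ℂ] RatFunc ℂ} : φ ∈ OmegaPiD L Z ↔
    φ ∈ omegaOf Z (⊤ : Submodule ℂ (AffineKM g)) ∧
      ∀ α : DihedralGroup T, diffAct L.ω_ne L.σt L.τt α φ = φ := by
  unfold OmegaPiD
  rw [Submodule.mem_inf, Submodule.mem_iInf]
  rfl

/-- The invariant differential obtained by averaging a polar part. -/
def avgDiff (s : Slot Z) : AffineKM g →ₗ[ℝ] OmegaPiD L Z where
  toFun v := ⟨diffAvg (T := T) L.ω_ne L.σt L.τt (v ⊗ₜ[ℂ] slotDiff s 1),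
    mem_OmegaPiD.2 ⟨diffAvg_slotDiff_mem L.ω_prim L.ω_ne (⊤ : Submodule ℂ (AffineKM g)) (fun _ _ => trivial)
      (fun _ _ => trivial) trivial s, fun α => act_diffAvg L.ω_prim L.ω_ne L.isDihedral_t α _⟩⟩
  map_add' v w := Subtype.ext (by
    change diffAvg _ _ _ _ = diffAvg _ _ _ _ + diffAvg _ _ _ _
    rw [TensorProduct.add_tmul, map_add])
  map_smul' r v := Subtype.ext (by
    change diffAvg _ _ _ _ = r • diffAvg _ _ _ _
    rw [← map_smul]
    rfl)

theorem avgDiff_coe (s : Slot Z) (v : AffineKM g) : (avgDiff (L := L) s v).1 =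
    diffAvg (T := T) L.ω_ne L.σt L.τt (v ⊗ₜ[ℂ] slotDiff s 1) := rfl

theorem slotPairing_tmul (s : Slot Z) (Y v : AffineKM g) (f : RatFunc ℂ) :
    slotPairing L s Y (v ⊗ₜ[ℂ] f) = L.kmForm v Y * slotRes s f := rfl

/-- Only stabiliser elements have a residue at the slot, and by invariance of `X` each contributes
Re (v | X_s). Their number cancels against the weight 2T/|Π_x| and the factor 1/(2T). -/
theorem pairing_avgDiff (s : Slot Z) (v : AffineKM g) (X : gD L Z) :
    pairing L Z (avgDiff s v) X = (L.kmForm v (X.1 s)).re := by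
  classical
  have hT : (T : ℝ) ≠ 0 := Nat.cast_ne_zero.2 (NeZero.ne T)
  have key : ∀ s' : Slot Z, slotPairing L s' (X.1 s') (avgDiff (L := L) s v).1 =
      (1 / (2 * T) : ℝ) * ∑ α : DihedralGroup T, if s' = s ∧ Fixes s α then
        L.kmForm (slotAct (slotWeight s)⁻¹ L.σt L.τt α v) (X.1 s) else 0 := by
    intro s'
    rw [avgDiff_coe, diffAvg_complex, map_smul, map_sum, smul_eq_mul]
    push_cast
    congr 1
    refine Finset.sum_congr rfl fun α _ => ?_
    rw [diffAct_slotDiff, slotPairing_tmul]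
    split_ifs with h
    · obtain ⟨rfl, h⟩ := h
      rw [slotRes_slotDiff_self h, mul_one]
    · rw [slotRes_slotDiff_of_not h, mul_zero]
  unfold pairing
  rw [Finset.sum_eq_single s]
  · rw [key, Complex.re_ofReal_mul, Complex.re_sum]
    -- Replacing X_s by its translate under α makes both arguments move together, so
    -- `kmForm_slotAct` removes α.
    have e : ∀ α : DihedralGroup T, (if s = s ∧ Fixes s α then
        L.kmForm (slotAct (slotWeight s)⁻¹ L.σt L.τt α v) (X.1 s) else 0).re =
        if Fixes s α then (L.kmForm v (X.1 s)).re else 0 := by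
      intro α
      by_cases h : Fixes s α
      · rw [if_pos ⟨rfl, h⟩, if_pos h]
        conv_lhs => rw [← mem_gD.1 X.2 s α h]
        exact kmForm_slotAct L (slotWeight_ne L.ω_prim s) α v _
      · rw [if_neg (fun h' => h h'.2), if_neg h]; rfl
    rw [Finset.sum_congr rfl fun α _ => e α, ← Finset.sum_filter, Finset.sum_const, nsmul_eq_mul, Nat.card_eq_fintype_card,
      Fintype.card_subtype]
    have hc : ((Finset.univ.filter fun α : DihedralGroup T => Fixes s α).card : ℝ) ≠ 0 := by
      refine Nat.cast_ne_zero.2 (Finset.card_ne_zero.2 ⟨1, ?_⟩)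
      exact Finset.mem_filter.2 ⟨Finset.mem_univ _, fixes_one s⟩
    field_simp
  · intro s' _ hs'
    rw [key]
    simp [hs']
  · exact fun h => absurd (Finset.mem_univ _) h

theorem avgDiff_slotAct {s : Slot Z} {β : DihedralGroup T} (h : Fixes s β) (v : AffineKM g) :
    avgDiff (L := L) s (slotAct (slotWeight s)⁻¹ L.σt L.τt β v) = avgDiff s v := by
  refine Subtype.ext ?_
  rw [avgDiff_coe, avgDiff_coe, ← diffAvg_act L.ω_prim L.ω_ne L.isDihedral_t β (v ⊗ₜ slotDiff s 1),
    diffAct_slotDiff, slotDiff_fixes h]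

theorem fixes_mul {s : Slot Z} {α β : DihedralGroup T} (hα : Fixes s α) (hβ : Fixes s β) :
    Fixes s (α * β) := by
  cases s with
  | inl s =>
    change mob L.ω (α * β) (s.1 : ℂ) = s.1
    rw [mob_mul L.ω_prim, show mob L.ω β (s.1 : ℂ) = s.1 from hβ]
    exact hα
  | inr q => trivial

theorem fixes_inv {s : Slot Z} {α : DihedralGroup T} (hα : Fixes s α) : Fixes s α⁻¹ := by
  cases s with
  | inl s => exact mob_inv_eq L.ω_prim hα
  | inr q => trivial

variable (Z) in
/-- The dual basis of the space of invariant differentials. -/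
def dualDiff (A : Idx B Z) : OmegaPiD L Z := avgDiff (slotOf A.1) (dualVec B A.1 A.2)

/-- `avgDiff` does not see the difference between v and its translates under the stabiliser, so v
may be replaced by an invariant vector, which lies in the span of the dual vectors. -/
theorem avgDiff_mem_span (s : Slot Z) (v : AffineKM g) :
    avgDiff (L := L) s v ∈ Submodule.span ℝ (Set.range (dualDiff B Z)) := by
  classical
  let G := Finset.univ.filter fun α : DihedralGroup T => Fixes s α
  have hG : ∀ α, α ∈ G ↔ Fixes s α := fun α => by simp [G]
  have hc : (G.card : ℝ) ≠ 0 :=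
    Nat.cast_ne_zero.2 (Finset.card_ne_zero.2 ⟨1, (hG 1).2 (fixes_one s)⟩)
  -- The sum over the stabiliser, not normalised; the order of the stabiliser is divided out at the
  -- very end.
  let v' : AffineKM g := ∑ α ∈ G, slotAct (slotWeight s)⁻¹ L.σt L.τt α v
  have h1 : avgDiff (L := L) s v' = (G.card : ℝ) • avgDiff s v := by
    rw [map_sum, Finset.sum_congr rfl fun α hα => avgDiff_slotAct ((hG α).1 hα) v,
      Finset.sum_const, Nat.cast_smul_eq_nsmul]
  have h2 : ∀ α, Fixes s α → slotAct (slotWeight s)⁻¹ L.σt L.τt α v' = v' := by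
    intro α hα
    have hm := (L.isDihedral_t.smul (slotWeight_inv_pow s) (slotWeight_inv_conj s)).mul α
    rw [map_sum]
    refine Finset.sum_nbij' (fun β => α * β) (fun β => α⁻¹ * β) ?_ ?_ ?_ ?_ ?_
    · exact fun β hβ => (hG _).2 (fixes_mul hα ((hG _).1 hβ))
    · exact fun β hβ => (hG _).2 (fixes_mul (fixes_inv hα) ((hG _).1 hβ))
    · intros; simp
    · intros; simp
    · intro β _
      exact (hm β v).symm
  have h3 := mem_span_dualVec B s v' h2
  have h4 : avgDiff (L := L) s v' ∈ Submodule.span ℝ (Set.range (dualDiff B Z)) := by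
    have := Submodule.mem_map_of_mem (f := avgDiff (L := L) s) h3
    rw [Submodule.map_span] at this
    refine Submodule.span_mono ?_ this
    rintro _ ⟨_, ⟨A, rfl, rfl⟩, rfl⟩
    exact ⟨A, rfl⟩
  rw [h1] at h4
  exact (Submodule.smul_mem_iff _ hc).1 h4

/-- An invariant differential equals its own average, so it suffices to average the partial
fractions. -/
theorem span_dualDiff : ⊤ ≤ Submodule.span ℝ (Set.range (dualDiff B Z)) := by
  rintro ⟨φ, hφ⟩ -
  obtain ⟨h1, h2⟩ := mem_OmegaPiD.1 hφ
  set U := (Submodule.span ℝ (Set.range (dualDiff B Z))).map (OmegaPiD L Z).subtype with hU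
  suffices h : φ ∈ U by
    obtain ⟨ψ, hψ, e⟩ := h
    have : ψ = ⟨φ, hφ⟩ := Subtype.ext e
    exact this ▸ hψ
  have h3 : ∀ ψ ∈ omegaOf Z (⊤ : Submodule ℂ (AffineKM g)),
      diffAvg (T := T) L.ω_ne L.σt L.τt ψ ∈ U := by
    have hle : omegaOf Z (⊤ : Submodule ℂ (AffineKM g)) ≤ Submodule.span ℂ (Set.image2
        (fun v f => v ⊗ₜ[ℂ] f) Set.univ
        (Set.range fun a : Slot Z × DihedralGroup T => slotDiff a.1 a.2)) := by
      refine (Submodule.map₂_le_map₂ (le_of_eq Submodule.span_univ.symm)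
        (OmegaD_le_span L.ω_prim)).trans ?_
      rw [Submodule.map₂_span_span]
      exact le_rfl
    intro ψ hψ
    -- `diffAvg` is only real linear, so complex scalars are kept inside the generators, where the
    -- coefficient v absorbs them.
    refine Submodule.closure_induction (p := fun ψ _ => diffAvg (T := T) L.ω_ne L.σt L.τt ψ ∈ U)
      ?_ ?_ ?_ (hle hψ)
    · rw [map_zero]; exact Submodule.zero_mem _
    · intro x y _ _ hx hy
      rw [map_add]; exact Submodule.add_mem _ hx hy
    · rintro c _ ⟨v, -, _, ⟨⟨s, α⟩, rfl⟩, rfl⟩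
      -- Each polar part at αx is the α-translate of one at x, which the average does not
      -- distinguish.
      have e : c • (v ⊗ₜ[ℂ] slotDiff s α) = diffAct L.ω_ne L.σt L.τt α
          ((slotAct (slotWeight s)⁻¹ L.σt L.τt α⁻¹ (c • v)) ⊗ₜ[ℂ] slotDiff s 1) := by
        have hm := (L.isDihedral_t.smul (slotWeight_inv_pow s) (slotWeight_inv_conj s)).mul α α⁻¹
        rw [diffAct_slotDiff]
        have h5 := hm (c • v)
        rw [mul_inv_cancel, dihedralAct_one] at h5
        exact congrArg (· ⊗ₜ[ℂ] slotDiff s α) h5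
      dsimp only
      rw [e, diffAvg_act L.ω_prim L.ω_ne L.isDihedral_t]
      exact ⟨_, avgDiff_mem_span B s _, rfl⟩
  rw [← diffAvg_of_fixed L.ω_ne h2]
  exact h3 φ h1

theorem span_gDVec : ⊤ ≤ Submodule.span ℝ (Set.range (gDVec B Z)) := by
  classical
  rintro ⟨X, hX⟩ -
  set U := (Submodule.span ℝ (Set.range (gDVec B Z))).map (gD L Z).subtype with hU
  suffices h : X ∈ U by
    obtain ⟨Y, hY, e⟩ := h
    have : Y = ⟨X, hX⟩ := Subtype.ext e
    exact this ▸ hY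
  have e : X = ∑ s, tak s (X s) := by
    refine (Finset.univ_sum_single X).symm.trans ?_
    exact Finset.sum_congr rfl fun s _ => rfl
  rw [e]
  refine Submodule.sum_mem _ fun s _ => ?_
  have h1 := mem_span_upVec B s (X s) (mem_gD.1 hX s)
  have h2 := Submodule.mem_map_of_mem (f := (tak s : AffineKM g →ₗ[ℂ] TakD g Z).restrictScalars ℝ) h1
  rw [Submodule.map_span] at h2
  rw [hU, Submodule.map_span]
  refine Submodule.span_mono ?_ h2
  rintro _ ⟨_, ⟨A, rfl, rfl⟩, rfl⟩
  exact ⟨_, ⟨A, rfl⟩, rfl⟩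

theorem pairing_dual (A A' : Idx B Z) [Decidable (A = A')] :
    pairing L Z (dualDiff B Z A) (gDVec B Z A') = if A = A' then 1 else 0 := by
  unfold dualDiff
  rw [pairing_avgDiff]
  change (L.kmForm _ ((tak (slotOf A'.1) (upVec B A'.1 A'.2) : TakD g Z) (slotOf A.1))).re = _
  by_cases h : slotOf A.1 = slotOf A'.1
  · rw [h, tak_same]
    exact dual_pair B A A' h
  · rw [tak_ne h, map_zero, if_neg (fun h' => h (by rw [h']))]
    rfl

theorem pairing_sum_left {ι : Type*} (s : Finset ι) (c : ι → ℝ) (φ : ι → OmegaPiD L Z)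
    (X : gD L Z) : pairing L Z (∑ i ∈ s, c i • φ i) X = ∑ i ∈ s, c i * pairing L Z (φ i) X := by
  unfold pairing
  simp only [Finset.mul_sum]
  rw [Finset.sum_comm]
  refine Finset.sum_congr rfl fun t _ => ?_
  have e : (∑ i ∈ s, c i • φ i : OmegaPiD L Z).1 = ∑ i ∈ s, (c i : ℂ) • (φ i).1 := by
    refine (map_sum (OmegaPiD L Z).subtype _ _).trans (Finset.sum_congr rfl fun i _ => ?_)
    exact real_smul_eq (c i) (φ i).1
  rw [e, map_sum, Complex.re_sum, Finset.mul_sum]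
  refine Finset.sum_congr rfl fun i _ => ?_
  rw [map_smul, smul_eq_mul, Complex.re_ofReal_mul]
  ring

theorem pairing_sum_right {ι : Type*} (s : Finset ι) (c : ι → ℝ) (φ : OmegaPiD L Z)
    (X : ι → gD L Z) : pairing L Z φ (∑ i ∈ s, c i • X i) = ∑ i ∈ s, c i * pairing L Z φ (X i) := by
  unfold pairing
  simp only [Finset.mul_sum]
  rw [Finset.sum_comm]
  refine Finset.sum_congr rfl fun t _ => ?_
  have e : (∑ i ∈ s, c i • X i : gD L Z).1 t = ∑ i ∈ s, (c i : ℂ) • (X i).1 t := by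
    have h := map_sum (gD L Z).subtype (fun i => c i • X i) s
    refine (congrFun h t).trans ?_
    rw [Finset.sum_apply]
    refine Finset.sum_congr rfl fun i _ => ?_
    exact real_smul_eq (c i) ((X i).1 t)
  have hlin : ∀ ψ, slotPairing L t (∑ i ∈ s, (c i : ℂ) • (X i).1 t) ψ =
      ∑ i ∈ s, (c i : ℂ) * slotPairing L t ((X i).1 t) ψ := by
    intro ψ
    induction ψ using TensorProduct.induction_on with
    | zero => simp
    | tmul v f =>
      simp only [slotPairing_tmul, map_sum, map_smul, smul_eq_mul, Finset.sum_mul, mul_assoc]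
    | add x y hx hy => simp only [map_add, hx, hy, mul_add, Finset.sum_add_distrib]
  rw [e, hlin, Complex.re_sum, Finset.mul_sum]
  refine Finset.sum_congr rfl fun i _ => ?_
  rw [Complex.re_ofReal_mul]
  ring

/-- Pairing a relation with a dual vector isolates each coefficient. -/
theorem linearIndependent_dualDiff : LinearIndependent ℝ (dualDiff B Z) := by
  classical
  rw [linearIndependent_iff']
  intro s c h A hA
  have := pairing_sum_left s c (dualDiff B Z) (gDVec B Z A)
  rw [h, Finset.sum_eq_single A, pairing_dual, if_pos rfl, mul_one] at this
  · rw [← this]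
    simp [pairing]
  · intro A' _ hA'
    rw [pairing_dual, if_neg hA', mul_zero]
  · exact fun h => absurd hA h

theorem linearIndependent_gDVec : LinearIndependent ℝ (gDVec B Z) := by
  classical
  rw [linearIndependent_iff']
  intro s c h A hA
  have := pairing_sum_right s c (dualDiff B Z A) (gDVec B Z)
  rw [h, Finset.sum_eq_single A, pairing_dual, if_pos rfl, mul_one] at this
  · rw [← this]
    have := pairing_sum_right ∅ c (dualDiff B Z A) (gDVec B Z)
    simpa using this
  · intro A' _ hA'
    rw [pairing_dual, if_neg hA'.symm, mul_zero]
  · exact fun h => absurd hA h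

variable (Z) in
/-- The basis of `g̃^D`. -/
def gDBasis : Module.Basis (Idx B Z) ℝ (gD L Z) :=
  Module.Basis.mk (linearIndependent_gDVec B) (span_gDVec B)

variable (Z) in
/-- The dual basis of the space of invariant differentials. -/
def dualBasis : Module.Basis (Idx B Z) ℝ (OmegaPiD L Z) :=
  Module.Basis.mk (linearIndependent_dualDiff B) (span_dualDiff B)

theorem gDBasis_apply (A : Idx B Z) : gDBasis B Z A = gDVec B Z A := Module.Basis.mk_apply _ _ A

theorem dualBasis_apply (A : Idx B Z) : dualBasis B Z A = dualDiff B Z A :=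
  Module.Basis.mk_apply _ _ A

end DualBases

/-! ### Monotonicity of the filtrations and membership of single modes. -/

section Filtrations

variable {g : Type*} [LieRing g] [LieAlgebra ℂ g] {T : ℕ} (L : LieData g T)

open AffineKM

theorem Fpos_antitone : Antitone (Fpos g) := fun _ _ h _ hX =>
  ⟨fun k hk => hX.1 k (hk.trans_le (by exact_mod_cast h)), hX.2⟩

theorem Fneg_antitone : Antitone (Fneg g) := fun _ _ h _ hX =>
  ⟨fun k hk => hX.1 k ((neg_le_neg (by exact_mod_cast h)).trans_lt hk), hX.2⟩

theorem mode_mem_Fpos (x : g) (n : ℕ) : mode x n ∈ Fpos g n := by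
  refine ⟨fun m hm => ?_, kPart_mode _ _, dPart_mode _ _⟩
  rw [loopPart_mode, if_neg hm.ne']

theorem mode_mem_Fneg (x : g) (n : ℕ) : mode x (-n) ∈ Fneg g n := by
  refine ⟨fun m hm => ?_, kPart_mode _ _, dPart_mode _ _⟩
  rw [loopPart_mode, if_neg hm.ne]

theorem fieldFil_antitone {W : Type*} [AddCommGroup W] [Module ℝ W]
    {Fil : ℕ → Submodule ℂ (ℂ ⊗[ℝ] W)} (h : Antitone Fil) : Antitone (fieldFil g Fil) :=
  fun _ _ hnm => sup_le_sup
    (Submodule.map₂_le_map₂ (Fpos_antitone hnm) (Submodule.map_mono (h hnm)))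
    (Submodule.map₂_le_map₂ (Fneg_antitone hnm) (h hnm))

theorem takFil_antitone {ω : ℂ} (Z : Divisor T ω) : Antitone (takFil g Z) := by
  refine fun n m h => Submodule.span_mono (Set.union_subset_union ?_ ?_)
  · rintro _ ⟨s, X, hX, rfl⟩
    exact ⟨s, X, Fpos_antitone h hX, rfl⟩
  · rintro _ ⟨s, X, hX, rfl⟩
    exact ⟨s, X, Fneg_antitone h hX, rfl⟩

theorem gDFil_antitone (Z : Divisor T L.ω) : Antitone (gDFil L Z) := by
  refine fun n m h => Submodule.comap_mono (Submodule.span_mono ?_)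
  rintro v ((((⟨x, p, X, hx, hX, rfl⟩ | ⟨x, p, X, hx, hX, rfl⟩) | ⟨k, x, p, X, hx, hX, rfl⟩) |
    ⟨x, p, X, hx, hX, h1, rfl⟩) | ⟨q, X, hX, h1, rfl⟩)
  · exact .inl (.inl (.inl (.inl ⟨x, p, X, hx, Fpos_antitone h hX, rfl⟩)))
  · exact .inl (.inl (.inl (.inr ⟨x, p, X, hx, Fneg_antitone h hX, rfl⟩)))
  · exact .inl (.inl (.inr ⟨k, x, p, X, hx, Fpos_antitone h hX, rfl⟩))
  · exact .inl (.inr ⟨x, p, X, hx, Fpos_antitone h hX, h1, rfl⟩)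
  · exact .inr ⟨q, X, Fpos_antitone h hX, h1, rfl⟩

theorem omegaOf_mono {ω : ℂ} (Z : Divisor T ω) {V : Type*} [AddCommGroup V] [Module ℂ V]
    {E E' : Submodule ℂ V} (h : E ≤ E') : omegaOf Z E ≤ omegaOf Z E' :=
  Submodule.map₂_le_map₂ h le_rfl

theorem zetaFil_antitone [NeZero T] (Z : Divisor T L.ω) : Antitone (zetaFil L Z) :=
  fun _ _ h => Submodule.comap_mono (omegaOf_mono Z (fieldFil_antitone (gDFil_antitone L Z) h))

variable {W : Type*} [AddCommGroup W] [Module ℝ W]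

theorem neg_tmul_mem_fieldFil {Fil : ℕ → Submodule ℂ (ℂ ⊗[ℝ] W)} {n : ℕ} (v : g)
    {w : ℂ ⊗[ℝ] W} (hw : w ∈ Fil n) : mode v (-n) ⊗ₜ[ℂ] w ∈ fieldFil g Fil n :=
  Submodule.mem_sup_right (Submodule.apply_mem_map₂ _ (mode_mem_Fneg v n) hw)

theorem pos_tmul_mem_fieldFil {Fil : ℕ → Submodule ℂ (ℂ ⊗[ℝ] W)} {n : ℕ} (v : g)
    {w : ℂ ⊗[ℝ] W} (hw : conjC w ∈ Fil n) : mode v n ⊗ₜ[ℂ] w ∈ fieldFil g Fil n := by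
  refine Submodule.mem_sup_left (Submodule.apply_mem_map₂ _ (mode_mem_Fpos v n) ?_)
  exact ⟨_, hw, conjC_conjC w⟩

end Filtrations

/-! ### Convergence of the formal fields. -/

section Convergence

variable {g : Type*} [LieRing g] [LieAlgebra ℂ g] {T : ℕ} {L : LieData g T}
  (B : BasisData L) {Z : Divisor T L.ω}

open AffineKM

variable (L Z) in
/-- The complexified inclusion of `g̃^D` in the Takiff algebra. -/
abbrev gDIncl : ℂ ⊗[ℝ] gD L Z →ₗ[ℂ] ℂ ⊗[ℝ] TakD g Z := (gD L Z).subtype.baseChange ℂ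

theorem gDIncl_tmul (z : ℂ) (X : gD L Z) : gDIncl L Z (z ⊗ₜ[ℝ] X) = z ⊗ₜ[ℝ] X.1 := rfl

theorem gDIncl_conjC (w : ℂ ⊗[ℝ] gD L Z) : gDIncl L Z (conjC w) = conjC (gDIncl L Z w) := by
  induction w using TensorProduct.induction_on with
  | zero => simp
  | tmul z w => rfl
  | add u v hu hv => simp only [map_add, hu, hv]

theorem mem_gDFil {w : ℂ ⊗[ℝ] gD L Z} {n : ℕ} :
    w ∈ gDFil L Z n ↔ gDIncl L Z w ∈ Submodule.span ℂ (gDGen L Z n) := Iff.rfl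

theorem tmul_tak_real {ω : ℂ} {Z : Divisor T ω} (s : Slot Z) (z : ℂ) (r : ℝ) (X : AffineKM g) :
    z ⊗ₜ[ℝ] (tak s ((r : ℂ) • X) : TakD g Z) = (r : ℂ) • (z ⊗ₜ[ℝ] tak s X) := by
  have e : (tak s ((r : ℂ) • X) : TakD g Z) = r • tak s X := by
    rw [map_smul, Complex.coe_smul]
  rw [e, TensorProduct.tmul_smul, TensorProduct.smul_tmul', TensorProduct.smul_tmul',
    Complex.real_smul, smul_eq_mul]

theorem I_tmul {W : Type*} [AddCommGroup W] [Module ℝ W] (w : W) :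
    Complex.I ⊗ₜ[ℝ] w = Complex.I • ((1 : ℂ) ⊗ₜ[ℝ] w) := by
  rw [TensorProduct.smul_tmul', smul_eq_mul, mul_one]

theorem inv_sqrt_two_sq : (1 / (Real.sqrt 2 : ℂ)) * (1 / (Real.sqrt 2 : ℂ)) = 1 / 2 := by
  rw [div_mul_div_comm, sqrt_two_mul, one_mul]

/-- The cosine and sine terms of one level regroup as v_n ⊗ c(w) + v_{-n} ⊗ w, and `h` says that w
lies in the n-th step: exactly the two summands of `fieldFil`. -/
theorem trig_pair_mem {d : ℕ} (u v : Fin d → g) (a : Fin d) {n : ℕ} (hn : 0 < (n : ℤ))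
    {s : Slot Z} {U U' : gD L Z} (hU : U.1 = tak s (trigMode u a n))
    (hU' : U'.1 = tak s (trigMode u a (-n)))
    (h : invVec g s (mode (u a) n) (mode (u a) (-n)) ∈ Submodule.span ℂ (gDGen L Z n)) :
    trigMode v a n ⊗ₜ[ℂ] ((1 : ℂ) ⊗ₜ[ℝ] U) + trigMode v a (-n) ⊗ₜ[ℂ] ((1 : ℂ) ⊗ₜ[ℝ] U') ∈
      fieldFil g (gDFil L Z) n := by
  -- w = (U - iU')/√2 is the coefficient of v_{-n}, and its conjugate is that of v_n.
  set w : ℂ ⊗[ℝ] gD L Z := (1 / (Real.sqrt 2 : ℂ)) •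
    ((1 : ℂ) ⊗ₜ[ℝ] U - Complex.I ⊗ₜ[ℝ] U') with hw
  have e : gDIncl L Z w = invVec g s (mode (u a) n) (mode (u a) (-n)) := by
    rw [hw, map_smul, map_sub, gDIncl_tmul, gDIncl_tmul, hU, hU', trigMode_pos u a hn,
      trigMode_neg u a hn]
    unfold invVec
    have h1 : (1 / (Real.sqrt 2 : ℂ)) = ((1 / Real.sqrt 2 : ℝ) : ℂ) := by push_cast; rfl
    have h2 : (1 / 2 : ℂ) = ((1 / 2 : ℝ) : ℂ) := by push_cast; rfl
    rw [div_eq_mul_one_div Complex.I, mul_comm Complex.I, mul_smul, h1, tmul_tak_real,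
      tmul_tak_real, smul_comm Complex.I, h2, tmul_tak_real, tmul_tak_real, ← smul_sub,
      ← smul_sub, smul_smul, ← h1, inv_sqrt_two_sq, h2]
  have hc : conjC w = (1 / (Real.sqrt 2 : ℂ)) •
      ((1 : ℂ) ⊗ₜ[ℝ] U + Complex.I ⊗ₜ[ℝ] U') := by
    rw [hw, conjC.map_smulₛₗ, map_sub, conjC_tmul, conjC_tmul]
    simp [TensorProduct.neg_tmul]
  have e2 : trigMode v a n ⊗ₜ[ℂ] ((1 : ℂ) ⊗ₜ[ℝ] U) + trigMode v a (-n) ⊗ₜ[ℂ] ((1 : ℂ) ⊗ₜ[ℝ] U') =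
      mode (v a) n ⊗ₜ[ℂ] conjC w + mode (v a) (-n) ⊗ₜ[ℂ] w := by
    rw [hc, hw, trigMode_pos v a hn, trigMode_neg v a hn, I_tmul]
    simp only [TensorProduct.add_tmul, TensorProduct.sub_tmul, ← TensorProduct.smul_tmul',
      TensorProduct.tmul_add, TensorProduct.tmul_sub, TensorProduct.tmul_smul]
    module
  rw [e2]
  refine add_mem (pos_tmul_mem_fieldFil _ ?_) (neg_tmul_mem_fieldFil _ ?_)
  · rw [conjC_conjC, mem_gDFil, e]; exact h
  · rw [mem_gDFil, e]; exact h

/-- The second tensor factor of the field at a complex point. -/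
def cplxFactor [NeZero T] (x : {x : ℂ // x ∈ Z.cplxPts}) (p : Fin (Z.n x)) (a : ModeIdx B.d True) :
    ℂ ⊗[ℝ] gD L Z :=
  (1 / 2 : ℂ) • ((1 : ℂ) ⊗ₜ[ℝ] gDVec B Z ⟨.cplx x p false, a⟩ -
    Complex.I ⊗ₜ[ℝ] gDVec B Z ⟨.cplx x p true, a⟩)

variable [NeZero T]

theorem gDIncl_cplxFactor (x : {x : ℂ // x ∈ Z.cplxPts}) (p : Fin (Z.n x))
    (a : ModeIdx B.d True) : gDIncl L Z (cplxFactor B x p a) =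
      cplxVec g (slotOf (.cplx x p false)) (expVec (fun a => (B.b 0 0 a : g)) a) := rfl

theorem fieldTerm_false (x : {x : ℂ // x ∈ Z.cplxPts}) (p : Fin (Z.n x)) (a : ModeIdx B.d True) :
    fieldTerm B (gDVec B Z) (.cplx x p false) a =
      expDual (fun a => (B.bd 0 0 a : g)) a ⊗ₜ[ℂ] cplxFactor B x p a := rfl

/-- The field at a conjugate point is the image of the field at x under t, so its convergence and
its place in the average come for free. -/
theorem fieldTerm_true (x : {x : ℂ // x ∈ Z.cplxPts}) (p : Fin (Z.n x)) (a : ModeIdx B.d True) :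
    fieldTerm B (gDVec B Z) (.cplx x p true) a =
      fieldT L (fieldTerm B (gDVec B Z) (.cplx x p false) a) := by
  rw [fieldTerm_false]
  change _ = L.τt _ ⊗ₜ[ℂ] conjC (cplxFactor B x p a)
  unfold cplxFactor
  rw [conjC.map_smulₛₗ, map_sub, conjC_tmul, conjC_tmul, conj_half, map_one, Complex.conj_I,
    TensorProduct.neg_tmul, sub_neg_eq_add]
  rfl

theorem fieldSum_true (x : {x : ℂ // x ∈ Z.cplxPts}) (p : Fin (Z.n x)) (N : ℕ) :
    fieldSum B (gDVec B Z) (.cplx x p true) N =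
      fieldT L (fieldSum B (gDVec B Z) (.cplx x p false) N) := by
  unfold fieldSum
  rw [map_sum]
  exact Finset.sum_congr rfl fun a _ => fieldTerm_true B x p a

theorem fieldSum_false_succ (x : {x : ℂ // x ∈ Z.cplxPts}) (p : Fin (Z.n x)) {N : ℕ} (hN : 1 ≤ N) :
    fieldSum B (gDVec B Z) (.cplx x p false) (N + 1) -
      fieldSum B (gDVec B Z) (.cplx x p false) N ∈ fieldFil g (gDFil L Z) N := by
  refine (sum_modes_succ (fieldTerm B (gDVec B Z) (.cplx x p false)) hN).symm ▸
    Submodule.sum_mem _ fun a _ => ?_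
  change mode (B.bd 0 0 a : g) (-(N : ℤ)) ⊗ₜ[ℂ] cplxFactor B x p (.loop a N) +
    mode (B.bd 0 0 a : g) (-(-(N : ℤ))) ⊗ₜ[ℂ] cplxFactor B x p (.loop a (-N)) ∈ _
  rw [neg_neg]
  refine add_mem (neg_tmul_mem_fieldFil _ ?_) ?_
  · rw [mem_gDFil, gDIncl_cplxFactor]
    exact Submodule.subset_span (.inl (.inl (.inl (.inl
      ⟨⟨x, Z.mem_of_cplx x.2⟩, p, _, x.2, mode_mem_Fpos _ N, rfl⟩))))
  · refine pos_tmul_mem_fieldFil _ ?_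
    rw [mem_gDFil, gDIncl_conjC, gDIncl_cplxFactor]
    exact Submodule.subset_span (.inl (.inl (.inl (.inr
      ⟨⟨x, Z.mem_of_cplx x.2⟩, p, _, x.2, mode_mem_Fneg _ N, rfl⟩))))

theorem σt_mode_c (j : ZMod T) (a : Fin (B.m j)) (n : ℤ) :
    L.σt (mode (B.c j a : g) n) = L.ω ^ j.val • mode (B.c j a : g) n := by
  rw [σt_mode, c_eigen, mode_smul]

/-- The two terms of level N lie in the N-th step of the filtration; the generators of `gDFil` have
precisely the shape produced by `trig_pair_mem`. -/
theorem fieldSum_succ (i : FIdx Z) {N : ℕ} (hN : 1 ≤ N) :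
    fieldSum B (gDVec B Z) i (N + 1) - fieldSum B (gDVec B Z) i N ∈
      fieldFil g (gDFil L Z) N := by
  have hN' : 0 < (N : ℤ) := by exact_mod_cast hN
  rcases i with ⟨x, p, _ | _⟩ | ⟨k, x, p⟩ | p | q
  · exact fieldSum_false_succ B x p hN
  · have h1 := fieldSum_true B x p N
    have h2 := fieldSum_true B x p (N + 1)
    change fieldSum B (gDVec B Z) (.cplx x p true) (N + 1) -
      fieldSum B (gDVec B Z) (.cplx x p true) N ∈ _
    rw [h1, h2, ← map_sub]
    exact fieldFil_le_fieldT L _ N (fieldSum_false_succ B x p hN)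
  · refine (sum_modes_succ (fieldTerm B (gDVec B Z) (.real k x p)) hN).symm ▸
      Submodule.sum_mem _ fun a _ => ?_
    refine trig_pair_mem (fun a => (B.b k ((p : ℕ) : ZMod T) a : g))
      (fun a => (B.bd k ((p : ℕ) : ZMod T) a : g)) a hN' rfl rfl ?_
    refine Submodule.subset_span (.inl (.inl (.inr
      ⟨k, ⟨x, Z.mem_of_real x.2⟩, p, mode (B.b k ((p : ℕ) : ZMod T) a : g) N, x.2, mode_mem_Fpos _ N, ?_⟩)))
    -- The conjugation defining the real form sends u_N to u_{-N}, which identifies the second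
    -- argument of `invVec`.
    rw [← twist_apply, twist_mode L (b_twist B k p a)]
    rfl
  · refine (sum_modes_succ (fieldTerm B (gDVec B Z) (.zero p)) hN).symm ▸
      Submodule.sum_mem _ fun a _ => ?_
    refine trig_pair_mem (fun a => (B.c ((p : ℕ) : ZMod T) a : g))
      (fun a => (B.cd ((p : ℕ) : ZMod T) a : g)) a hN' rfl rfl ?_
    refine Submodule.subset_span (.inl (.inr
      ⟨⟨0, Z.zero_mem p⟩, p, mode (B.c ((p : ℕ) : ZMod T) a : g) N, rfl, mode_mem_Fpos _ N, ?_, ?_⟩))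
    · exact (σt_mode_c B _ a N).trans (by rw [omega_pow_val])
    · rw [← twist_one, twist_mode L (c_twist B _ a)]
      rfl
  · refine (sum_modes_succ (fieldTerm B (gDVec B Z) (.inf q)) hN).symm ▸
      Submodule.sum_mem _ fun a _ => ?_
    refine trig_pair_mem (fun a => (B.c (-(((q : ℕ) + 1 : ℕ) : ZMod T)) a : g))
      (fun a => (B.cd (-(((q : ℕ) + 1 : ℕ) : ZMod T)) a : g)) a hN' rfl rfl ?_
    refine Submodule.subset_span (.inr ⟨q, mode (B.c (-(((q : ℕ) + 1 : ℕ) : ZMod T)) a : g) N,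
      mode_mem_Fpos _ N, ?_, ?_⟩)
    · exact (σt_mode_c B _ a N).trans (by rw [omega_pow_val_neg, omega_pow_val])
    · rw [← twist_one, twist_mode L (c_twist B _ a)]
      rfl

theorem fieldSumC_succ {ω : ℂ} {Z : Divisor T ω} (s : Slot Z) {N : ℕ} (hN : 1 ≤ N) :
    (∑ a ∈ modes B.d True (N + 1), expDual (fun a => (B.bd 0 0 a : g)) a ⊗ₜ[ℂ]
      cplxVec g s (expVec (fun a => (B.b 0 0 a : g)) a)) -
    (∑ a ∈ modes B.d True N, expDual (fun a => (B.bd 0 0 a : g)) a ⊗ₜ[ℂ]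
      cplxVec g s (expVec (fun a => (B.b 0 0 a : g)) a)) ∈ fieldFil g (takFil g Z) N := by
  rw [sum_modes_succ _ hN]
  refine Submodule.sum_mem _ fun a _ => ?_
  change mode (B.bd 0 0 a : g) (-(N : ℤ)) ⊗ₜ[ℂ] cplxVec g s (mode (B.b 0 0 a : g) N) +
    mode (B.bd 0 0 a : g) (-(-(N : ℤ))) ⊗ₜ[ℂ] cplxVec g s (mode (B.b 0 0 a : g) (-N)) ∈ _
  rw [neg_neg]
  refine add_mem (neg_tmul_mem_fieldFil _ ?_) ?_
  · exact Submodule.subset_span (.inl ⟨s, _, mode_mem_Fpos _ N, rfl⟩)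
  · refine pos_tmul_mem_fieldFil _ ?_
    exact Submodule.subset_span (.inr ⟨s, _, mode_mem_Fneg _ N, rfl⟩)

theorem exists_field (i : FIdx Z) :
    ∃ A : Fields L Z, IsLim (fieldSum B (gDVec B Z) i) A :=
  exists_isLim (fieldFil_antitone (gDFil_antitone L Z)) fun _ hN => fieldSum_succ B i hN

theorem exists_fieldC (s : Slot Z) : ∃ A : FieldsC g Z, IsLim (fieldSumC B s) A :=
  exists_isLim (fieldFil_antitone (takFil_antitone Z)) fun _ hN => fieldSumC_succ B s hN

end Convergence

/-! ### Compatibility of limits with the group action and with averaging. -/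

section LimitsOfActions

variable {V : Type*} [AddCommGroup V] [Module ℂ V] {T : ℕ} [NeZero T] {F : ℕ → Submodule ℂ V}

theorem IsLim.congr {F : ℕ → Submodule ℂ V} {v w : ℕ → V} {a : Completion F} (ha : IsLim v a)
    (h : ∀ N, v N = w N) : IsLim w a := by
  rwa [← funext h]

theorem IsLim.slotAct {S : V →ₗ[ℂ] V} {R : V →ₛₗ[starRingEnd ℂ] V}
    (hS : ∀ n, F n ≤ (F n).comap S) (hR : ∀ n, F n ≤ (F n).comap R) (w : ℂ)
    (α : DihedralGroup T) {v : ℕ → V} {a : Completion F} (ha : IsLim v a) :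
    IsLim (fun N => Gaudin.slotAct w S R α (v N))
      (Gaudin.slotAct w (complMap S hS) (complMap R hR) α a) := by
  have key : ∀ n : ℕ, IsLim (fun N => (S ^ n : Module.End ℂ V) (v N))
      ((complMap S hS ^ n : Module.End ℂ (Completion F)) a) := by
    intro n
    induction n with
    | zero => exact ha
    | succ n ih =>
      have h : IsLim (fun N => (S ^ (n + 1) : Module.End ℂ V) (v N))
          (complMap S hS ((complMap S hS ^ n : Module.End ℂ (Completion F)) a)) :=
        (ih.map S hS).congr fun N => by rw [pow_succ']; rfl
      have e : (complMap S hS ^ (n + 1) : Module.End ℂ (Completion F)) a =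
          complMap S hS ((complMap S hS ^ n : Module.End ℂ (Completion F)) a) := by
        rw [pow_succ']; rfl
      rwa [e]
  cases α with
  | r i =>
    rw [slotAct_r]
    exact ((key _).smul _).congr fun N => (slotAct_r _ _ _ _ _).symm
  | sr i =>
    rw [slotAct_sr]
    exact (((key _).smul _).map R hR).congr fun N => (slotAct_sr _ _ _ _ _).symm

theorem IsLim.tmul {v : ℕ → V} {a : Completion F} (ha : IsLim v a) (f : RatFunc ℂ) :
    IsLim (fun N => v N ⊗ₜ[ℂ] f) (complProd F (a ⊗ₜ[ℂ] f)) :=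
  ha.map ((TensorProduct.mk ℂ V (RatFunc ℂ)).flip f)
    (fun n _ hv => Submodule.apply_mem_map₂ _ (p := F n) (q := ⊤) hv trivial)

theorem diffAvg_tmul_slotDiff {ω : ℂ} {Z : Divisor T ω} (h0 : ω ≠ 0) (S : V →ₗ[ℂ] V)
    (R : V →ₛₗ[starRingEnd ℂ] V) (v : V) (s : Slot Z) :
    diffAvg (T := T) h0 S R (v ⊗ₜ[ℂ] slotDiff s 1) = (1 / (2 * T) : ℂ) •
      ∑ α : DihedralGroup T, slotAct (slotWeight s)⁻¹ S R α v ⊗ₜ[ℂ] slotDiff s α := by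
  rw [diffAvg_complex, Finset.sum_congr rfl fun α _ => diffAct_slotDiff h0 S R α v s]

/-- The average of a polar part is an explicit finite sum of translated coefficients times fixed
differentials, so the limit may be taken in each coefficient. -/
theorem IsLim.diffAvg {ω : ℂ} {Z : Divisor T ω} (h0 : ω ≠ 0) {S : V →ₗ[ℂ] V}
    {R : V →ₛₗ[starRingEnd ℂ] V}
    (hS : ∀ n, F n ≤ (F n).comap S) (hR : ∀ n, F n ≤ (F n).comap R) (s : Slot Z) {v : ℕ → V}
    {a : Completion F} (ha : IsLim v a) :
    IsLim (fun N => Gaudin.diffAvg (T := T) h0 S R (v N ⊗ₜ[ℂ] slotDiff s 1))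
      (complProd F (Gaudin.diffAvg (T := T) h0 (complMap S hS) (complMap R hR)
        (a ⊗ₜ[ℂ] slotDiff s 1))) := by
  rw [diffAvg_tmul_slotDiff, map_smul, map_sum]
  refine IsLim.congr (IsLim.smul _ (IsLim.sum _ fun α _ =>
    (ha.slotAct hS hR (slotWeight s)⁻¹ α).tmul (slotDiff s α))) fun N => ?_
  rw [diffAvg_tmul_slotDiff]

theorem diffAct_map {V' : Type*} [AddCommGroup V'] [Module ℂ V'] {ω : ℂ} (h0 : ω ≠ 0)
    {S : V →ₗ[ℂ] V} {R : V →ₛₗ[starRingEnd ℂ] V} {S' : V' →ₗ[ℂ] V'}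
    {R' : V' →ₛₗ[starRingEnd ℂ] V'} (f : V →ₗ[ℂ] V') (hS : ∀ x, f (S x) = S' (f x))
    (hR : ∀ x, f (R x) = R' (f x)) (α : DihedralGroup T) (φ : V ⊗[ℂ] RatFunc ℂ) :
    TensorProduct.map f LinearMap.id (diffAct h0 S R α φ) =
      diffAct h0 S' R' α (TensorProduct.map f LinearMap.id φ) := by
  refine dihedralAct_comm (fun φ : V ⊗[ℂ] RatFunc ℂ => TensorProduct.map f LinearMap.id φ)
    (fun φ => ?_) (fun φ => ?_) α φ
  · induction φ using TensorProduct.induction_on with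
    | zero => simp
    | tmul v h => simp only [TensorProduct.map_tmul, hS, LinearMap.id_apply]
    | add x y hx hy => simp only [map_add, hx, hy]
  · induction φ using TensorProduct.induction_on with
    | zero => simp
    | tmul v h =>
      change f (R v) ⊗ₜ[ℂ] diffT h = R' (f v) ⊗ₜ[ℂ] diffT h
      rw [hR]
    | add x y hx hy => simp only [map_add, hx, hy]

theorem diffAvg_map {V' : Type*} [AddCommGroup V'] [Module ℂ V'] {ω : ℂ} (h0 : ω ≠ 0)
    {S : V →ₗ[ℂ] V} {R : V →ₛₗ[starRingEnd ℂ] V} {S' : V' →ₗ[ℂ] V'}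
    {R' : V' →ₛₗ[starRingEnd ℂ] V'} (f : V →ₗ[ℂ] V') (hS : ∀ x, f (S x) = S' (f x))
    (hR : ∀ x, f (R x) = R' (f x)) (φ : V ⊗[ℂ] RatFunc ℂ) :
    TensorProduct.map f LinearMap.id (diffAvg (T := T) h0 S R φ) =
      diffAvg (T := T) h0 S' R' (TensorProduct.map f LinearMap.id φ) := by
  rw [diffAvg_complex, diffAvg_complex, map_smul, map_sum]
  congr 1
  exact Finset.sum_congr rfl fun α _ => diffAct_map h0 f hS hR α φ

end LimitsOfActions

/-! ### The canonical element, its convergence and its image under ζ. -/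

section Canonical

variable {g : Type*} [LieRing g] [LieAlgebra ℂ g] {T : ℕ} [NeZero T] {L : LieData g T}
  (B : BasisData L) {Z : Divisor T L.ω}

/-- The multiplicities with which the formal fields contribute to the average over the dihedral
group; the fields at the conjugate points arise by averaging. -/
def mult {ω : ℂ} {Z : Divisor T ω} : FIdx Z → ℂ
  | .inl ⟨_, _, false⟩ => 2
  | .inl ⟨_, _, true⟩ => 0
  | .inr _ => 1

/-- The sum of the polar parts with given coefficients. -/
def polarSum {ω : ℂ} {Z : Divisor T ω} {V : Type*} [AddCommGroup V] [Module ℂ V] (v : FIdx Z → V) :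
    V ⊗[ℂ] RatFunc ℂ := ∑ i, (mult i • v i) ⊗ₜ[ℂ] slotDiff (slotOf i) 1

/-- Tensoring with 1 ⊗ Y intertwines the actions because c fixes it, so ζ commutes with averaging.
-/
theorem zeta_avgDiff (s : Slot Z) (v : AffineKM g) (Y : gD L Z) :
    zeta L Z (avgDiff s v ⊗ₜ[ℝ] Y) = diffAvg (T := T) L.ω_ne (fieldS L) (fieldT L)
      ((v ⊗ₜ[ℂ] ((1 : ℂ) ⊗ₜ[ℝ] Y)) ⊗ₜ[ℂ] slotDiff s 1) := by
  change TensorProduct.map ((TensorProduct.mk ℂ (AffineKM g) (ℂ ⊗[ℝ] gD L Z)).flip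
    ((1 : ℂ) ⊗ₜ[ℝ] Y)) LinearMap.id (avgDiff s v).1 = _
  rw [avgDiff_coe, diffAvg_map (S' := fieldS L) (R' := fieldT L)]
  · rfl
  · intro x; rfl
  · intro x
    change _ = L.τt x ⊗ₜ[ℂ] conjC ((1 : ℂ) ⊗ₜ[ℝ] Y)
    rw [conjC_tmul, map_one]
    rfl

/-- The dual vectors I and -iI combine with the Takiff vectors Y and Y' into I ⊗ (Y - iY'), twice
the term of the field. This is the value 2 in `mult`. -/
theorem sum_dual_cplx (x : {x : ℂ // x ∈ Z.cplxPts}) (p : Fin (Z.n x)) (N : ℕ) :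
    (∑ a ∈ modes B.d True N, dualVec B (.cplx x p false) a ⊗ₜ[ℂ]
        ((1 : ℂ) ⊗ₜ[ℝ] gDVec B Z ⟨.cplx x p false, a⟩)) +
      (∑ a ∈ modes B.d True N, dualVec B (.cplx x p true) a ⊗ₜ[ℂ]
        ((1 : ℂ) ⊗ₜ[ℝ] gDVec B Z ⟨.cplx x p true, a⟩)) =
      (2 : ℂ) • fieldSum B (gDVec B Z) (.cplx x p false) N := by
  unfold fieldSum
  refine Finset.sum_add_distrib.symm.trans (Eq.trans ?_ Finset.smul_sum.symm)
  refine Finset.sum_congr rfl fun a _ => ?_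
  rw [fieldTerm_false]
  unfold cplxFactor
  change expDual (fun a => (B.bd 0 0 a : g)) a ⊗ₜ[ℂ] _ +
    (-Complex.I • expDual (fun a => (B.bd 0 0 a : g)) a) ⊗ₜ[ℂ] _ = _
  rw [I_tmul (gDVec B Z ⟨.cplx x p true, a⟩)]
  simp only [← TensorProduct.smul_tmul', TensorProduct.tmul_sub, TensorProduct.tmul_smul]
  module

/-- The bridge between Φ and the fields: from here on only averages of polar parts with field
coefficients occur. -/
theorem zeta_sum (N : ℕ) :
    zeta L Z (∑ A ∈ idxUpTo B Z N, dualDiff B Z A ⊗ₜ[ℝ] gDVec B Z A) =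
      diffAvg (T := T) L.ω_ne (fieldS L) (fieldT L)
        (polarSum fun i => fieldSum B (gDVec B Z) i N) := by
  have h1 : ∀ i : FIdx Z, ∑ a ∈ modes (dimOf B i) (hasKD i) N,
      zeta L Z (dualDiff B Z ⟨i, a⟩ ⊗ₜ[ℝ] gDVec B Z ⟨i, a⟩) =
      diffAvg (T := T) L.ω_ne (fieldS L) (fieldT L)
        ((∑ a ∈ modes (dimOf B i) (hasKD i) N, dualVec B i a ⊗ₜ[ℂ]
          ((1 : ℂ) ⊗ₜ[ℝ] gDVec B Z ⟨i, a⟩)) ⊗ₜ[ℂ] slotDiff (slotOf i) 1) := by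
    intro i
    rw [TensorProduct.sum_tmul, map_sum]
    exact Finset.sum_congr rfl fun a _ => zeta_avgDiff _ _ _
  unfold idxUpTo
  rw [map_sum, Finset.sum_sigma, Finset.sum_congr rfl fun i _ => h1 i, ← map_sum]
  congr 1
  unfold polarSum
  refine (Fintype.sum_sum_type _).trans (Eq.trans ?_ (Fintype.sum_sum_type _).symm)
  refine congrArg₂ (· + ·) ?_ ?_
  · rw [Fintype.sum_sigma, Fintype.sum_sigma]
    refine Finset.sum_congr rfl fun x _ => ?_
    rw [Fintype.sum_prod_type, Fintype.sum_prod_type]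
    refine Finset.sum_congr rfl fun p _ => ?_
    rw [Fintype.sum_bool, Fintype.sum_bool]
    refine (TensorProduct.add_tmul _ _ _).symm.trans ?_
    refine (congrArg (· ⊗ₜ[ℂ] slotDiff (slotOf (.cplx x p false)) 1)
      ((add_comm _ _).trans (sum_dual_cplx B x p N))).trans ?_
    change _ = ((0 : ℂ) • fieldSum B (gDVec B Z) (.cplx x p true) N) ⊗ₜ[ℂ]
        slotDiff (slotOf (.cplx x p false)) 1 +
      ((2 : ℂ) • fieldSum B (gDVec B Z) (.cplx x p false) N) ⊗ₜ[ℂ]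
        slotDiff (slotOf (.cplx x p false)) 1
    rw [zero_smul, TensorProduct.zero_tmul, zero_add]
  · refine Finset.sum_congr rfl fun i _ => ?_
    change _ = ((1 : ℂ) • fieldSum B (gDVec B Z) (.inr i) N) ⊗ₜ[ℂ] slotDiff (slotOf (.inr i)) 1
    rw [one_smul]
    rfl

theorem diffAvg_polarSum_mem {V : Type*} [AddCommGroup V] [Module ℂ V] {ω : ℂ}
    (hω : IsPrimitiveRoot ω T) (h0 : ω ≠ 0) {Z : Divisor T ω} {S : V →ₗ[ℂ] V}
    {R : V →ₛₗ[starRingEnd ℂ] V} (E : Submodule ℂ V) (hS : ∀ x ∈ E, S x ∈ E)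
    (hR : ∀ x ∈ E, R x ∈ E) {v : FIdx Z → V} (hv : ∀ i, v i ∈ E) :
    diffAvg (T := T) h0 S R (polarSum v) ∈ omegaOf Z E := by
  unfold polarSum
  rw [map_sum]
  exact Submodule.sum_mem _ fun i _ =>
    diffAvg_slotDiff_mem hω h0 E hS hR (E.smul_mem _ (hv i)) (slotOf i)

theorem polarSum_sub {V : Type*} [AddCommGroup V] [Module ℂ V] {ω : ℂ} {Z : Divisor T ω}
    (v w : FIdx Z → V) : polarSum (fun i => v i - w i) = polarSum v - polarSum w := by
  unfold polarSum
  rw [← Finset.sum_sub_distrib]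
  exact Finset.sum_congr rfl fun i _ => by rw [smul_sub, TensorProduct.sub_tmul]

/-- `zetaFil` is a preimage under ζ, so the bound for the fields transfers directly to the partial
sums of Φ. -/
theorem canonical_succ {N : ℕ} (hN : 1 ≤ N) :
    ∑ A ∈ idxUpTo B Z (N + 1), dualDiff B Z A ⊗ₜ[ℝ] gDVec B Z A -
      ∑ A ∈ idxUpTo B Z N, dualDiff B Z A ⊗ₜ[ℝ] gDVec B Z A ∈ zetaFil L Z N := by
  refine Submodule.mem_comap.2 ?_
  rw [map_sub, zeta_sum, zeta_sum, ← map_sub, ← polarSum_sub]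
  exact diffAvg_polarSum_mem L.ω_prim L.ω_ne (fieldFil g (gDFil L Z) N)
    (fun _ h => fieldFil_le_fieldS L (gDFil L Z) N h)
    (fun _ h => fieldFil_le_fieldT L (gDFil L Z) N h) fun i => fieldSum_succ B i hN

theorem exists_canonical : ∃ Φ : Completion (R := ℝ) (V := OmegaPiD L Z ⊗[ℝ] gD L Z) (zetaFil L Z),
    IsLim (fun N => ∑ A ∈ idxUpTo B Z N, dualDiff B Z A ⊗ₜ[ℝ] gDVec B Z A) Φ := by
  have h := @exists_isLim ℝ _ (OmegaPiD L Z ⊗[ℝ] gD L Z) _ _ (zetaFil L Z) (zetaFil_antitone L Z)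
    (fun N => ∑ A ∈ idxUpTo B Z N, dualDiff B Z A ⊗ₜ[ℝ] gDVec B Z A)
    fun N hN => canonical_succ B hN
  exact h

variable (L Z) in
/-- The completed action of `s` on formal fields. -/
abbrev fieldsS : Fields L Z →ₗ[ℂ] Fields L Z :=
  complMap (fieldS L) (fieldFil_le_fieldS L (gDFil L Z))

variable (L Z) in
/-- The completed action of `t` on formal fields. -/
abbrev fieldsT : Fields L Z →ₛₗ[starRingEnd ℂ] Fields L Z :=
  complMap (fieldT L) (fieldFil_le_fieldT L (gDFil L Z))

theorem isDihedral_fields : IsDihedral T (fieldsS L Z) (fieldsT L Z) :=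
  isDihedral_compl L.isDihedral_field _ _

/-- The image of the canonical element, as a sum of averages. -/
def canonicalImage (A : FIdx Z → Fields L Z) : Fields L Z ⊗[ℂ] RatFunc ℂ :=
  diffAvg (T := T) L.ω_ne (fieldsS L Z) (fieldsT L Z) (polarSum A)

/-- Both sides are limits of the same sequence. -/
theorem zetaHat_canonical {A : FIdx Z → Fields L Z}
    (hA : ∀ i, IsLim (fieldSum B (gDVec B Z) i) (A i))
    {Φ : Completion (R := ℝ) (V := OmegaPiD L Z ⊗[ℝ] gD L Z) (zetaFil L Z)}
    (hΦ : IsLim (fun N => ∑ A ∈ idxUpTo B Z N, dualDiff B Z A ⊗ₜ[ℝ] gDVec B Z A) Φ) :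
    zetaHat L Z (by exact Φ) = complProd (fieldFil g (gDFil L Z)) (canonicalImage A) := by
  have h1 : IsLim (fun N => zeta L Z (∑ A ∈ idxUpTo B Z N, dualDiff B Z A ⊗ₜ[ℝ] gDVec B Z A))
      (zetaHat L Z (by exact Φ)) := hΦ.map (zeta L Z) _
  refine h1.unique ?_
  unfold canonicalImage polarSum
  rw [map_sum, map_sum]
  refine IsLim.congr (IsLim.sum _ fun i _ =>
    ((hA i).smul (mult i)).diffAvg L.ω_ne _ _ (slotOf i)) fun N => ?_
  rw [zeta_sum]
  unfold polarSum
  rw [map_sum]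

theorem canonicalImage_mem (A : FIdx Z → Fields L Z) :
    canonicalImage A ∈ omegaOf Z (⊤ : Submodule ℂ (Fields L Z)) :=
  diffAvg_polarSum_mem L.ω_prim L.ω_ne ⊤ (fun _ _ => trivial) (fun _ _ => trivial)
    fun _ => trivial

theorem act_canonicalImage (A : FIdx Z → Fields L Z) (α : DihedralGroup T) :
    fieldAct L (gDFil L Z) α (canonicalImage A) = canonicalImage A :=
  act_diffAvg L.ω_prim L.ω_ne isDihedral_fields α _

end Canonical

/-! ### Reducing dihedral averages to averages over rotations. -/

section RotationAverage

variable {T : ℕ} [NeZero T] {ω : ℂ} {V : Type*} [AddCommGroup V] [Module ℂ V]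

theorem sum_dihedral {M : Type*} [AddCommMonoid M] (f : DihedralGroup T → M) :
    ∑ α, f α = ∑ k : ZMod T, f (.r k) + ∑ k : ZMod T, f (.sr k) := by
  let e : DihedralGroup T ≃ ZMod T ⊕ ZMod T :=
    { toFun := fun | .r k => .inl k | .sr k => .inr k
      invFun := fun | .inl k => .r k | .inr k => .sr k
      left_inv := by rintro (_ | _) <;> rfl
      right_inv := by rintro (_ | _) <;> rfl }
  rw [← e.symm.sum_comp, Fintype.sum_sum_type]
  rfl

/-- The average of a differential over the rotations. -/
def rotAvg (h0 : ω ≠ 0) (S : V →ₗ[ℂ] V) (R : V →ₛₗ[starRingEnd ℂ] V) :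
    Module.End ℝ (V ⊗[ℂ] RatFunc ℂ) :=
  (1 / T : ℝ) • ∑ k : ZMod T, diffAct h0 S R (.r k)

theorem rotAvg_apply (h0 : ω ≠ 0) (S : V →ₗ[ℂ] V) (R : V →ₛₗ[starRingEnd ℂ] V)
    (φ : V ⊗[ℂ] RatFunc ℂ) : rotAvg (T := T) h0 S R φ =
      (1 / T : ℂ) • ∑ k : ZMod T, diffAct h0 S R (.r k) φ := by
  have h : rotAvg (T := T) h0 S R φ = (1 / T : ℝ) • ∑ k : ZMod T, diffAct h0 S R (.r k) φ := by
    simp [rotAvg]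
  rw [h]
  refine (real_smul_eq _ _).trans ?_
  congr 1
  push_cast
  rfl

variable {S : V →ₗ[ℂ] V} {R : V →ₛₗ[starRingEnd ℂ] V}

/-- If `sr j` fixes φ, then `sr k` acts on φ as the rotation `r (j - k)`, so the reflections
contribute a second copy of the sum over rotations. -/
theorem diffAvg_eq_rotAvg (hω : IsPrimitiveRoot ω T) (h0 : ω ≠ 0) (h : IsDihedral T S R)
    {j : ZMod T} {φ : V ⊗[ℂ] RatFunc ℂ} (hφ : diffAct h0 S R (.sr j) φ = φ) :
    diffAvg (T := T) h0 S R φ = rotAvg (T := T) h0 S R φ := by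
  have hT : (T : ℂ) ≠ 0 := Nat.cast_ne_zero.2 (NeZero.ne T)
  have e : ∑ k : ZMod T, diffAct h0 S R (.sr k) φ = ∑ k : ZMod T, diffAct h0 S R (.r k) φ := by
    rw [← (Equiv.subLeft j).sum_comp fun k : ZMod T => diffAct h0 S R (.r k) φ]
    refine Finset.sum_congr rfl fun k _ => ?_
    conv_lhs => rw [← hφ, ← h.diffAct_mul hω h0, DihedralGroup.sr_mul_sr]
    rfl
  rw [diffAvg_complex, rotAvg_apply, sum_dihedral, e, ← two_smul ℂ, smul_smul]
  congr 1
  field_simp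

/-- One copy of φ may be reflected by t before averaging; φ + tφ is then fixed by t. -/
theorem diffAvg_two_smul (hω : IsPrimitiveRoot ω T) (h0 : ω ≠ 0) (h : IsDihedral T S R)
    (φ : V ⊗[ℂ] RatFunc ℂ) : diffAvg (T := T) h0 S R (φ + φ) =
      rotAvg (T := T) h0 S R (φ + diffAct h0 S R (.sr 0 : DihedralGroup T) φ) := by
  rw [← diffAvg_eq_rotAvg hω h0 h (j := 0), map_add, map_add, diffAvg_act hω h0 h]
  rw [map_add, ← h.diffAct_mul hω h0, DihedralGroup.sr_mul_sr, sub_zero, ← DihedralGroup.one_def,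
    diffAct_one, add_comm]

end RotationAverage

/-! ### Symmetry of the fields under stabilisers, and the formula in (c). -/

section FieldSymmetry

variable {g : Type*} [LieRing g] [LieAlgebra ℂ g] {T : ℕ} [NeZero T] {L : LieData g T}
  (B : BasisData L) {Z : Divisor T L.ω}

theorem slotAct_field_real (w : ℂ) (α : DihedralGroup T) (X : AffineKM g) {W : Type*}
    [AddCommGroup W] [Module ℝ W] (Y : W) :
    slotAct w (fieldS L) (fieldT L) α (X ⊗ₜ[ℂ] ((1 : ℂ) ⊗ₜ[ℝ] Y)) =
      slotAct w L.σt L.τt α X ⊗ₜ[ℂ] ((1 : ℂ) ⊗ₜ[ℝ] Y) := by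
  refine (dihedralAct_comm (fun X : AffineKM g => X ⊗ₜ[ℂ] ((1 : ℂ) ⊗ₜ[ℝ] Y))
    (fun X => ?_) (fun X => ?_) α X).symm
  · exact (TensorProduct.smul_tmul' w (L.σt X) ((1 : ℂ) ⊗ₜ[ℝ] Y)).symm
  · change _ = L.τt X ⊗ₜ[ℂ] conjC ((1 : ℂ) ⊗ₜ[ℝ] Y)
    rw [conjC_tmul, map_one]

/-- The group acts only on the first tensor factor, as c fixes 1 ⊗ Y, and that factor is
stabiliser-invariant term by term. -/
theorem fieldSum_fixed
    (i : (Σ (k : ZMod T) (x : {x : ℂ // x ∈ Z.realPts k}), Fin (Z.n x)) ⊕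
      (Fin (Z.n 0) ⊕ Fin (Z.nInf - 1))) (N : ℕ) {α : DihedralGroup T}
    (hα : Fixes (slotOf (.inr i : FIdx Z)) α) :
    slotAct (slotWeight (slotOf (.inr i : FIdx Z)))⁻¹ (fieldS L) (fieldT L) α
      (fieldSum B (gDVec B Z) (.inr i) N) = fieldSum B (gDVec B Z) (.inr i) N := by
  unfold fieldSum
  rw [map_sum]
  refine Finset.sum_congr rfl fun a _ => ?_
  change slotAct _ _ _ _ (auxVec B (.inr i) a ⊗ₜ[ℂ] _) = auxVec B (.inr i) a ⊗ₜ[ℂ] _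
  rw [slotAct_field_real, auxVec_fixed B i a hα]

variable {A : FIdx Z → Fields L Z}

theorem fieldsT_false (hA : ∀ i, IsLim (fieldSum B (gDVec B Z) i) (A i))
    (x : {x : ℂ // x ∈ Z.cplxPts}) (p : Fin (Z.n x)) :
    fieldsT L Z (A (.cplx x p false)) = A (.cplx x p true) :=
  (((hA (.cplx x p false)).map (fieldT L) (fieldFil_le_fieldT L (gDFil L Z))).congr
    fun N => (fieldSum_true B x p N).symm).unique (hA (.cplx x p true))

theorem field_fixed (hA : ∀ i, IsLim (fieldSum B (gDVec B Z) i) (A i))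
    (i : (Σ (k : ZMod T) (x : {x : ℂ // x ∈ Z.realPts k}), Fin (Z.n x)) ⊕
      (Fin (Z.n 0) ⊕ Fin (Z.nInf - 1))) {α : DihedralGroup T}
    (hα : Fixes (slotOf (.inr i : FIdx Z)) α) :
    slotAct (slotWeight (slotOf (.inr i : FIdx Z)))⁻¹ (fieldsS L Z) (fieldsT L Z) α (A (.inr i)) =
      A (.inr i) :=
  (((hA (.inr i)).slotAct (fieldFil_le_fieldS L (gDFil L Z)) (fieldFil_le_fieldT L (gDFil L Z))
    _ α).congr fun N => fieldSum_fixed B i N hα).unique (hA (.inr i))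

theorem act_polar_fixed (hA : ∀ i, IsLim (fieldSum B (gDVec B Z) i) (A i))
    (i : (Σ (k : ZMod T) (x : {x : ℂ // x ∈ Z.realPts k}), Fin (Z.n x)) ⊕
      (Fin (Z.n 0) ⊕ Fin (Z.nInf - 1))) {α : DihedralGroup T}
    (hα : Fixes (slotOf (.inr i : FIdx Z)) α) :
    diffAct L.ω_ne (fieldsS L Z) (fieldsT L Z) α
      (A (.inr i) ⊗ₜ[ℂ] slotDiff (slotOf (.inr i)) 1) =
        A (.inr i) ⊗ₜ[ℂ] slotDiff (slotOf (.inr i)) 1 := by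
  rw [diffAct_slotDiff, field_fixed B hA i hα, slotDiff_fixes hα]

theorem slotDiff_one_inl (x : {x : ℂ // x ∈ Z.n.support}) (p : Fin (Z.n x)) :
    slotDiff (.inl ⟨x, p⟩ : Slot Z) 1 = polarDiff x p := by
  change polarDiff (mob L.ω 1 (x : ℂ)) p = _
  rw [mob_one]

/-- The factor 2 provides the spare copy that t turns into the polar part at the conjugate point. -/
theorem diffAvg_cplx (hA : ∀ i, IsLim (fieldSum B (gDVec B Z) i) (A i))
    (x : {x : ℂ // x ∈ Z.cplxPts}) (p : Fin (Z.n x)) :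
    diffAvg (T := T) L.ω_ne (fieldsS L Z) (fieldsT L Z)
        (((2 : ℂ) • A (.cplx x p false)) ⊗ₜ[ℂ] slotDiff (slotOf (.cplx x p false)) 1) =
      rotAvg (T := T) L.ω_ne (fieldsS L Z) (fieldsT L Z)
        (A (.cplx x p false) ⊗ₜ[ℂ] polarDiff x p +
          A (.cplx x p true) ⊗ₜ[ℂ] polarDiff (starRingEnd ℂ x) p) := by
  have e1 : slotDiff (slotOf (.cplx x p false)) 1 = polarDiff x p :=
    slotDiff_one_inl (L := L) ⟨x, Z.mem_of_cplx x.2⟩ p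
  rw [two_smul, TensorProduct.add_tmul, diffAvg_two_smul L.ω_prim L.ω_ne isDihedral_fields, e1,
    diffAct_polarDiff, slotAct_sr_zero, fieldsT_false B hA, mob_sr L.ω_prim, neg_zero,
    ZMod.val_zero, pow_zero, one_mul]

theorem diffAvg_real (hA : ∀ i, IsLim (fieldSum B (gDVec B Z) i) (A i)) (l : ZMod T)
    (x : {x : ℂ // x ∈ Z.realPts l}) (p : Fin (Z.n x)) :
    diffAvg (T := T) L.ω_ne (fieldsS L Z) (fieldsT L Z)
        (A (.real l x p) ⊗ₜ[ℂ] slotDiff (slotOf (.real l x p)) 1) =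
      rotAvg (T := T) L.ω_ne (fieldsS L Z) (fieldsT L Z)
        (A (.real l x p) ⊗ₜ[ℂ] polarDiff x p) := by
  have e1 : slotDiff (slotOf (.real l x p)) 1 = polarDiff x p :=
    slotDiff_one_inl (L := L) ⟨x, Z.mem_of_real x.2⟩ p
  have h := act_polar_fixed B hA (.inl ⟨l, x, p⟩) ((fixes_real L.ω_prim l x p _).2 (.inr rfl))
  rw [diffAvg_eq_rotAvg L.ω_prim L.ω_ne isDihedral_fields h, e1]

theorem diffAvg_zero (hA : ∀ i, IsLim (fieldSum B (gDVec B Z) i) (A i)) (p : Fin (Z.n 0)) :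
    diffAvg (T := T) L.ω_ne (fieldsS L Z) (fieldsT L Z)
        (A (.zero p) ⊗ₜ[ℂ] slotDiff (slotOf (.zero p)) 1) =
      A (.zero p) ⊗ₜ[ℂ] polarDiff 0 p := by
  have e1 : slotDiff (slotOf (.zero p : FIdx Z)) 1 = polarDiff 0 p :=
    slotDiff_one_inl (L := L) ⟨0, Z.zero_mem p⟩ p
  have h := fun α => act_polar_fixed B hA (.inr (.inl p)) (fixes_zero p α)
  rw [diffAvg_of_fixed L.ω_ne h, e1]

theorem diffAvg_inf (hA : ∀ i, IsLim (fieldSum B (gDVec B Z) i) (A i)) (q : Fin (Z.nInf - 1)) :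
    diffAvg (T := T) L.ω_ne (fieldsS L Z) (fieldsT L Z)
        (A (.inf q) ⊗ₜ[ℂ] slotDiff (slotOf (.inf q)) 1) =
      -(A (.inf q) ⊗ₜ[ℂ] (RatFunc.X ^ (q : ℕ) : RatFunc ℂ)) := by
  have h := fun α => act_polar_fixed B hA (.inr (.inr q)) (α := α) trivial
  rw [diffAvg_of_fixed L.ω_ne h]
  exact TensorProduct.tmul_neg _ _

theorem polarSum_eq {ω : ℂ} {Z : Divisor T ω} {V : Type*} [AddCommGroup V] [Module ℂ V]
    (v : FIdx Z → V) : polarSum v =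
      ∑ x : {x : ℂ // x ∈ Z.cplxPts}, ∑ p : Fin (Z.n x),
        ((2 : ℂ) • v (.cplx x p false)) ⊗ₜ[ℂ] slotDiff (slotOf (.cplx x p false)) 1 +
      ((∑ l : ZMod T, ∑ x : {x : ℂ // x ∈ Z.realPts l}, ∑ p : Fin (Z.n x),
        v (.real l x p) ⊗ₜ[ℂ] slotDiff (slotOf (.real l x p)) 1) +
      (∑ p : Fin (Z.n 0), v (.zero p) ⊗ₜ[ℂ] slotDiff (slotOf (.zero p)) 1 +
      ∑ q : Fin (Z.nInf - 1), v (.inf q) ⊗ₜ[ℂ] slotDiff (slotOf (.inf q)) 1)) := by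
  unfold polarSum
  rw [Fintype.sum_sum_type, Fintype.sum_sum_type, Fintype.sum_sum_type, Fintype.sum_sigma,
    Fintype.sum_sigma]
  refine congrArg₂ (· + ·) ?_ (congrArg₂ (· + ·) ?_ (congrArg₂ (· + ·) ?_ ?_))
  · refine Finset.sum_congr rfl fun x _ => ?_
    rw [Fintype.sum_prod_type]
    refine Finset.sum_congr rfl fun p _ => ?_
    rw [Fintype.sum_bool]
    refine (congrArg (· + _) ?_).trans (zero_add _)
    change ((0 : ℂ) • v (.cplx x p true)) ⊗ₜ[ℂ] _ = 0
    rw [zero_smul, TensorProduct.zero_tmul]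
  · refine Finset.sum_congr rfl fun l _ => ?_
    rw [Fintype.sum_sigma]
    refine Finset.sum_congr rfl fun x _ => Finset.sum_congr rfl fun p _ => ?_
    exact congrArg (· ⊗ₜ[ℂ] _) (one_smul ℂ _)
  · exact Finset.sum_congr rfl fun p _ => congrArg (· ⊗ₜ[ℂ] _) (one_smul ℂ _)
  · exact Finset.sum_congr rfl fun p _ => congrArg (· ⊗ₜ[ℂ] _) (one_smul ℂ _)

theorem canonicalImage_eq (hA : ∀ i, IsLim (fieldSum B (gDVec B Z) i) (A i)) :
    canonicalImage A = rotAvg (T := T) L.ω_ne (fieldsS L Z) (fieldsT L Z)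
            (∑ x : {x : ℂ // x ∈ Z.cplxPts}, ∑ p : Fin (Z.n x),
                (A (.cplx x p false) ⊗ₜ[ℂ] polarDiff x p +
                  A (.cplx x p true) ⊗ₜ[ℂ] polarDiff (starRingEnd ℂ x) p) +
              ∑ l : ZMod T, ∑ x : {x : ℂ // x ∈ Z.realPts l}, ∑ p : Fin (Z.n x),
                A (.real l x p) ⊗ₜ[ℂ] polarDiff x p)
          + ∑ p : Fin (Z.n 0), A (.zero p) ⊗ₜ[ℂ] polarDiff 0 p
          - ∑ q : Fin (Z.nInf - 1), A (.inf q) ⊗ₜ[ℂ] (RatFunc.X ^ (q : ℕ) : RatFunc ℂ) := by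
  unfold canonicalImage
  rw [polarSum_eq, sub_eq_add_neg, add_assoc, ← Finset.sum_neg_distrib]
  simp only [map_add, map_sum, diffAvg_cplx B hA, diffAvg_real B hA, diffAvg_zero B hA,
    diffAvg_inf B hA, add_assoc]

end FieldSymmetry

/-! ### Complex linearity of the complexified vectors. -/

section CplxVec

variable {g : Type*} [LieRing g] [LieAlgebra ℂ g] {T : ℕ} {ω : ℂ} {Z : Divisor T ω}

theorem cplxVec_add (s : Slot Z) (X Y : AffineKM g) :
    cplxVec g s (X + Y) = cplxVec g s X + cplxVec g s Y := by
  unfold cplxVec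
  rw [smul_add, map_add, map_add, TensorProduct.tmul_add, TensorProduct.tmul_add, ← smul_add]
  congr 1
  abel

theorem cplxVec_real (s : Slot Z) (r : ℝ) (X : AffineKM g) :
    cplxVec g s ((r : ℂ) • X) = (r : ℂ) • cplxVec g s X := by
  unfold cplxVec
  rw [smul_comm Complex.I (r : ℂ) X, tmul_tak_real, tmul_tak_real, ← smul_sub, smul_comm]

/-- `cplxVec` projects onto the part of the complexification where multiplication by i in the Takiff
algebra agrees with the scalar i. -/
theorem cplxVec_I (s : Slot Z) (X : AffineKM g) :
    cplxVec g s (Complex.I • X) = Complex.I • cplxVec g s X := by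
  unfold cplxVec
  rw [smul_smul Complex.I Complex.I X, Complex.I_mul_I, neg_one_smul, map_neg,
    TensorProduct.tmul_neg, sub_neg_eq_add, smul_comm Complex.I (1 / 2 : ℂ), smul_sub,
    I_tmul (tak s (Complex.I • X)), smul_smul Complex.I Complex.I, Complex.I_mul_I, neg_one_smul,
    sub_neg_eq_add, ← I_tmul, add_comm]

/-- The map `cplxVec` is complex linear. -/
def cplxVecL (s : Slot Z) : AffineKM g →ₗ[ℂ] ℂ ⊗[ℝ] TakD g Z where
  toFun := cplxVec g s
  map_add' := cplxVec_add s
  map_smul' c X := by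
    have h : c • X = (c.re : ℂ) • X + (c.im : ℂ) • (Complex.I • X) := by
      rw [smul_smul, ← add_smul, Complex.re_add_im]
    rw [h, cplxVec_add, cplxVec_real, cplxVec_real, cplxVec_I, smul_smul, ← add_smul,
      Complex.re_add_im]
    rfl

/-- A real vector is the sum of its holomorphic part and the conjugate of that part; this splits
every field at a point with a stabiliser into two halves. -/
theorem one_tmul_tak (s : Slot Z) (X : AffineKM g) :
    (1 : ℂ) ⊗ₜ[ℝ] (tak s X : TakD g Z) = cplxVec g s X + conjC (cplxVec g s X) := by
  rw [← invVec_eq]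
  unfold invVec
  rw [sub_self, smul_zero, smul_zero, map_zero, TensorProduct.tmul_zero, sub_zero, ← two_smul ℂ,
    smul_smul]
  norm_num

/-- The pairing `X, Y ↦ X ⊗ Y_ℂ`, for the vectors above. -/
def fieldPair (s : Slot Z) :
    AffineKM g →ₗ[ℂ] AffineKM g →ₗ[ℂ] AffineKM g ⊗[ℂ] (ℂ ⊗[ℝ] TakD g Z) :=
  (TensorProduct.mk ℂ (AffineKM g) (ℂ ⊗[ℝ] TakD g Z)).compl₂ (cplxVecL s)

theorem fieldPair_apply (s : Slot Z) (X Y : AffineKM g) :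
    fieldPair s X Y = X ⊗ₜ[ℂ] cplxVec g s Y := rfl

end CplxVec

/-! ### Independence of the canonical tensor from the basis. -/

section ChangeOfBasis

variable {g : Type*} [LieRing g] [LieAlgebra ℂ g] {T : ℕ} (L : LieData g T)
  {M : Type*} [AddCommGroup M] [Module ℂ M] {d d' : ℕ} {P : Prop}

open AffineKM

/-- Expanding u in u' and exchanging the sums moves the matrix of the form onto v; on a subspace,
this replaces v' by its projection `f`. -/
theorem sum_mode_change (β : AffineKM g →ₗ[ℂ] AffineKM g →ₗ[ℂ] M) (u v : Fin d → g)
    (u' v' : Fin d' → g) (f : g → g) (hv : ∀ b, ∑ a, L.form (v' b) (u a) • v a = f (v' b))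
    (hu : ∀ a, ∑ b, L.form (v' b) (u a) • u' b = u a) (n m : ℤ) :
    ∑ a, β (mode (v a) m) (mode (u a) n) = ∑ b, β (mode (f (v' b)) m) (mode (u' b) n) := by
  have h1 : ∀ a, β (mode (v a) m) (mode (u a) n) =
      ∑ b, L.form (v' b) (u a) • β (mode (v a) m) (mode (u' b) n) := by
    intro a
    conv_lhs => rw [← hu a]
    change β _ (modeL n _) = ∑ b, _ • β _ (modeL n _)
    simp only [map_sum, map_smul]
  have h2 : ∀ b, β (mode (f (v' b)) m) (mode (u' b) n) =
      ∑ a, L.form (v' b) (u a) • β (mode (v a) m) (mode (u' b) n) := by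
    intro b
    conv_lhs => rw [← hv b]
    change β (modeL m _) _ = ∑ a, _ • β (modeL m _) _
    simp only [map_sum, map_smul, LinearMap.sum_apply, LinearMap.smul_apply]
  rw [Finset.sum_congr rfl fun a _ => h1 a, Finset.sum_congr rfl fun b _ => h2 b,
    Finset.sum_comm]

/-- `E` extends the projection to the affine algebra. It must keep or kill K and D according to `P`,
so that both sides have the same K, D part. -/
theorem sum_exp_change (β : AffineKM g →ₗ[ℂ] AffineKM g →ₗ[ℂ] M) (u v : Fin d → g)
    (u' v' : Fin d' → g) (f : g → g) (hv : ∀ b, ∑ a, L.form (v' b) (u a) • v a = f (v' b))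
    (hu : ∀ a, ∑ b, L.form (v' b) (u a) • u' b = u a) (E : AffineKM g → AffineKM g)
    (hE : ∀ x n, E (mode x n) = mode (f x) n) (h1 : P → E (K g) = K g ∧ E (D g) = D g)
    (h2 : ¬ P → E (K g) = 0 ∧ E (D g) = 0) (N : ℕ) :
    ∑ a ∈ modes d P N, β (expDual v a) (expVec u a) =
      ∑ a ∈ modes d' True N, β (E (expDual v' a)) (expVec u' a) := by
  rw [sum_modes, sum_modes (P := True), sum_modes_zero _ trivial]
  refine congrArg₂ (· + ·) (Finset.sum_congr rfl fun n _ => ?_) ?_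
  · refine (sum_mode_change L β u v u' v' f hv hu n (-n)).trans ?_
    refine Finset.sum_congr rfl fun b _ => ?_
    rw [← hE]
    rfl
  · change _ = β (E (D g)) (K g) + β (E (K g)) (D g)
    by_cases h : P
    · rw [sum_modes_zero _ h, (h1 h).1, (h1 h).2]
      rfl
    · rw [sum_modes_zero_of_not _ h, (h2 h).1, (h2 h).2, map_zero, LinearMap.zero_apply,
        LinearMap.zero_apply, add_zero]

variable [NeZero T]

theorem sum_zmod_val {A : Type*} [AddCommMonoid A] (f : ℕ → A) :
    ∑ k : ZMod T, f k.val = ∑ k : Fin T, f k := by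
  obtain ⟨n, rfl⟩ := Nat.exists_eq_succ_of_ne_zero (NeZero.ne T)
  rfl

/-- The projection to the `w⁻¹`-eigenspace of `σ`. -/
def eigenProj (w : ℂ) (X : AffineKM g) : AffineKM g :=
  (1 / T : ℂ) • ∑ k : ZMod T, w ^ k.val • (L.σt ^ k.val : Module.End ℂ _) X

variable {L}

theorem sum_root {w : ℂ} (hw : w ^ T = 1) (hw1 : w ≠ 1) : ∑ k : ZMod T, w ^ k.val = 0 := by
  rw [sum_zmod_val (fun k => w ^ k), Fin.sum_univ_eq_sum_range (fun k => w ^ k),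
    geom_sum_eq hw1, hw, sub_self, zero_div]

theorem eigenProj_fixed {w : ℂ} {X : AffineKM g} (hX : L.σt X = X) :
    eigenProj L w X = ((1 / T : ℂ) * ∑ k : ZMod T, w ^ k.val) • X := by
  have h : ∀ n : ℕ, (L.σt ^ n : Module.End ℂ _) X = X := by
    intro n
    induction n with
    | zero => rfl
    | succ n ih => rw [pow_succ', Module.End.mul_apply, ih, hX]
  unfold eigenProj
  simp only [h]
  rw [← Finset.sum_smul, smul_smul]

theorem eigenProj_one {X : AffineKM g} (hX : L.σt X = X) : eigenProj L 1 X = X := by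
  have hT : (T : ℂ) ≠ 0 := Nat.cast_ne_zero.2 (NeZero.ne T)
  rw [eigenProj_fixed hX]
  simp [hT]

theorem eigenProj_zero {w : ℂ} (hw : w ^ T = 1) (hw1 : w ≠ 1) {X : AffineKM g} (hX : L.σt X = X) :
    eigenProj L w X = 0 := by
  rw [eigenProj_fixed hX, sum_root hw hw1, mul_zero, zero_smul]

variable (B : BasisData L)

/-- The dual vectors c, cd compute the orthogonal projection onto the ω^(-j)-eigenspace, which is
also a mean over the powers of σ. -/
theorem BasisData.cd_project (j : ZMod T) (x : g) :
    ∑ a, L.form x (B.c j a : g) • (B.cd j a : g) =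
      (1 / T : ℂ) • ∑ k : ZMod T, (L.ω ^ j.val) ^ k.val • (L.σL ^ k.val : Module.End ℂ g) x := by
  have hT : (T : ℂ) ≠ 0 := Nat.cast_ne_zero.2 (NeZero.ne T)
  -- T times the projection of x; being an eigenvector, it is reproduced by the basis.
  set y : g := ∑ k : Fin T, (L.ω ^ ((-j).val * (k : ℕ)))⁻¹ • (L.σL ^ (k : ℕ) : Module.End ℂ g) x
    with hy
  have e : ∑ k : ZMod T, (L.ω ^ j.val) ^ k.val • (L.σL ^ k.val : Module.End ℂ g) x = y := by
    rw [sum_zmod_val (fun k => (L.ω ^ j.val) ^ k • (L.σL ^ k : Module.End ℂ g) x)]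
    refine Finset.sum_congr rfl fun k _ => ?_
    rw [pow_mul, omega_pow_val_neg, inv_pow, inv_inv]
  have h1 := B.cd_reproduce j (L.σL_sum_eigen x (-j).val)
  rw [← hy] at h1
  have h2 : ∀ (k : ℕ) (a : Fin (B.m j)),
      L.form ((L.σL ^ k : Module.End ℂ g) x) (B.c j a) =
        ((L.ω ^ j.val) ^ k)⁻¹ * L.form x (B.c j a) := by
    intro k a
    have hne : L.ω ^ j.val ≠ 0 := pow_ne_zero _ L.ω_ne
    induction k with
    | zero => simp
    | succ k ih =>
      rw [pow_succ', Module.End.mul_apply]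
      have h3 : (B.c j a : g) = (L.ω ^ j.val)⁻¹ • L.σL (B.c j a : g) := by
        rw [c_eigen, inv_smul_smul₀ hne]
      conv_lhs => rw [h3]
      rw [map_smul, smul_eq_mul]
      have h4 : L.form (L.σL ((L.σL ^ k : Module.End ℂ g) x)) (L.σL (B.c j a : g)) = _ :=
        L.form_σ _ _
      rw [h4, ih, pow_succ', mul_inv, mul_assoc]
  -- By σ-invariance of the form, all T terms of y pair equally with an eigenvector.
  have h5 : ∀ a, L.form y (B.c j a : g) = T * L.form x (B.c j a : g) := by
    intro a
    rw [hy, map_sum, LinearMap.sum_apply]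
    have h6 : ∀ k : Fin T, L.form ((L.ω ^ ((-j).val * (k : ℕ)))⁻¹ •
        (L.σL ^ (k : ℕ) : Module.End ℂ g) x) (B.c j a : g) = L.form x (B.c j a) := by
      intro k
      rw [map_smul, LinearMap.smul_apply, h2, smul_eq_mul, pow_mul, omega_pow_val_neg, inv_pow,
        inv_inv, mul_inv_cancel_left₀ (pow_ne_zero _ (pow_ne_zero _ L.ω_ne))]
    rw [Finset.sum_congr rfl fun k _ => h6 k]
    simp
  rw [e, ← h1, Finset.smul_sum]
  refine Finset.sum_congr rfl fun a _ => ?_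
  rw [h5, smul_smul]
  congr 1
  field_simp

theorem eigenProj_mode (j : ZMod T) (x : g) (n : ℤ) : eigenProj L (L.ω ^ j.val) (mode x n) =
    mode (∑ a, L.form x (B.c j a : g) • (B.cd j a : g)) n := by
  rw [B.cd_project]
  unfold eigenProj
  simp only [σt_pow_mode]
  change _ = modeL n _
  rw [map_smul, map_sum]
  simp only [map_smul]
  rfl

theorem sum_change_real (β : AffineKM g →ₗ[ℂ] AffineKM g →ₗ[ℂ] M) (k p : ZMod T) (N : ℕ) :
    ∑ a ∈ modes B.d True N, β (expDual (fun a => (B.bd k p a : g)) a)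
        (expVec (fun a => (B.b k p a : g)) a) =
      ∑ a ∈ modes B.d True N, β (expDual (fun a => (B.bd 0 0 a : g)) a)
        (expVec (fun a => (B.b 0 0 a : g)) a) :=
  sum_exp_change L β _ _ _ _ id (fun _ => B.bd_reproduce k p _) (fun _ => B.b_reproduce 0 0 _) id
    (fun _ _ => rfl) (fun _ => ⟨rfl, rfl⟩) (fun h => (h trivial).elim) N

/-- The tensor of the eigenspace is the full tensor with its first factor projected. -/
theorem sum_change_eigen (β : AffineKM g →ₗ[ℂ] AffineKM g →ₗ[ℂ] M) (j : ZMod T) (N : ℕ) :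
    ∑ a ∈ modes (B.m j) (j = 0) N, β (expDual (fun a => (B.cd j a : g)) a)
        (expVec (fun a => (B.c j a : g)) a) =
      ∑ a ∈ modes B.d True N, β (eigenProj L (L.ω ^ j.val) (expDual (fun a => (B.bd 0 0 a : g)) a))
        (expVec (fun a => (B.b 0 0 a : g)) a) := by
  refine sum_exp_change L β _ _ _ _ (fun x => ∑ a, L.form x (B.c j a : g) • (B.cd j a : g))
    (fun _ => rfl) (fun _ => B.b_reproduce 0 0 _) _ (eigenProj_mode B j) ?_ ?_ N
  · intro h
    rw [h, ZMod.val_zero, pow_zero]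
    exact ⟨eigenProj_one (σt_K L), eigenProj_one (σt_D L)⟩
  · intro h
    have h1 : L.ω ^ j.val ≠ 1 := fun h' => h (omega_val_eq_one.1 h')
    have h2 : (L.ω ^ j.val) ^ T = 1 := by rw [← pow_mul, mul_comm, pow_mul, L.ω_prim.pow_eq_one, one_pow]
    exact ⟨eigenProj_zero h2 h1 (σt_K L), eigenProj_zero h2 h1 (σt_D L)⟩

end ChangeOfBasis

/-! ### Sums over slots and absorption of translates by the average. -/

section SlotSums

variable {T : ℕ} [NeZero T] {ω : ℂ} {Z : Divisor T ω}

/-- `slotOf` becomes a bijection once only the value `false` is kept at complex points. -/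
theorem sum_slot (hω : IsPrimitiveRoot ω T) {M : Type*} [AddCommMonoid M] (h : Slot Z → M) :
    ∑ s, h s = ∑ x : {x : ℂ // x ∈ Z.cplxPts}, ∑ p : Fin (Z.n x), h (slotOf (.cplx x p false)) +
      ((∑ l : ZMod T, ∑ x : {x : ℂ // x ∈ Z.realPts l}, ∑ p : Fin (Z.n x),
        h (slotOf (.real l x p))) +
      (∑ p : Fin (Z.n 0), h (slotOf (.zero p)) + ∑ q : Fin (Z.nInf - 1), h (slotOf (.inf q)))) := by
  let J : Type := (Σ x : {x : ℂ // x ∈ Z.cplxPts}, Fin (Z.n x)) ⊕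
    ((Σ (k : ZMod T) (x : {x : ℂ // x ∈ Z.realPts k}), Fin (Z.n x)) ⊕
      (Fin (Z.n 0) ⊕ Fin (Z.nInf - 1)))
  let f : J → FIdx Z := Sum.elim (fun y => .cplx y.1 y.2 false) .inr
  have hb : Function.Bijective fun j : J => slotOf (f j) := by
    constructor
    · intro i j hij
      rcases slotOf_eq hω hij with h | ⟨x, p, b, b', h1, h2⟩
      · rcases i with ⟨x, p⟩ | i <;> rcases j with ⟨y, q⟩ | j
        · have h' := Sum.inl.inj h
          simp only [Sigma.mk.injEq] at h'
          obtain ⟨rfl, h'⟩ := h'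
          rw [heq_eq_eq, Prod.mk.injEq] at h'
          rw [h'.1]
        · cases h
        · cases h
        · exact congrArg _ (Sum.inr.inj h)
      · rcases i with ⟨y, q⟩ | i
        · rcases j with ⟨y', q'⟩ | j
          · have h1' := Sum.inl.inj h1
            have h2' := Sum.inl.inj h2
            simp only [Sigma.mk.injEq] at h1' h2'
            obtain ⟨rfl, h1'⟩ := h1'
            obtain ⟨rfl, h2'⟩ := h2'
            rw [heq_eq_eq, Prod.mk.injEq] at h1' h2'
            rw [h1'.1, h2'.1]
          · cases h2
        · cases h1
    · intro s
      obtain ⟨i, rfl⟩ := exists_slotOf s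
      rcases i with ⟨x, p, c⟩ | i
      · exact ⟨.inl ⟨x, p⟩, rfl⟩
      · exact ⟨.inr i, rfl⟩
  rw [← hb.sum_comp, Fintype.sum_sum_type, Fintype.sum_sum_type, Fintype.sum_sum_type,
    Fintype.sum_sigma, Fintype.sum_sigma]
  refine congrArg₂ (· + ·) rfl (congrArg₂ (· + ·) ?_ rfl)
  exact Finset.sum_congr rfl fun l _ => Fintype.sum_sigma _

variable {V : Type*} [AddCommGroup V] [Module ℂ V] {S : V →ₗ[ℂ] V} {R : V →ₛₗ[starRingEnd ℂ] V}

theorem diffAvg_slotAct (hω : IsPrimitiveRoot ω T) (h0 : ω ≠ 0) (h : IsDihedral T S R)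
    {s : Slot Z} {β : DihedralGroup T} (hβ : Fixes s β) (v : V) :
    diffAvg (T := T) h0 S R (slotAct (slotWeight s)⁻¹ S R β v ⊗ₜ[ℂ] slotDiff s 1) =
      diffAvg (T := T) h0 S R (v ⊗ₜ[ℂ] slotDiff s 1) := by
  rw [← diffAvg_act hω h0 h β (v ⊗ₜ slotDiff s 1), diffAct_slotDiff, slotDiff_fixes hβ]

theorem diffAvg_mean (h0 : ω ≠ 0) (f : RatFunc ℂ) (v : ZMod T → V) {y : V ⊗[ℂ] RatFunc ℂ}
    (hv : ∀ k, diffAvg (T := T) h0 S R (v k ⊗ₜ[ℂ] f) = y) :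
    diffAvg (T := T) h0 S R (((1 / T : ℂ) • ∑ k, v k) ⊗ₜ[ℂ] f) = y := by
  have hT : (T : ℂ) ≠ 0 := Nat.cast_ne_zero.2 (NeZero.ne T)
  -- After multiplication by T the scalar is a natural number, with which the merely real linear
  -- average commutes.
  refine smul_right_injective _ hT ?_
  change (T : ℂ) • _ = (T : ℂ) • y
  have e : T • (((1 / T : ℂ) • ∑ k, v k) ⊗ₜ[ℂ] f) = (∑ k, v k) ⊗ₜ[ℂ] f := by
    rw [← Nat.cast_smul_eq_nsmul ℂ, TensorProduct.smul_tmul', smul_smul, mul_one_div_cancel hT,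
      one_smul]
  rw [Nat.cast_smul_eq_nsmul, ← map_nsmul, e, TensorProduct.sum_tmul, map_sum,
    Finset.sum_congr rfl fun k _ => hv k, Finset.sum_const, Finset.card_univ, ZMod.card,
    Nat.cast_smul_eq_nsmul]

end SlotSums

/-! ### The image in the complexified fields, and the formula in (d). -/

section Complexified

variable {g : Type*} [LieRing g] [LieAlgebra ℂ g] {T : ℕ} [NeZero T] {L : LieData g T}
  (B : BasisData L) {Z : Divisor T L.ω}

theorem fieldS_pow {W : Type*} [AddCommGroup W] [Module ℝ W] (n : ℕ) (X : AffineKM g)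
    (u : ℂ ⊗[ℝ] W) : (fieldS L ^ n : Module.End ℂ (AffineKM g ⊗[ℂ] (ℂ ⊗[ℝ] W))) (X ⊗ₜ[ℂ] u) =
      (L.σt ^ n : Module.End ℂ _) X ⊗ₜ[ℂ] u := by
  induction n with
  | zero => rfl
  | succ n ih => rw [pow_succ', pow_succ', Module.End.mul_apply, ih]; rfl

theorem slotAct_field_r {W : Type*} [AddCommGroup W] [Module ℝ W] (w : ℂ) (k : ZMod T)
    (X : AffineKM g) (u : ℂ ⊗[ℝ] W) : slotAct w (fieldS L) (fieldT L) (.r k) (X ⊗ₜ[ℂ] u) =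
      (w ^ k.val • (L.σt ^ k.val : Module.End ℂ _) X) ⊗ₜ[ℂ] u := by
  rw [slotAct_r, fieldS_pow, TensorProduct.smul_tmul']

theorem slotAct_field_sr {W : Type*} [AddCommGroup W] [Module ℝ W] (w : ℂ) (k : ZMod T)
    (X : AffineKM g) (u : ℂ ⊗[ℝ] W) : slotAct w (fieldS L) (fieldT L) (.sr k) (X ⊗ₜ[ℂ] u) =
      slotAct w L.σt L.τt (.sr k) X ⊗ₜ[ℂ] conjC u := by
  rw [slotAct_sr, slotAct_sr, fieldS_pow, TensorProduct.smul_tmul']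
  rfl

/-- The partial sums of the images of the formal fields at the points with a stabiliser, without
the conjugate terms. -/
def halfSum (i : (Σ (k : ZMod T) (x : {x : ℂ // x ∈ Z.realPts k}), Fin (Z.n x)) ⊕
      (Fin (Z.n 0) ⊕ Fin (Z.nInf - 1))) (N : ℕ) : AffineKM g ⊗[ℂ] (ℂ ⊗[ℝ] TakD g Z) :=
  ∑ a ∈ modes (dimOf B (.inr i)) (hasKD (.inr i : FIdx Z)) N,
    fieldPair (slotOf (.inr i)) (auxVec B (.inr i) a) (upVec B (.inr i) a)

theorem fieldIncl_false (x : {x : ℂ // x ∈ Z.cplxPts}) (p : Fin (Z.n x)) (N : ℕ) :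
    fieldIncl L Z (fieldSum B (gDVec B Z) (.cplx x p false) N) =
      fieldSumC B (slotOf (.cplx x p false)) N := by
  unfold fieldSum
  rw [map_sum]
  exact Finset.sum_congr rfl fun a _ => rfl

/-- The conjugate half of 1 ⊗ X is the reflection of the other half, because the first tensor factor
is fixed by that reflection. -/
theorem fieldIncl_inr (i : (Σ (k : ZMod T) (x : {x : ℂ // x ∈ Z.realPts k}), Fin (Z.n x)) ⊕
      (Fin (Z.n 0) ⊕ Fin (Z.nInf - 1))) {j : ZMod T}
    (hj : Fixes (slotOf (.inr i : FIdx Z)) (.sr j)) (N : ℕ) :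
    fieldIncl L Z (fieldSum B (gDVec B Z) (.inr i) N) = halfSum B i N +
      slotAct (slotWeight (slotOf (.inr i : FIdx Z)))⁻¹ (fieldS L) (fieldT L) (.sr j)
        (halfSum B i N) := by
  unfold fieldSum halfSum
  rw [map_sum, map_sum, ← Finset.sum_add_distrib]
  refine Finset.sum_congr rfl fun a _ => ?_
  change auxVec B (.inr i) a ⊗ₜ[ℂ] ((1 : ℂ) ⊗ₜ[ℝ] tak (slotOf (.inr i)) (upVec B (.inr i) a)) = _
  rw [fieldPair_apply, slotAct_field_sr, auxVec_fixed B i a hj, one_tmul_tak,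
    TensorProduct.tmul_add]

/-- Passing from trigonometric to exponential modes and then from g_{k,p} to g_{0,0} leaves the
canonical tensor unchanged, level by level. -/
theorem halfSum_real (l : ZMod T) (x : {x : ℂ // x ∈ Z.realPts l}) (p : Fin (Z.n x)) (N : ℕ) :
    halfSum B (.inl ⟨l, x, p⟩) N = fieldSumC B (slotOf (.real l x p)) N :=
  (trig_sum (P := True) (fieldPair (slotOf (.real l x p)))
    (fun a => (B.b l ((p : ℕ) : ZMod T) a : g)) (fun a => (B.bd l ((p : ℕ) : ZMod T) a : g))
    (kappa_mul B _) N).trans (sum_change_real B _ l _ N)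

theorem pair_eigenProj (s : Slot Z) (w : ℂ) (X Y : AffineKM g) :
    fieldPair s (eigenProj L w X) Y =
      (1 / T : ℂ) • ∑ k : ZMod T, slotAct w (fieldS L) (fieldT L) (.r k) (fieldPair s X Y) := by
  unfold eigenProj
  rw [map_smul, map_sum, LinearMap.smul_apply, LinearMap.sum_apply]
  congr 1
  exact Finset.sum_congr rfl fun k _ => (slotAct_field_r w k X (cplxVec g s Y)).symm

/-- Here the basis spans only an eigenspace, and the projection onto it appears as a mean over
rotations. -/
theorem halfSum_eigen (s : Slot Z) (j : ZMod T) (hw : slotWeight s = (L.ω ^ j.val)⁻¹) (N : ℕ) :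
    ∑ a ∈ modes (B.m j) (j = 0) N,
      fieldPair s (trigDual (-Complex.I) (fun a => (B.cd j a : g)) a)
        (trigVec Complex.I (fun a => (B.c j a : g)) a) =
      (1 / T : ℂ) • ∑ k : ZMod T, slotAct (slotWeight s)⁻¹ (fieldS L) (fieldT L) (.r k)
        (fieldSumC B s N) := by
  rw [trig_sum (fieldPair s) _ _ kappa_one N, sum_change_eigen B (fieldPair s) j N, hw, inv_inv]
  simp only [pair_eigenProj]
  rw [← Finset.smul_sum, Finset.sum_comm]
  congr 1
  refine Finset.sum_congr rfl fun k _ => ?_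
  unfold fieldSumC
  rw [map_sum]
  rfl

variable (L Z) in
/-- The completed action of `s` on complexified formal fields. -/
abbrev fieldsSC : FieldsC g Z →ₗ[ℂ] FieldsC g Z :=
  complMap (fieldS L) (fieldFil_le_fieldS L (takFil g Z))

variable (L Z) in
/-- The completed action of `t` on complexified formal fields. -/
abbrev fieldsTC : FieldsC g Z →ₛₗ[starRingEnd ℂ] FieldsC g Z :=
  complMap (fieldT L) (fieldFil_le_fieldT L (takFil g Z))

variable (L Z) in
/-- The map from formal fields to complexified formal fields. -/
abbrev fieldsInclC : Fields L Z →ₗ[ℂ] FieldsC g Z :=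
  complMap (fieldIncl L Z) (fieldFil_le_fieldIncl L Z)

theorem isDihedral_fieldsC : IsDihedral T (fieldsSC L Z) (fieldsTC L Z) :=
  isDihedral_compl L.isDihedral_field _ _

theorem fieldIncl_fieldS (v : AffineKM g ⊗[ℂ] (ℂ ⊗[ℝ] gD L Z)) :
    fieldIncl L Z (fieldS L v) = fieldS L (fieldIncl L Z v) := by
  induction v using TensorProduct.induction_on with
  | zero => simp
  | tmul X u => rfl
  | add x y hx hy => simp only [map_add, hx, hy]

theorem fieldIncl_fieldT (v : AffineKM g ⊗[ℂ] (ℂ ⊗[ℝ] gD L Z)) :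
    fieldIncl L Z (fieldT L v) = fieldT L (fieldIncl L Z v) := by
  induction v using TensorProduct.induction_on with
  | zero => simp
  | tmul X u =>
    change L.τt X ⊗ₜ[ℂ] gDIncl L Z (conjC u) = L.τt X ⊗ₜ[ℂ] conjC (gDIncl L Z u)
    rw [gDIncl_conjC]
  | add x y hx hy => simp only [map_add, hx, hy]

theorem fieldsInclC_S (a : Fields L Z) :
    fieldsInclC L Z (fieldsS L Z a) = fieldsSC L Z (fieldsInclC L Z a) := by
  refine Completion.ext fun n => ?_
  obtain ⟨v, hv⟩ := Completion.exists_isLim_const a n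
  rw [← proj_complMap _ _ _ n (proj_complMap _ _ _ n hv),
    ← proj_complMap _ _ _ n (proj_complMap _ _ _ n hv), fieldIncl_fieldS]

theorem fieldsInclC_T (a : Fields L Z) :
    fieldsInclC L Z (fieldsT L Z a) = fieldsTC L Z (fieldsInclC L Z a) := by
  refine Completion.ext fun n => ?_
  obtain ⟨v, hv⟩ := Completion.exists_isLim_const a n
  rw [← proj_complMap _ _ _ n (proj_complMap _ _ _ n hv),
    ← proj_complMap _ _ _ n (proj_complMap _ _ _ n hv), fieldIncl_fieldT]

variable {A : FIdx Z → Fields L Z} {C : Slot Z → FieldsC g Z}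

theorem incl_false (hA : ∀ i, IsLim (fieldSum B (gDVec B Z) i) (A i))
    (hC : ∀ s, IsLim (fieldSumC B s) (C s)) (x : {x : ℂ // x ∈ Z.cplxPts}) (p : Fin (Z.n x)) :
    fieldsInclC L Z (A (.cplx x p false)) = C (slotOf (.cplx x p false)) :=
  (((hA _).map (fieldIncl L Z) (fieldFil_le_fieldIncl L Z)).congr
    fun N => fieldIncl_false B x p N).unique (hC _)

/-- The rotations in that mean fix 0 and ∞, so the average absorbs them; at a real point there is
nothing to absorb. -/
theorem exists_half (hC : ∀ s, IsLim (fieldSumC B s) (C s))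
    (i : (Σ (k : ZMod T) (x : {x : ℂ // x ∈ Z.realPts k}), Fin (Z.n x)) ⊕
      (Fin (Z.n 0) ⊕ Fin (Z.nInf - 1))) :
    ∃ a : FieldsC g Z, IsLim (halfSum B i) a ∧
      diffAvg (T := T) L.ω_ne (fieldsSC L Z) (fieldsTC L Z)
        (a ⊗ₜ[ℂ] slotDiff (slotOf (.inr i)) 1) =
      diffAvg (T := T) L.ω_ne (fieldsSC L Z) (fieldsTC L Z)
        (C (slotOf (.inr i)) ⊗ₜ[ℂ] slotDiff (slotOf (.inr i)) 1) := by
  have key : (∀ N, halfSum B i N = (1 / T : ℂ) • ∑ k : ZMod T,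
      slotAct (slotWeight (slotOf (.inr i : FIdx Z)))⁻¹ (fieldS L) (fieldT L) (.r k)
        (fieldSumC B (slotOf (.inr i)) N)) →
      (∀ α, Fixes (slotOf (.inr i : FIdx Z)) α) → ∃ a : FieldsC g Z, IsLim (halfSum B i) a ∧
      diffAvg (T := T) L.ω_ne (fieldsSC L Z) (fieldsTC L Z)
        (a ⊗ₜ[ℂ] slotDiff (slotOf (.inr i)) 1) =
      diffAvg (T := T) L.ω_ne (fieldsSC L Z) (fieldsTC L Z)
        (C (slotOf (.inr i)) ⊗ₜ[ℂ] slotDiff (slotOf (.inr i)) 1) := by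
    intro h1 h2
    refine ⟨(1 / T : ℂ) • ∑ k : ZMod T, slotAct (slotWeight (slotOf (.inr i : FIdx Z)))⁻¹
      (fieldsSC L Z) (fieldsTC L Z) (.r k) (C (slotOf (.inr i))), ?_, ?_⟩
    · exact ((IsLim.sum _ fun k _ => (hC _).slotAct (fieldFil_le_fieldS L (takFil g Z))
        (fieldFil_le_fieldT L (takFil g Z)) _ (.r k)).smul _).congr fun N => (h1 N).symm
    · exact diffAvg_mean L.ω_ne _ _ fun k =>
        diffAvg_slotAct L.ω_prim L.ω_ne isDihedral_fieldsC (h2 _) _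
  rcases i with ⟨l, x, p⟩ | p | q
  · exact ⟨_, (hC _).congr fun N => (halfSum_real B l x p N).symm, rfl⟩
  · exact key (halfSum_eigen B _ _ (slotWeight_zero p)) (fixes_zero p)
  · exact key (halfSum_eigen B _ _ (slotWeight_inf q)) fun _ => trivial

theorem exists_reflection (i : (Σ (k : ZMod T) (x : {x : ℂ // x ∈ Z.realPts k}), Fin (Z.n x)) ⊕
      (Fin (Z.n 0) ⊕ Fin (Z.nInf - 1))) :
    ∃ j : ZMod T, Fixes (slotOf (.inr i : FIdx Z)) (.sr j) := by
  rcases i with ⟨l, x, p⟩ | p | q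
  · exact ⟨-l, (fixes_real L.ω_prim l x p _).2 (.inr rfl)⟩
  · exact ⟨0, fixes_zero p _⟩
  · exact ⟨0, trivial⟩

/-- The half and its reflection have the same average, which accounts for the factor 2. -/
theorem diffAvg_incl (hA : ∀ i, IsLim (fieldSum B (gDVec B Z) i) (A i))
    (hC : ∀ s, IsLim (fieldSumC B s) (C s))
    (i : (Σ (k : ZMod T) (x : {x : ℂ // x ∈ Z.realPts k}), Fin (Z.n x)) ⊕
      (Fin (Z.n 0) ⊕ Fin (Z.nInf - 1))) :
    diffAvg (T := T) L.ω_ne (fieldsSC L Z) (fieldsTC L Z)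
        (fieldsInclC L Z (A (.inr i)) ⊗ₜ[ℂ] slotDiff (slotOf (.inr i)) 1) =
      diffAvg (T := T) L.ω_ne (fieldsSC L Z) (fieldsTC L Z)
        (((2 : ℂ) • C (slotOf (.inr i))) ⊗ₜ[ℂ] slotDiff (slotOf (.inr i)) 1) := by
  obtain ⟨j, hj⟩ := exists_reflection i
  obtain ⟨a, ha, e⟩ := exists_half B hC i
  have h1 : fieldsInclC L Z (A (.inr i)) = a + slotAct (slotWeight (slotOf (.inr i : FIdx Z)))⁻¹
      (fieldsSC L Z) (fieldsTC L Z) (.sr j) a :=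
    ((hA (.inr i)).map (fieldIncl L Z) (fieldFil_le_fieldIncl L Z)).unique
      ((ha.add (ha.slotAct (fieldFil_le_fieldS L (takFil g Z))
        (fieldFil_le_fieldT L (takFil g Z)) _ (.sr j))).congr
        fun N => (fieldIncl_inr B i hj N).symm)
  rw [h1, TensorProduct.add_tmul, map_add, diffAvg_slotAct L.ω_prim L.ω_ne isDihedral_fieldsC hj,
    e, two_smul, TensorProduct.add_tmul, map_add]

/-- The multiplicity 2 at complex points and the two halves at the other points lead to the same
coefficient, so a uniform sum over slots results. -/
theorem fieldsToC_canonicalImage (hA : ∀ i, IsLim (fieldSum B (gDVec B Z) i) (A i))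
    (hC : ∀ s, IsLim (fieldSumC B s) (C s)) :
    fieldsToC L Z (canonicalImage A) = diffAvg (T := T) L.ω_ne (fieldsSC L Z) (fieldsTC L Z)
      (∑ s, ((2 : ℂ) • C s) ⊗ₜ[ℂ] slotDiff s 1) := by
  have h1 : fieldsToC L Z (canonicalImage A) =
      diffAvg (T := T) L.ω_ne (fieldsSC L Z) (fieldsTC L Z)
        (TensorProduct.map (fieldsInclC L Z) LinearMap.id (polarSum A)) :=
    diffAvg_map L.ω_ne (fieldsInclC L Z) fieldsInclC_S fieldsInclC_T _
  have h2 : TensorProduct.map (fieldsInclC L Z) LinearMap.id (polarSum A) =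
      polarSum fun i => fieldsInclC L Z (A i) := by
    unfold polarSum
    rw [map_sum]
    refine Finset.sum_congr rfl fun i _ => ?_
    rw [TensorProduct.map_tmul, map_smul]
    rfl
  rw [h1, h2, polarSum_eq, sum_slot L.ω_prim]
  simp only [map_add, map_sum]
  refine congrArg₂ (· + ·) ?_ (congrArg₂ (· + ·) ?_ (congrArg₂ (· + ·) ?_ ?_))
  · refine Finset.sum_congr rfl fun x _ => Finset.sum_congr rfl fun p _ => ?_
    rw [incl_false B hA hC]
  · exact Finset.sum_congr rfl fun l _ => Finset.sum_congr rfl fun x _ =>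
      Finset.sum_congr rfl fun p _ => diffAvg_incl B hA hC (.inl ⟨l, x, p⟩)
  · exact Finset.sum_congr rfl fun p _ => diffAvg_incl B hA hC (.inr (.inl p))
  · exact Finset.sum_congr rfl fun q _ => diffAvg_incl B hA hC (.inr (.inr q))

theorem sum_slotDiff (C : Slot Z → FieldsC g Z) : ∑ s, C s ⊗ₜ[ℂ] slotDiff s 1 =
    ∑ x : {x : ℂ // x ∈ Z.n.support}, ∑ p : Fin (Z.n x), C (.inl ⟨x, p⟩) ⊗ₜ[ℂ] polarDiff x p -
      ∑ q : Fin (Z.nInf - 1), C (.inr q) ⊗ₜ[ℂ] (RatFunc.X ^ (q : ℕ) : RatFunc ℂ) := by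
  rw [Fintype.sum_sum_type, Fintype.sum_sigma, sub_eq_add_neg, ← Finset.sum_neg_distrib]
  refine congrArg₂ (· + ·) ?_ ?_
  · refine Finset.sum_congr rfl fun x _ => Finset.sum_congr rfl fun p _ => ?_
    rw [slotDiff_one_inl]
  · exact Finset.sum_congr rfl fun q _ => TensorProduct.tmul_neg _ _

theorem fieldsToC_eq (hA : ∀ i, IsLim (fieldSum B (gDVec B Z) i) (A i))
    (hC : ∀ s, IsLim (fieldSumC B s) (C s)) :
    fieldsToC L Z (canonicalImage A) = (1 / T : ℂ) • ∑ α : DihedralGroup T,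
      diffAct L.ω_ne (fieldsSC L Z) (fieldsTC L Z) α
        (∑ x : {x : ℂ // x ∈ Z.n.support}, ∑ p : Fin (Z.n x), C (.inl ⟨x, p⟩) ⊗ₜ[ℂ] polarDiff x p -
          ∑ q : Fin (Z.nInf - 1), C (.inr q) ⊗ₜ[ℂ] (RatFunc.X ^ (q : ℕ) : RatFunc ℂ)) := by
  have hT : (T : ℂ) ≠ 0 := Nat.cast_ne_zero.2 (NeZero.ne T)
  have e : ∑ s, ((2 : ℂ) • C s) ⊗ₜ[ℂ] slotDiff s 1 =
      ∑ s, C s ⊗ₜ[ℂ] slotDiff s 1 + ∑ s, C s ⊗ₜ[ℂ] slotDiff s 1 := by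
    rw [← Finset.sum_add_distrib]
    exact Finset.sum_congr rfl fun s _ => by rw [two_smul, TensorProduct.add_tmul]
  rw [fieldsToC_canonicalImage B hA hC, e, sum_slotDiff, map_add, diffAvg_complex, ← two_smul ℂ,
    smul_smul]
  congr 1
  field_simp

end Complexified

end Gaudin

end

/-! ### Assembly of (a) to (d). -/

theorem mainTheorem5 {g : Type*} [LieRing g] [LieAlgebra ℂ g] [FiniteDimensional ℂ g] {T : ℕ}
    [NeZero T] (L : LieData g T) (B : BasisData L) (Z : Divisor T L.ω) :
    ∃ (Iup : Module.Basis (Idx B Z) ℝ (gD L Z)) (Idn : Module.Basis (Idx B Z) ℝ (OmegaPiD L Z)),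
      (∀ A, (Iup A : TakD g Z) = takVec B A) ∧
      (∀ A, pairing L Z (Idn A) (Iup A) = 1) ∧
      (∀ A A', A ≠ A' → pairing L Z (Idn A) (Iup A') = 0) ∧
    ∃ (𝒜 : FIdx Z → Fields L Z) (𝒜C : Slot Z → FieldsC g Z),
      (∀ i, IsLim (fieldSum B Iup i) (𝒜 i)) ∧
      (∀ s, IsLim (fieldSumC B s) (𝒜C s)) ∧
    ∃ (Φ : Completion (R := ℝ) (V := OmegaPiD L Z ⊗[ℝ] gD L Z) (zetaFil L Z))
      (ζΦ : Fields L Z ⊗[ℂ] RatFunc ℂ),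
      IsLim (fun N => ∑ A ∈ idxUpTo B Z N, Idn A ⊗ₜ[ℝ] Iup A) Φ ∧
      zetaHat L Z Φ = complProd (fieldFil g (gDFil L Z)) ζΦ ∧
      ζΦ ∈ omegaOf Z (⊤ : Submodule ℂ (Fields L Z)) ∧
      (∀ α : DihedralGroup T, fieldAct L (gDFil L Z) α ζΦ = ζΦ) ∧
      ζΦ = (1 / T : ℂ) • ∑ k : ZMod T, fieldAct L (gDFil L Z) (.r k)
            (∑ x : {x : ℂ // x ∈ Z.cplxPts}, ∑ p : Fin (Z.n x),
                (𝒜 (.cplx x p false) ⊗ₜ[ℂ] polarDiff x p +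
                  𝒜 (.cplx x p true) ⊗ₜ[ℂ] polarDiff (starRingEnd ℂ x) p) +
              ∑ l : ZMod T, ∑ x : {x : ℂ // x ∈ Z.realPts l}, ∑ p : Fin (Z.n x),
                𝒜 (.real l x p) ⊗ₜ[ℂ] polarDiff x p)
          + ∑ p : Fin (Z.n 0), 𝒜 (.zero p) ⊗ₜ[ℂ] polarDiff 0 p
          - ∑ q : Fin (Z.nInf - 1), 𝒜 (.inf q) ⊗ₜ[ℂ] (RatFunc.X ^ (q : ℕ) : RatFunc ℂ) ∧
      fieldsToC L Z ζΦ = (1 / T : ℂ) • ∑ α : DihedralGroup T, fieldAct L (takFil g Z) α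
          (∑ x : {x : ℂ // x ∈ Z.n.support}, ∑ p : Fin (Z.n x),
              𝒜C (.inl ⟨x, p⟩) ⊗ₜ[ℂ] polarDiff x p
            - ∑ q : Fin (Z.nInf - 1),
              𝒜C (.inr q) ⊗ₜ[ℂ] (RatFunc.X ^ (q : ℕ) : RatFunc ℂ)) := by
  obtain ⟨Φ, hΦ⟩ := exists_canonical B (Z := Z)
  choose A hA using exists_field B (Z := Z)
  choose C hC using exists_fieldC B (Z := Z)
  -- The convergence results were proved for the explicit families; these equalities transfer them
  -- to the bundled bases.
  have e1 : (⇑(gDBasis B Z) : Idx B Z → gD L Z) = gDVec B Z := funext (gDBasis_apply B)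
  have e2 : (⇑(dualBasis B Z) : Idx B Z → OmegaPiD L Z) = dualDiff B Z :=
    funext (dualBasis_apply B)
  classical
  refine ⟨gDBasis B Z, dualBasis B Z, fun A => ?_, fun A => ?_, fun A A' h => ?_, A, C, ?_, hC,
    Φ, canonicalImage A, ?_, zetaHat_canonical B hA hΦ, canonicalImage_mem A,
    act_canonicalImage A, ?_, fieldsToC_eq B hA hC⟩
  · rw [e1]; rfl
  · rw [e1, e2, pairing_dual, if_pos rfl]
  · rw [e1, e2, pairing_dual, if_neg h]
  · rw [e1]; exact hA
  · rw [e1, e2]; exact hΦ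
  · refine (canonicalImage_eq B hA).trans ?_
    rw [rotAvg_apply]
    rfl
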